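/- Let $A$ be a commutative associative unital algebra over $\mathbb C$ with identity $e$, and let $B$ be a vertex $A$-algebroid: a complex vector space with a $\mathbb C$-bilinear map $A\times B\to B$, $(a,v)\mapsto a*v$, with $e*v=v$; a Leibniz bracket $[\cdot,\cdot]$ on $B$, i.e. $[u,[v,w]]=[[u,v],w]+[v,[u,w]]$; a homomorphism of Leibniz algebras $\pi:B\to\mathrm{Der}(A)$; a symmetric bilinear pairing $\langle\cdot,\cdot\rangle:B\times B\to A$; and a linear map $\partial:A\to B$ with $\pi\circ\partial=0$, such that for all $a,a'\in A$ and $u,v,v_1,v_2\in B$ $$\begin{gathered} a*(a'*v)-(aa')*v=\pi(v)(a)*\partial a'+\pi(v)(a')*\partial a,\qquad [u,a*v]=\pi(u)(a)*v+a*[u,v],\\ [u,v]+[v,u]=\partial\langle u,v\rangle,\qquad \pi(a*v)=a\,\pi(v),\qquad \langle a*u,v\rangle=a\langle u,v\rangle-\pi(u)(\pi(v)(a)),\\ \pi(v)\langle v_1,v_2\rangle=\langle[v,v_1],v_2\rangle+\langle v_1,[v,v_2]\rangle,\qquad \partial(aa')=a*\partial a'+a'*\partial a,\\ [v,\partial a]=\partial(\pi(v)(a)),\qquad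 \langle v,\partial a\rangle=\pi(v)(a). \end{gathered}$$ Let $\mathcal L$ be the Lie algebra $\bigl((A\oplus B)\otimes\mathbb C[t,t^{-1}]\bigr)/\{\partial f+\tfrac{d}{dt}f : f\in A\otimes\mathbb C[t,t^{-1}]\}$ (where $\partial$ acts on coefficients), spanned by the classes $v(n)$ of $v\otimes t^n$ ($v\in A\oplus B$, $n\in\mathbb Z$), with $$[a(m),a'(n)]=0,\qquad [b(m),a(n)]=(\pi(b)(a))(m+n)=-[a(n),b(m)],$$ $$[b(m),b'(n)]=[b,b'](m+n)+m\,\langle b,b'\rangle(m+n-1)$$ for $a,a'\in A$, $b,b'\in B$. Let $\mathcal L^{\ge0}$ be the span of the $v(n)$ with $n\ge0$, let $V_{\mathcal L}=U(\mathcal L)\otimes_{U(\mathcal L^{\ge0})}\mathbb C$ be the module induced from the trivial module, and let $\mathbf 1=1\otimes1$. Grade $V_{\mathcal L}$ by $\deg\mathbf 1=0$, $\deg a(n)=-n-1$ for $a\in A$ and $\deg b(n)=-n$ for $b\in B$. For an element $v$ of a vertex algebra write $Y(v,x)=\sum_{n\in\mathbb Z}v_nx^{-n-1}$ and $\mathcal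 Dv=v_{-2}\mathbf 1$. Then there is a unique vertex algebra structure on $V_{\mathcal L}$ with vacuum $\mathbf 1$ and with $(v(-1)\mathbf 1)_n=v(n)$ for all $v\in A\oplus B$ and $n\in\mathbb Z$. Let $E\subset V_{\mathcal L}$ be the span of $e(-1)\mathbf 1-\mathbf 1$ and all the vectors $a(-1)a'(-1)\mathbf 1-(aa')(-1)\mathbf 1$ and $a(-1)b(-1)\mathbf 1-(a*b)(-1)\mathbf 1$ with $a,a'\in A$, $b\in B$; let $I_B=U(\mathcal L)\,\mathbb C[\mathcal D]\,E$ and $V_B=V_{\mathcal L}/I_B$. There is a unique vertex algebra structure on $V_B$ for which the quotient map $V_{\mathcal L}\to V_B$ is a homomorphism of vertex algebras, and with the images $(V_B)_{(n)}$ of the homogeneous components of $V_{\mathcal L}$ it is an $\mathbb N$-graded vertex algebra. Moreover: 1. The linear maps $A\to V_B$ and $B\to V_B$ given by $v\mapsto v(-1)\mathbf 1$ are injective with images $(V_B)_{(0)}$ and $(V_B)_{(1)}$. Under these identifications $(V_B)_{(0)}=A$ and $(V_B)_{(1)}=B$ one has $e=\mathbf 1$, $a_{-1}a'=aa'$, $a_{-1}b=a*b$,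 $b_0a=\pi(b)(a)$, $b_0b'=[b,b']$, $b_1b'=\langle b,b'\rangle$ and $\mathcal Da=\partial a$ for $a,a'\in A$ and $b,b'\in B$. 2. $V_B$ is generated by $A\oplus B$ as a vertex algebra. 3. For every $n\ge1$, $$(V_B)_{(n)}=\mathrm{span}\{\,b_1(-n_1)\cdots b_k(-n_k)\mathbf 1 \mid b_i\in B,\ n_1\ge n_2\ge\cdots\ge n_k\ge1,\ n_1+\cdots+n_k=n\,\}.$$ -/

import Mathlib

/-- A vertex algebra over `ℂ`: a space `V` with a vacuum vector and a linear map
`Y : V → (End V)[[x, x⁻¹]]`, `Y(v, x) = ∑ vₙ x^(-n-1)`, where `vₙ` is `VertexOperator.ncoeff (Y v) n`.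
The truncation condition (`uₙ v = 0` for large `n`) is part of Mathlib's notion of vertex operator.
The Jacobi identity is written through the coefficients of `x₀^(-l-1) x₁^(-m-1) x₂^(-n-1)`;
by truncation all the sums that occur in it have only finitely many nonzero terms. -/
@[ext]
structure VertexAlgebra (V : Type*) [AddCommGroup V] [Module ℂ V] where
  vac : V
  Y : V →ₗ[ℂ] VertexOperator ℂ V
  vacuum : ∀ (n : ℤ) (v : V), VertexOperator.ncoeff (Y vac) n v = if n = -1 then v else 0
  creation_regular : ∀ (v : V) (n : ℤ), 0 ≤ n → VertexOperator.ncoeff (Y v) n vac = 0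
  creation_limit : ∀ v : V, VertexOperator.ncoeff (Y v) (-1) vac = v
  jacobi : ∀ (u v w : V) (l m n : ℤ),
    (∑ᶠ i : ℕ, ((-1 : ℤ) ^ i * Ring.choose l i) •
      (VertexOperator.ncoeff (Y u) (l + m - i) (VertexOperator.ncoeff (Y v) (n + i) w)
        - (Int.negOnePow l : ℤ) •
          VertexOperator.ncoeff (Y v) (l + n - i) (VertexOperator.ncoeff (Y u) (m + i) w)))
    = ∑ᶠ i : ℕ, Ring.choose m i •
        VertexOperator.ncoeff (Y (VertexOperator.ncoeff (Y u) (l + i) v)) (m + n - i) w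

namespace VertexAlgebra

variable {V : Type*} [AddCommGroup V] [Module ℂ V]

/-- The operator `uₙ` of a vertex algebra. -/
noncomputable def mode (𝒱 : VertexAlgebra V) (u : V) (n : ℤ) : Module.End ℂ V :=
  VertexOperator.ncoeff (𝒱.Y u) n

/-- The operator `𝒟 v = v₋₂ 𝟏`. -/
noncomputable def D (𝒱 : VertexAlgebra V) (v : V) : V := 𝒱.mode v (-2) 𝒱.vac

/-- A set generates `V` as a vertex algebra when the only subspace that contains it and the vacuum
and is closed under all products `uₙ v` is `V` itself. -/
def GeneratedBy (𝒱 : VertexAlgebra V) (s : Set V) : Prop :=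
  ∀ W : Submodule ℂ V, 𝒱.vac ∈ W →
    (∀ u ∈ W, ∀ v ∈ W, ∀ n : ℤ, 𝒱.mode u n v ∈ W) → s ⊆ W → W = ⊤

/-- `V = ∐ V₍ₙ₎` is an `ℕ`-graded vertex algebra: a `ℤ`-graded vertex algebra in which all the
components of negative degree vanish. -/
structure IsNGraded (𝒱 : VertexAlgebra V) (G : ℤ → Submodule ℂ V) : Prop where
  isInternal : DirectSum.IsInternal G
  eq_bot_of_neg : ∀ n : ℤ, n < 0 → G n = ⊥
  vac_mem : 𝒱.vac ∈ G 0
  mode_mem : ∀ (k n m : ℤ), ∀ u ∈ G k, ∀ v ∈ G n, 𝒱.mode u m v ∈ G (k + n - m - 1)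

/-- A linear map that preserves the vacuum and all the products `uₙ v`. -/
structure IsHom {V' : Type*} [AddCommGroup V'] [Module ℂ V'] (𝒱 : VertexAlgebra V)
    (𝒱' : VertexAlgebra V') (f : V →ₗ[ℂ] V') : Prop where
  map_vac : f 𝒱.vac = 𝒱'.vac
  map_mode : ∀ (u v : V) (n : ℤ), f (𝒱.mode u n v) = 𝒱'.mode (f u) n (f v)

end VertexAlgebra

/-- A `1`-truncated conformal algebra `C₀ ⊕ C₁`. For degree reasons the only products `u₀ v`, `u₁ v`
of homogeneous elements that can be nonzero are the following four, and the axioms listed are the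
components of the derivation, commutativity and associativity axioms that are not `0 = 0`. -/
structure OneTruncatedConformalAlgebra (C₀ C₁ : Type*) [AddCommGroup C₀] [Module ℂ C₀]
    [AddCommGroup C₁] [Module ℂ C₁] where
  /-- `∂ : C₀ → C₁` -/
  d : C₀ →ₗ[ℂ] C₁
  /-- `a₀ u ∈ C₀` for `a ∈ C₀`, `u ∈ C₁` -/
  zero01 : C₀ →ₗ[ℂ] C₁ →ₗ[ℂ] C₀
  /-- `u₀ a ∈ C₀` for `u ∈ C₁`, `a ∈ C₀` -/
  zero10 : C₁ →ₗ[ℂ] C₀ →ₗ[ℂ] C₀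
  /-- `u₀ v ∈ C₁` for `u, v ∈ C₁` -/
  zero11 : C₁ →ₗ[ℂ] C₁ →ₗ[ℂ] C₁
  /-- `u₁ v ∈ C₀` for `u, v ∈ C₁` -/
  one11 : C₁ →ₗ[ℂ] C₁ →ₗ[ℂ] C₀
  d_zero10 : ∀ a a', zero10 (d a) a' = 0
  d_zero11 : ∀ a u, zero11 (d a) u = 0
  d_one11 : ∀ a u, one11 (d a) u = -zero01 a u
  d_comm : ∀ u a, d (zero10 u a) = zero11 u (d a)
  comm10 : ∀ u a, zero10 u a = -zero01 a u
  comm11 : ∀ u v, zero11 u v = -zero11 v u + d (one11 v u)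
  comm_one : ∀ u v, one11 u v = one11 v u
  assoc011 : ∀ a u v, zero01 a (zero11 u v) = zero10 u (zero01 a v) + zero01 (zero01 a u) v
  assoc101 : ∀ u a v, zero10 u (zero01 a v) = zero01 a (zero11 u v) + zero01 (zero10 u a) v
  assoc110 : ∀ u v a, zero10 u (zero10 v a) = zero10 v (zero10 u a) + zero10 (zero11 u v) a
  assoc111 : ∀ u v w, zero11 u (zero11 v w) = zero11 v (zero11 u w) + zero11 (zero11 u v) w
  assoc_one : ∀ u v w, zero10 u (one11 v w) = one11 v (zero11 u w) + one11 (zero11 u v) w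

/-- `L(C₀ ⊕ C₁) = (C₀ ⊕ C₁) ⊗ ℂ[t, t⁻¹]`, as pairs of Laurent polynomials with coefficients in
`C₀` and `C₁`. -/
abbrev LoopModule (C₀ C₁ : Type*) [AddCommGroup C₀] [AddCommGroup C₁] : Type _ :=
  (ℤ →₀ C₀) × (ℤ →₀ C₁)

namespace OneTruncatedConformalAlgebra

variable {C₀ C₁ : Type*} [AddCommGroup C₀] [Module ℂ C₀] [AddCommGroup C₁] [Module ℂ C₁]

/-- `a ⊗ tⁿ` for `a ∈ C₀`. -/
noncomputable def t0 (C₀ C₁ : Type*) [AddCommGroup C₀] [Module ℂ C₀] [AddCommGroup C₁]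
    [Module ℂ C₁] (n : ℤ) : C₀ →ₗ[ℂ] LoopModule C₀ C₁ :=
  LinearMap.inl ℂ _ _ ∘ₗ Finsupp.lsingle n

/-- `u ⊗ tⁿ` for `u ∈ C₁`. -/
noncomputable def t1 (C₀ C₁ : Type*) [AddCommGroup C₀] [Module ℂ C₀] [AddCommGroup C₁]
    [Module ℂ C₁] (n : ℤ) : C₁ →ₗ[ℂ] LoopModule C₀ C₁ :=
  LinearMap.inr ℂ _ _ ∘ₗ Finsupp.lsingle n

/-- The bilinear extension of `(x ⊗ tᵐ, y ⊗ tⁿ) ↦ g m n x y`. -/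
noncomputable def bilin {M N P : Type*} [AddCommGroup M] [Module ℂ M] [AddCommGroup N] [Module ℂ N]
    [AddCommGroup P] [Module ℂ P] (g : ℤ → ℤ → M →ₗ[ℂ] N →ₗ[ℂ] P) :
    (ℤ →₀ M) →ₗ[ℂ] (ℤ →₀ N) →ₗ[ℂ] P :=
  Finsupp.lsum ℂ fun m => (Finsupp.lsum ℂ fun n => (g m n).flip).flip

theorem bilin_single {M N P : Type*} [AddCommGroup M] [Module ℂ M] [AddCommGroup N] [Module ℂ N]
    [AddCommGroup P] [Module ℂ P] (g : ℤ → ℤ → M →ₗ[ℂ] N →ₗ[ℂ] P) (m n : ℤ) (x : M) (y : N) :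
    bilin g (Finsupp.single m x) (Finsupp.single n y) = g m n x y := by
  simp [bilin]

variable (C : OneTruncatedConformalAlgebra C₀ C₁)

/-- The map `∂̂ = ∂ ⊗ 1 + 1 ⊗ d/dt : L(C₀) → L(C₀ ⊕ C₁)`. -/
noncomputable def dHat : (ℤ →₀ C₀) →ₗ[ℂ] LoopModule C₀ C₁ :=
  Finsupp.lsum ℂ fun n => t1 C₀ C₁ n ∘ₗ C.d + (n : ℂ) • t0 C₀ C₁ (n - 1)

/-- The product on `L(C₀ ⊕ C₁)`; its values on monomials are computed below. -/
noncomputable def bracket : LoopModule C₀ C₁ →ₗ[ℂ] LoopModule C₀ C₁ →ₗ[ℂ] LoopModule C₀ C₁ :=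
  (bilin fun m n => C.zero01.compr₂ (t0 C₀ C₁ (m + n))).compl₁₂
      (LinearMap.fst ℂ _ _) (LinearMap.snd ℂ _ _)
  + (bilin fun m n => C.zero10.compr₂ (t0 C₀ C₁ (m + n))).compl₁₂
      (LinearMap.snd ℂ _ _) (LinearMap.fst ℂ _ _)
  + (bilin fun m n => C.zero11.compr₂ (t1 C₀ C₁ (m + n))
        + (m : ℂ) • C.one11.compr₂ (t0 C₀ C₁ (m + n - 1))).compl₁₂
      (LinearMap.snd ℂ _ _) (LinearMap.snd ℂ _ _)

theorem dHat_single (n : ℤ) (a : C₀) :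
    C.dHat (Finsupp.single n a) = t1 C₀ C₁ n (C.d a) + (n : ℂ) • t0 C₀ C₁ (n - 1) a := by
  simp [dHat]

theorem bracket_t0_t0 (m n : ℤ) (a a' : C₀) :
    C.bracket (t0 C₀ C₁ m a) (t0 C₀ C₁ n a') = 0 := by
  simp [bracket, t0]

theorem bracket_t0_t1 (m n : ℤ) (a : C₀) (u : C₁) :
    C.bracket (t0 C₀ C₁ m a) (t1 C₀ C₁ n u) = t0 C₀ C₁ (m + n) (C.zero01 a u) := by
  simp [bracket, t0, t1, bilin_single]

theorem bracket_t1_t0 (m n : ℤ) (u : C₁) (a : C₀) :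
    C.bracket (t1 C₀ C₁ m u) (t0 C₀ C₁ n a) = t0 C₀ C₁ (m + n) (C.zero10 u a) := by
  simp [bracket, t0, t1, bilin_single]

theorem bracket_t1_t1 (m n : ℤ) (u v : C₁) :
    C.bracket (t1 C₀ C₁ m u) (t1 C₀ C₁ n v)
      = t1 C₀ C₁ (m + n) (C.zero11 u v) + (m : ℂ) • t0 C₀ C₁ (m + n - 1) (C.one11 u v) := by
  simp [bracket, t0, t1, bilin_single]

theorem loop_induction {p : LoopModule C₀ C₁ → Prop} (h0 : ∀ m a, p (t0 C₀ C₁ m a))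
    (h1 : ∀ m u, p (t1 C₀ C₁ m u)) (hadd : ∀ x y, p x → p y → p (x + y)) (x : LoopModule C₀ C₁) :
    p x := by
  obtain ⟨f, g⟩ := x
  have key : ((f, g) : LoopModule C₀ C₁) = LinearMap.inl ℂ _ _ f + LinearMap.inr ℂ _ _ g := by simp
  rw [key]
  refine hadd _ _ ?_ ?_
  · induction f using Finsupp.induction_linear with
    | zero =>
      have h := h0 0 0
      rw [map_zero] at h
      rwa [map_zero]
    | add f f' h h' =>
      rw [map_add]
      exact hadd _ _ (h (by simp)) (h' (by simp))
    | single m a => exact h0 m a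
  · induction g using Finsupp.induction_linear with
    | zero =>
      have h := h0 0 0
      rw [map_zero] at h
      rwa [map_zero]
    | add f f' h h' =>
      rw [map_add]
      exact hadd _ _ (h (by simp)) (h' (by simp))
    | single m a => exact h1 m a

/-- `∂̂ L(C₀)`. -/
noncomputable def dHatRange : Submodule ℂ (LoopModule C₀ C₁) := LinearMap.range C.dHat

theorem dHat_mem (n : ℤ) (a : C₀) :
    t1 C₀ C₁ n (C.d a) + (n : ℂ) • t0 C₀ C₁ (n - 1) a ∈ C.dHatRange :=
  ⟨Finsupp.single n a, C.dHat_single n a⟩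

theorem dHatRange_le {p : Submodule ℂ (LoopModule C₀ C₁)}
    (h : ∀ n a, t1 C₀ C₁ n (C.d a) + (n : ℂ) • t0 C₀ C₁ (n - 1) a ∈ p) : C.dHatRange ≤ p := by
  rintro _ ⟨f, rfl⟩
  induction f using Finsupp.induction_linear with
  | zero => simp
  | add f f' h h' => rw [map_add]; exact p.add_mem h h'
  | single m a => rw [dHat_single]; exact h m a

theorem zero01_d (a a' : C₀) : C.zero01 a (C.d a') = 0 := by
  have h := C.comm10 (C.d a') a
  rw [C.d_zero10] at h
  simpa using h.symm

theorem one11_d (u : C₁) (a : C₀) : C.one11 u (C.d a) = C.zero10 u a := by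
  rw [C.comm_one, C.d_one11, C.comm10]

theorem bracket_mem_right (x : LoopModule C₀ C₁) {y : LoopModule C₀ C₁} (hy : y ∈ C.dHatRange) :
    C.bracket x y ∈ C.dHatRange := by
  have : C.dHatRange ≤ C.dHatRange.comap (C.bracket x) := by
    refine C.dHatRange_le fun n a => ?_
    rw [Submodule.mem_comap]
    induction x using loop_induction with
    | h0 m a' =>
      simp [map_add, bracket_t0_t1, bracket_t0_t0, zero01_d]
    | h1 m u =>
      rw [map_add, map_smul, bracket_t1_t1, bracket_t1_t0, one11_d, ← C.d_comm]
      convert C.dHat_mem (m + n) (C.zero10 u a) using 1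
      rw [show m + (n - 1) = m + n - 1 by ring, add_assoc, ← add_smul]
      push_cast
      rfl
    | hadd x y hx hy =>
      rw [map_add C.bracket x y, LinearMap.add_apply]
      exact C.dHatRange.add_mem hx hy
  exact this hy

theorem bracket_skew_mem (x y : LoopModule C₀ C₁) :
    C.bracket x y + C.bracket y x ∈ C.dHatRange := by
  induction x using loop_induction with
  | hadd x x' hx hx' =>
    rw [map_add, map_add, LinearMap.add_apply]
    convert C.dHatRange.add_mem hx hx' using 1
    abel
  | h0 m a =>
    induction y using loop_induction with
    | hadd y y' hy hy' =>
      rw [map_add, map_add, LinearMap.add_apply]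
      convert C.dHatRange.add_mem hy hy' using 1
      abel
    | h0 n a' => simp [bracket_t0_t0]
    | h1 n u =>
      rw [bracket_t0_t1, bracket_t1_t0, C.comm10, add_comm n m, ← map_add]
      simp
  | h1 m u =>
    induction y using loop_induction with
    | hadd y y' hy hy' =>
      rw [map_add, map_add, LinearMap.add_apply]
      convert C.dHatRange.add_mem hy hy' using 1
      abel
    | h0 n a' =>
      rw [bracket_t0_t1, bracket_t1_t0, C.comm10, add_comm n m, ← map_add]
      simp
    | h1 n v =>
      rw [bracket_t1_t1, bracket_t1_t1, C.comm11 u v, C.comm_one v u]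
      convert C.dHat_mem (m + n) (C.one11 u v) using 1
      rw [add_comm n m]
      push_cast
      simp only [map_add, map_neg, add_smul]
      abel

theorem bracket_mem_left {x : LoopModule C₀ C₁} (hx : x ∈ C.dHatRange) (y : LoopModule C₀ C₁) :
    C.bracket x y ∈ C.dHatRange := by
  have h := C.dHatRange.sub_mem (C.bracket_skew_mem x y) (C.bracket_mem_right y hx)
  simpa using h

theorem one11_zero11 (u v w : C₁) : C.one11 u (C.zero11 v w)
    = C.one11 (C.zero11 u v) w + C.zero01 (C.one11 u v) w + C.zero10 v (C.one11 u w) := by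
  have h1 := C.assoc_one v u w
  rw [C.comm11 v u, map_add, map_neg, LinearMap.add_apply, LinearMap.neg_apply, C.d_one11] at h1
  rw [h1]
  abel

theorem bracket_leibniz (x y z : LoopModule C₀ C₁) :
    C.bracket x (C.bracket y z) = C.bracket (C.bracket x y) z + C.bracket y (C.bracket x z) := by
  have e1 : ∀ a b c : ℤ, b + (a + c) = a + (b + c) := fun a b c => by ring
  induction x using loop_induction with
  | hadd x x' hx hx' =>
    simp only [map_add, LinearMap.add_apply, hx, hx']
    abel
  | h0 m a =>
    induction y using loop_induction with
    | hadd y y' hy hy' =>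
      simp only [map_add, LinearMap.add_apply, hy, hy']
      abel
    | h0 n b =>
      induction z using loop_induction with
      | hadd z z' hz hz' =>
        simp only [map_add, hz, hz']
        abel
      | h0 k c => simp [bracket_t0_t0]
      | h1 k c => simp [bracket_t0_t0, bracket_t0_t1]
    | h1 n b =>
      induction z using loop_induction with
      | hadd z z' hz hz' =>
        simp only [map_add, hz, hz']
        abel
      | h0 k c => simp [bracket_t0_t0, bracket_t0_t1, bracket_t1_t0]
      | h1 k c =>
        simp only [bracket_t0_t0, bracket_t0_t1, bracket_t1_t0, bracket_t1_t1, map_add, map_smul,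
          smul_zero, add_zero, C.assoc011, e1 m n k, add_assoc m n k]
        abel
  | h1 m a =>
    induction y using loop_induction with
    | hadd y y' hy hy' =>
      simp only [map_add, LinearMap.add_apply, hy, hy']
      abel
    | h0 n b =>
      induction z using loop_induction with
      | hadd z z' hz hz' =>
        simp only [map_add, hz, hz']
        abel
      | h0 k c => simp [bracket_t0_t0, bracket_t1_t0]
      | h1 k c =>
        simp only [bracket_t0_t0, bracket_t0_t1, bracket_t1_t0, bracket_t1_t1, map_add, map_smul,
          smul_zero, add_zero, C.assoc101, e1 m n k, add_assoc m n k]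
        abel
    | h1 n b =>
      induction z using loop_induction with
      | hadd z z' hz hz' =>
        simp only [map_add, hz, hz']
        abel
      | h0 k c =>
        simp only [bracket_t0_t0, bracket_t1_t0, bracket_t1_t1, map_add, map_smul,
          smul_zero, add_zero, C.assoc110 a b c, e1 m n k, add_assoc m n k, LinearMap.add_apply,
          LinearMap.smul_apply]
        abel
      | h1 k c =>
        have e2 : m + (n + k - 1) = m + (n + k) - 1 := by ring
        have e3 : n + (m + k - 1) = m + (n + k) - 1 := by ring
        have e4 : m + n - 1 + k = m + (n + k) - 1 := by ring
        simp only [bracket_t0_t1, bracket_t1_t0, bracket_t1_t1, map_add, map_smul,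
          C.assoc111 a b c, C.assoc_one a b c, C.one11_zero11 a b c, e1 m n k, add_assoc m n k,
          LinearMap.add_apply, LinearMap.smul_apply, e2, e3, e4]
        push_cast
        module

/-- The bracket induced on `L(C₀ ⊕ C₁)/∂̂ L(C₀)`. -/
noncomputable def quotBracket :
    (LoopModule C₀ C₁ ⧸ C.dHatRange) →ₗ[ℂ] (LoopModule C₀ C₁ ⧸ C.dHatRange) →ₗ[ℂ]
      (LoopModule C₀ C₁ ⧸ C.dHatRange) :=
  C.dHatRange.liftQ
    (LinearMap.flip (C.dHatRange.liftQ (C.bracket.compr₂ C.dHatRange.mkQ).flip (by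
      intro y hy
      rw [LinearMap.mem_ker]
      refine LinearMap.ext fun x => ?_
      exact (Submodule.Quotient.mk_eq_zero _).2 (C.bracket_mem_right x hy)))) (by
    intro x hx
    rw [LinearMap.mem_ker]
    refine LinearMap.ext fun y => ?_
    induction y using Submodule.Quotient.induction_on with
    | H y => exact (Submodule.Quotient.mk_eq_zero _).2 (C.bracket_mem_left hx y))

theorem quotBracket_mk (x y : LoopModule C₀ C₁) :
    C.quotBracket (C.dHatRange.mkQ x) (C.dHatRange.mkQ y) = C.dHatRange.mkQ (C.bracket x y) := rfl

/-- The Lie algebra `𝓛 = L(C₀ ⊕ C₁)/∂̂ L(C₀)`. -/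
def LieAlg : Type _ := LoopModule C₀ C₁ ⧸ C.dHatRange

noncomputable instance : AddCommGroup C.LieAlg :=
  inferInstanceAs (AddCommGroup (LoopModule C₀ C₁ ⧸ C.dHatRange))

noncomputable instance : Module ℂ C.LieAlg :=
  inferInstanceAs (Module ℂ (LoopModule C₀ C₁ ⧸ C.dHatRange))

/-- The natural map `ρ : L(C₀ ⊕ C₁) → 𝓛`. -/
noncomputable def rho : LoopModule C₀ C₁ →ₗ[ℂ] C.LieAlg := C.dHatRange.mkQ

theorem rho_surjective : Function.Surjective C.rho := Submodule.mkQ_surjective _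

noncomputable instance : Bracket C.LieAlg C.LieAlg := ⟨fun x y => C.quotBracket x y⟩

theorem rho_bracket (x y : LoopModule C₀ C₁) : ⁅C.rho x, C.rho y⁆ = C.rho (C.bracket x y) := rfl

noncomputable instance : LieRing C.LieAlg where
  add_lie x y z := C.quotBracket.map_add₂ x y z
  lie_add x y z := (C.quotBracket x).map_add y z
  lie_self x := by
    obtain ⟨x, rfl⟩ := C.rho_surjective x
    rw [rho_bracket]
    refine (Submodule.Quotient.mk_eq_zero _).2 ?_
    have h := C.dHatRange.smul_mem (2⁻¹ : ℂ) (C.bracket_skew_mem x x)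
    rwa [← two_smul ℂ, smul_smul, inv_mul_cancel₀ two_ne_zero, one_smul] at h
  leibniz_lie x y z := by
    obtain ⟨x, rfl⟩ := C.rho_surjective x
    obtain ⟨y, rfl⟩ := C.rho_surjective y
    obtain ⟨z, rfl⟩ := C.rho_surjective z
    simp only [rho_bracket, C.bracket_leibniz x y z, map_add]

noncomputable instance : LieAlgebra ℂ C.LieAlg where
  lie_smul c x y := (C.quotBracket x).map_smul c y

attribute [local instance 100] LieRing.ofAssociativeRing

/-- `a(n) = ρ(a ⊗ tⁿ)` for `a ∈ C₀`, as an element of `U(𝓛)`. -/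
noncomputable def m0 (n : ℤ) : C₀ →ₗ[ℂ] UniversalEnvelopingAlgebra ℂ C.LieAlg :=
  (UniversalEnvelopingAlgebra.ι ℂ : C.LieAlg →ₗ⁅ℂ⁆ _).toLinearMap ∘ₗ C.rho ∘ₗ t0 C₀ C₁ n

/-- `u(n) = ρ(u ⊗ tⁿ)` for `u ∈ C₁`, as an element of `U(𝓛)`. -/
noncomputable def m1 (n : ℤ) : C₁ →ₗ[ℂ] UniversalEnvelopingAlgebra ℂ C.LieAlg :=
  (UniversalEnvelopingAlgebra.ι ℂ : C.LieAlg →ₗ⁅ℂ⁆ _).toLinearMap ∘ₗ C.rho ∘ₗ t1 C₀ C₁ n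

/-- `𝓛^{≥ 0} = ρ((C₀ ⊕ C₁) ⊗ ℂ[t])`. -/
noncomputable def nonnegPart : Submodule ℂ C.LieAlg :=
  Submodule.span ℂ {x | ∃ n : ℤ, 0 ≤ n ∧
    ((∃ a, x = C.rho (t0 C₀ C₁ n a)) ∨ (∃ u, x = C.rho (t1 C₀ C₁ n u)))}

/-- The left ideal `U(𝓛) 𝓛^{≥ 0}`. -/
noncomputable def vacIdeal : Submodule (UniversalEnvelopingAlgebra ℂ C.LieAlg)
    (UniversalEnvelopingAlgebra ℂ C.LieAlg) :=
  Submodule.span _ (UniversalEnvelopingAlgebra.ι ℂ '' (C.nonnegPart : Set C.LieAlg))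

/-- The induced module `V_𝓛 = U(𝓛) ⊗_{U(𝓛^{≥ 0})} ℂ` of the trivial module `ℂ`, in the form
`U(𝓛)/U(𝓛) 𝓛^{≥ 0}`. -/
abbrev VL : Type _ := UniversalEnvelopingAlgebra ℂ C.LieAlg ⧸ C.vacIdeal

/-- The vector `𝟏 = 1 ⊗ 1` of `V_𝓛`. -/
noncomputable def one : C.VL := C.vacIdeal.mkQ 1

/-- The vertex algebra structures on `V_𝓛` with vacuum `𝟏` and `Y(u, x) = ∑ u(n) x^(-n-1)` for
`u ∈ C₀ ⊕ C₁`, where `u` is identified with `u(-1)𝟏`. -/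
structure IsCanonical (𝒱 : VertexAlgebra C.VL) : Prop where
  vac_eq : 𝒱.vac = C.one
  mode_zero : ∀ (a : C₀) (n : ℤ) (v : C.VL), 𝒱.mode (C.m0 (-1) a • C.one) n v = C.m0 n a • v
  mode_one : ∀ (u : C₁) (n : ℤ) (v : C.VL), 𝒱.mode (C.m1 (-1) u • C.one) n v = C.m1 n u • v

/-- The vectors of `V_𝓛` obtained from `𝟏` by applying operators `a(m)` (of degree `-m-1`) and `u(m)`
(of degree `-m`), `a ∈ C₀`, `u ∈ C₁`, of total degree `n`. -/
inductive IsMonomial : ℤ → C.VL → Prop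
  | one : IsMonomial 0 C.one
  | zero_mode (a : C₀) (m n : ℤ) (v : C.VL) :
      IsMonomial n v → IsMonomial (n - m - 1) (C.m0 m a • v)
  | one_mode (u : C₁) (m n : ℤ) (v : C.VL) :
      IsMonomial n v → IsMonomial (n - m) (C.m1 m u • v)

/-- The homogeneous component `(V_𝓛)₍ₙ₎`, for the grading of the `𝓛`-module `V_𝓛` by `deg 𝟏 = 0`. -/
noncomputable def gradeVL (n : ℤ) : Submodule ℂ C.VL := Submodule.span ℂ {v | C.IsMonomial n v}

end OneTruncatedConformalAlgebra

/-- A vertex `A`-algebroid structure on the complex vector space `B`. -/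
structure VertexAlgebroid (A B : Type*) [CommRing A] [Algebra ℂ A] [AddCommGroup B]
    [Module ℂ B] where
  /-- the (nonassociative) action `a * v` -/
  act : A →ₗ[ℂ] B →ₗ[ℂ] B
  one_act : ∀ v, act 1 v = v
  /-- the Leibniz bracket `[u, v]` -/
  br : B →ₗ[ℂ] B →ₗ[ℂ] B
  br_leibniz : ∀ u v w, br u (br v w) = br (br u v) w + br v (br u w)
  /-- the anchor `π : B → Der(A)` -/
  anchor : B →ₗ[ℂ] Derivation ℂ A A
  anchor_br : ∀ u v, anchor (br u v) = ⁅anchor u, anchor v⁆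
  /-- the symmetric pairing `⟨u, v⟩` -/
  pair : B →ₗ[ℂ] B →ₗ[ℂ] A
  pair_symm : ∀ u v, pair u v = pair v u
  /-- the map `∂ : A → B` -/
  d : A →ₗ[ℂ] B
  anchor_d : ∀ a, anchor (d a) = 0
  act_act : ∀ a a' v,
    act a (act a' v) - act (a * a') v = act (anchor v a) (d a') + act (anchor v a') (d a)
  br_act : ∀ u a v, br u (act a v) = act (anchor u a) v + act a (br u v)
  br_add_br : ∀ u v, br u v + br v u = d (pair u v)
  anchor_act : ∀ a v, anchor (act a v) = a • anchor v
  pair_act : ∀ a u v, pair (act a u) v = a * pair u v - anchor u (anchor v a)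
  anchor_pair : ∀ v v₁ v₂, anchor v (pair v₁ v₂) = pair (br v v₁) v₂ + pair v₁ (br v v₂)
  d_mul : ∀ a a', d (a * a') = act a (d a') + act a' (d a)
  br_d : ∀ v a, br v (d a) = d (anchor v a)
  pair_d : ∀ v a, pair v (d a) = anchor v a

namespace VertexAlgebroid

variable {A B : Type*} [CommRing A] [Algebra ℂ A] [AddCommGroup B] [Module ℂ B]

/-- The bilinear map `(u, a) ↦ π(u)(a)`. -/
noncomputable def anchorBilin (S : VertexAlgebroid A B) : B →ₗ[ℂ] A →ₗ[ℂ] A where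
  toFun u := (S.anchor u).toLinearMap
  map_add' u v := by ext a; simp
  map_smul' c u := by ext a; simp

/-- The `1`-truncated conformal algebra `A ⊕ B` of a vertex `A`-algebroid `B`:
`u₀ a = π(u)(a) = -a₀ u`, `u₀ v = [u, v]`, `u₁ v = ⟨u, v⟩`. -/
noncomputable def toConformal (S : VertexAlgebroid A B) : OneTruncatedConformalAlgebra A B where
  d := S.d
  zero01 := -S.anchorBilin.flip
  zero10 := S.anchorBilin
  zero11 := S.br
  one11 := S.pair
  d_zero10 a a' := by simp [anchorBilin, S.anchor_d]
  d_zero11 a u := by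
    have h := S.br_add_br (S.d a) u
    rw [S.br_d, S.pair_symm, S.pair_d] at h
    simpa using h
  d_one11 a u := by simp [anchorBilin, S.pair_symm (S.d a) u, S.pair_d]
  d_comm u a := by simp [anchorBilin, S.br_d]
  comm10 u a := by simp
  comm11 u v := by rw [S.pair_symm v u, ← S.br_add_br u v]; abel
  comm_one := S.pair_symm
  assoc011 a u v := by
    simp only [anchorBilin, LinearMap.neg_apply, LinearMap.flip_apply, LinearMap.coe_mk,
      AddHom.coe_mk, Derivation.coeFn_coe, map_neg, S.anchor_br,
      Derivation.commutator_apply]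
    ring
  assoc101 u a v := by
    simp only [anchorBilin, LinearMap.neg_apply, LinearMap.flip_apply, LinearMap.coe_mk,
      AddHom.coe_mk, Derivation.coeFn_coe, map_neg, S.anchor_br,
      Derivation.commutator_apply]
    ring
  assoc110 u v a := by
    simp only [anchorBilin, LinearMap.coe_mk, AddHom.coe_mk, Derivation.coeFn_coe, S.anchor_br,
      Derivation.commutator_apply]
    ring
  assoc111 u v w := by rw [S.br_leibniz u v w, add_comm]
  assoc_one u v w := by
    rw [add_comm]
    exact S.anchor_pair u v w

variable (S : VertexAlgebroid A B)

/-- The Lie algebra `𝓛` attached to `A ⊕ B`. -/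
abbrev Lie : Type _ := S.toConformal.LieAlg

/-- The universal enveloping algebra `U(𝓛)`. -/
abbrev U : Type _ := UniversalEnvelopingAlgebra ℂ S.Lie

/-- The space `V_𝓛`. -/
abbrev VL : Type _ := S.toConformal.VL

/-- `a(n) ∈ U(𝓛)` for `a ∈ A`. -/
noncomputable abbrev modeA (a : A) (n : ℤ) : S.U := S.toConformal.m0 n a

/-- `b(n) ∈ U(𝓛)` for `b ∈ B`. -/
noncomputable abbrev modeB (b : B) (n : ℤ) : S.U := S.toConformal.m1 n b

/-- The vacuum vector `𝟏` of `V_𝓛`. -/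
noncomputable abbrev one : S.VL := S.toConformal.one

/-- The subspace `E` of `V_𝓛` spanned by `e - 𝟏`, `a(-1)a' - aa'` and `a(-1)b - ab`, where `A ⊕ B` is
mapped to `V_𝓛` by `v ↦ v(-1)𝟏` and `e` is the identity of `A`. -/
noncomputable def E : Submodule ℂ S.VL :=
  Submodule.span ℂ ({S.modeA 1 (-1) • S.one - S.one}
    ∪ {v | ∃ a a' : A, v = S.modeA a (-1) • S.modeA a' (-1) • S.one - S.modeA (a * a') (-1) • S.one}
    ∪ {v | ∃ (a : A) (b : B),
        v = S.modeA a (-1) • S.modeB b (-1) • S.one - S.modeB (S.act a b) (-1) • S.one})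

/-- The `𝓛`-submodule `I_B = U(𝓛) ℂ[𝒟] E` of `V_𝓛`, where `𝒟` is the operator of a vertex algebra
structure on `V_𝓛`. -/
noncomputable def idealB (𝒱 : VertexAlgebra S.VL) : Submodule S.U S.VL :=
  Submodule.span S.U {v | ∃ k : ℕ, ∃ x ∈ S.E, v = 𝒱.D^[k] x}

/-- The space `V_B = V_𝓛/I_B`. -/
abbrev VB (𝒱 : VertexAlgebra S.VL) : Type _ := S.VL ⧸ S.idealB 𝒱

/-- The quotient map `V_𝓛 → V_B`. -/
noncomputable def toVB (𝒱 : VertexAlgebra S.VL) : S.VL →ₗ[ℂ] S.VB 𝒱 :=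
  (S.idealB 𝒱).mkQ.restrictScalars ℂ

/-- The vector `𝟏` of `V_B`. -/
noncomputable def vacB (𝒱 : VertexAlgebra S.VL) : S.VB 𝒱 := S.toVB 𝒱 S.one

/-- The homogeneous component `(V_B)₍ₙ₎`, the image of `(V_𝓛)₍ₙ₎`. -/
noncomputable def gradeVB (𝒱 : VertexAlgebra S.VL) (n : ℤ) : Submodule ℂ (S.VB 𝒱) :=
  (S.toConformal.gradeVL n).map (S.toVB 𝒱)

/-- The linear map `A → V_B`, `a ↦ a(-1)𝟏`. -/
noncomputable def inA (𝒱 : VertexAlgebra S.VL) : A →ₗ[ℂ] S.VB 𝒱 where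
  toFun a := S.modeA a (-1) • S.vacB 𝒱
  map_add' a a' := by rw [modeA, map_add, add_smul]
  map_smul' c a := by rw [modeA, map_smul, smul_assoc, RingHom.id_apply]

/-- The linear map `B → V_B`, `b ↦ b(-1)𝟏`. -/
noncomputable def inB (𝒱 : VertexAlgebra S.VL) : B →ₗ[ℂ] S.VB 𝒱 where
  toFun b := S.modeB b (-1) • S.vacB 𝒱
  map_add' a a' := by rw [modeB, map_add, add_smul]
  map_smul' c a := by rw [modeB, map_smul, smul_assoc, RingHom.id_apply]

/-- The vectors `b₁(-n₁) ⋯ b_k(-n_k)𝟏` of `V_B` with `bᵢ ∈ B`, `n₁ ≥ ⋯ ≥ n_k ≥ 1` and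
`n₁ + ⋯ + n_k = n`. -/
def monomialsB (𝒱 : VertexAlgebra S.VL) (n : ℕ) : Set (S.VB 𝒱) :=
  {v | ∃ (k : ℕ) (b : Fin k → B) (p : Fin k → ℕ), Antitone p ∧ (∀ i, 1 ≤ p i) ∧ ∑ i, p i = n ∧
    v = (List.ofFn fun i => S.modeB (b i) (-(p i : ℤ))).prod • S.vacB 𝒱}

end VertexAlgebroid

/-! The vertex algebra on `V_𝓛` comes from a reconstruction theorem. The series `a(x)` and `b(x)`
are mutually local, covariant for the operator induced by `-d/dt`, regular on `𝟏`, and generate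
`V_𝓛` from it. By Dong's lemma (`MutuallyLocal.nprod`) their iterated products stay mutually local.
By Goddard's uniqueness theorem (`eq_zero_of_ncoeff_vac`) a field in the span of these products is
determined by its value on the vacuum, which gives the state-field correspondence. The Jacobi
identity is the Borcherds identity of local pairs (`MutuallyLocal.borcherds`), obtained from a
recursion in the exponent of `x₁ - x₂`. An `𝓛`-submodule stable under `𝒟` is an ideal, so `V_B`
inherits the structure.

The delicate point is that `A` and `B` are not collapsed by `I_B`. A linear map `φ : V_𝓛 → A × B` is
built that kills `I_B` and restricts to the identity on `A ⊕ B`. It is defined by letting the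
negative modes act on `A × B` as they must act on degrees 0 and 1 of `V_B`. To get a map out of
`V_𝓛` from the negative modes alone, `V_𝓛` is mapped to `U(𝓛⁻)`, where `𝓛⁻` is the span of the
negative modes. Instead of invoking the Poincaré-Birkhoff-Witt theorem, `LieSplitting.exists_rep`
constructs an `𝓛`-action on `U(𝓛⁻)` directly. The relations needed on `A × B` are axioms of the
algebroid.

That `φ` kills `I_B` uses the other half of the axioms: they say that `E` is stable under `𝓛^{≥0}`
(`modeA_smul_mem_E`, `modeB_smul_mem_E`). Then `ℂ[𝒟]E` is stable as well, so `I_B` is reached from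
it by creation operators alone, and `ker φ` is stable under those.

For the grading, the degree derivation descends to `V_B`, so the components are independent as parts
of distinct eigenspaces. To identify them, note that `a(n-1)` is a multiple of `(∂a)(n)` for `n ≠
0`, so only `a(-1)` is essential; and modulo words starting with some `b(-m)`, `a(-1)b(-m)w` is
`(a*b)(-m)w`. Hence `A` together with the words starting with a mode of `B` spans everything, and
independence of the components makes this exact in each degree (`gradeVB_eq`). Sorting the modes
gives the monomials (`gradeVB_le_orderedSpan`). -/

set_option linter.unusedSectionVars false

/-! ### Formal calculus in two variables -/

namespace FormalCalculus

variable {R R' V V' : Type*} [AddCommGroup V] [Module ℂ V] [AddCommGroup V'] [Module ℂ V']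

/-- Multiplication by `x₁` on doubly infinite formal series with parameters. -/
def shift₁ : Module.End ℂ (ℤ → ℤ → R → V) where
  toFun F p q ρ := F (p + 1) q ρ
  map_add' _ _ := rfl
  map_smul' _ _ := rfl

/-- Multiplication by `x₂`. -/
def shift₂ : Module.End ℂ (ℤ → ℤ → R → V) where
  toFun F p q ρ := F p (q + 1) ρ
  map_add' _ _ := rfl
  map_smul' _ _ := rfl

/-- Multiplication by `x₁ - x₂`. -/
def diff : Module.End ℂ (ℤ → ℤ → R → V) := shift₁ - shift₂

theorem diff_apply (F : ℤ → ℤ → R → V) (p q : ℤ) (ρ : R) :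
    diff F p q ρ = F (p + 1) q ρ - F p (q + 1) ρ := rfl

/-- Exchange of the two variables. -/
def swap : (ℤ → ℤ → R → V) →ₗ[ℂ] (ℤ → ℤ → R → V) where
  toFun F p q ρ := F q p ρ
  map_add' _ _ := rfl
  map_smul' _ _ := rfl

theorem swap_apply (F : ℤ → ℤ → R → V) (p q : ℤ) (ρ : R) : swap F p q ρ = F q p ρ := rfl

theorem swap_swap (F : ℤ → ℤ → R → V) : swap (swap F) = F := rfl

theorem diff_swap (F : ℤ → ℤ → R → V) : diff (swap F) = -swap (diff F) := by
  funext p q ρ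
  simp [diff_apply, swap_apply]

/-- Vanishing for large values of the second index, uniformly in the first. -/
def BddSnd (F : ℤ → ℤ → R → V) : Prop := ∀ ρ, ∃ N : ℤ, ∀ q, N ≤ q → ∀ p, F p q ρ = 0

theorem BddSnd.add {F G : ℤ → ℤ → R → V} (hF : BddSnd F) (hG : BddSnd G) : BddSnd (F + G) := by
  intro ρ
  obtain ⟨N, hN⟩ := hF ρ
  obtain ⟨M, hM⟩ := hG ρ
  exact ⟨max N M, fun q hq p => by
    simp [hN q (le_trans (le_max_left _ _) hq), hM q (le_trans (le_max_right _ _) hq)]⟩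

theorem BddSnd.neg {F : ℤ → ℤ → R → V} (hF : BddSnd F) : BddSnd (-F) := by
  intro ρ
  obtain ⟨N, hN⟩ := hF ρ
  exact ⟨N, fun q hq p => by simp [hN q hq]⟩

theorem BddSnd.sub {F G : ℤ → ℤ → R → V} (hF : BddSnd F) (hG : BddSnd G) : BddSnd (F - G) := by
  rw [sub_eq_add_neg]
  exact hF.add hG.neg

theorem BddSnd.map_shift₁ {F : ℤ → ℤ → R → V} (hF : BddSnd F) : BddSnd (shift₁ F) := by
  intro ρ
  obtain ⟨N, hN⟩ := hF ρ
  exact ⟨N, fun q hq p => hN q hq _⟩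

theorem BddSnd.map_shift₂ {F : ℤ → ℤ → R → V} (hF : BddSnd F) : BddSnd (shift₂ F) := by
  intro ρ
  obtain ⟨N, hN⟩ := hF ρ
  exact ⟨N, fun q hq p => hN (q + 1) (by omega) _⟩

/-- Multiplication by `x₁ - x₂` is injective on series bounded in the second variable. -/
theorem BddSnd.eq_zero_of_diff_eq_zero {F : ℤ → ℤ → R → V} (hF : BddSnd F) (h : diff F = 0) :
    F = 0 := by
  funext p q ρ
  obtain ⟨N, hN⟩ := hF ρ
  -- `F` is constant along the lines `p + q = const`, and far enough along each of them it vanishes.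
  have step : ∀ (k : ℕ) (p q : ℤ), F p q ρ = F (p - k) (q + k) ρ := by
    intro k
    induction k with
    | zero => intro p q; simp
    | succ k ih =>
      intro p q
      have h1 := congrFun (congrFun (congrFun h (p - (k + 1 : ℕ))) (q + k)) ρ
      rw [diff_apply] at h1
      rw [ih p q]
      have h2 := sub_eq_zero.1 h1
      rw [show p - ((k + 1 : ℕ) : ℤ) + 1 = p - k by push_cast; ring] at h2
      rw [h2]
      congr 1
      push_cast; ring
  rw [step (N - q).toNat]
  exact hN _ (by omega) _

theorem BddSnd.eq_of_diff_eq {F G : ℤ → ℤ → R → V} (hF : BddSnd F) (hG : BddSnd G)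
    (h : diff F = diff G) : F = G :=
  sub_eq_zero.1 ((hF.sub hG).eq_zero_of_diff_eq_zero (by rw [map_sub, h, sub_self]))

/-- Multiplication by `(x₁ - x₂)ⁿ`, expanded in nonnegative powers of `x₂`. -/
noncomputable def binomMul (n : ℤ) (F : ℤ → ℤ → R → V) : ℤ → ℤ → R → V := fun p q ρ =>
  ∑ᶠ i : ℕ, ((-1 : ℤ) ^ i * Ring.choose n i) • F (p + n - i) (q + i) ρ

theorem binomMul_eq_sum {F : ℤ → ℤ → R → V} {ρ : R} {N : ℤ} (hN : ∀ q, N ≤ q → ∀ p, F p q ρ = 0)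
    (n p q : ℤ) {K : ℕ} (hK : N ≤ q + K) : binomMul n F p q ρ
      = ∑ i ∈ Finset.range K, ((-1 : ℤ) ^ i * Ring.choose n i) • F (p + n - i) (q + i) ρ := by
  refine finsum_eq_sum_of_support_subset _ fun i hi => ?_
  rw [Finset.coe_range, Set.mem_Iio]
  by_contra hlt
  exact hi (by simp only [hN (q + i) (by omega), smul_zero])

theorem BddSnd.map_binomMul {F : ℤ → ℤ → R → V} (hF : BddSnd F) (n : ℤ) : BddSnd (binomMul n F) := by
  intro ρ
  obtain ⟨N, hN⟩ := hF ρ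
  exact ⟨N, fun q hq p => by
    rw [binomMul_eq_sum hN n p q (K := 0) (by simpa using hq), Finset.sum_range_zero]⟩

theorem binomMul_zero (F : ℤ → ℤ → R → V) : binomMul 0 F = F := by
  funext p q ρ
  rw [binomMul, finsum_eq_single _ 0]
  · simp
  · intro i hi
    rw [Ring.choose_zero_pos ℤ (Nat.pos_of_ne_zero hi)]
    simp

/-- Pascal's rule. Boundedness makes the sums finite; the term with the raised `q` uses the cutoff
`K` instead of `K + 1` so that the indices align. -/
theorem binomMul_succ {F : ℤ → ℤ → R → V} (hF : BddSnd F) (n : ℤ) :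
    binomMul (n + 1) F = diff (binomMul n F) := by
  funext p q ρ
  obtain ⟨N, hN⟩ := hF ρ
  set K := (N - q).toNat with hK
  rw [diff_apply, binomMul_eq_sum hN (n + 1) p q (K := K + 1) (by omega),
    binomMul_eq_sum hN n (p + 1) q (K := K + 1) (by omega),
    binomMul_eq_sum hN n p (q + 1) (K := K) (by omega), Finset.sum_range_succ',
    Finset.sum_range_succ' (n := K), add_sub_right_comm (Finset.sum _ _), ← Finset.sum_sub_distrib]
  congr 1
  · refine Finset.sum_congr rfl fun i _ => ?_
    have hp : Ring.choose (n + 1) (i + 1) = Ring.choose n i + Ring.choose n (i + 1) :=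
      Ring.choose_succ_succ n i
    have e1 : p + (n + 1) - ((i + 1 : ℕ) : ℤ) = p + n - i := by push_cast; ring
    have e2 : p + 1 + n - ((i + 1 : ℕ) : ℤ) = p + n - i := by push_cast; ring
    have e3 : q + ((i + 1 : ℕ) : ℤ) = q + 1 + i := by push_cast; ring
    rw [e1, e2, e3, hp, ← sub_smul]
    congr 1
    ring
  · simp [add_comm, add_left_comm]

/-- The family `binomMul n F` is characterized by `binomMul 0 F = F` and the recursion. -/
theorem binomMul_unique (H : ℤ → ℤ → ℤ → R → V) (hH : ∀ n, BddSnd (H n))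
    (hs : ∀ n, H (n + 1) = diff (H n)) (n : ℤ) : H n = binomMul n (H 0) := by
  induction n using Int.induction_on with
  | zero => rw [binomMul_zero]
  | succ n ih => rw [hs, binomMul_succ (hH 0), ih]
  | pred n ih =>
    refine (hH _).eq_of_diff_eq ((hH 0).map_binomMul _) ?_
    rw [← hs, ← binomMul_succ (hH 0), sub_add_cancel, ih]

/-- Both sides obey the recursion of `binomMul_unique`. This treats all integral exponents at once
and needs no exchange of `Φ` with an infinite sum. -/
theorem binomMul_natural (Φ : (ℤ → ℤ → R → V) → (ℤ → ℤ → R' → V'))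
    (hΦ : ∀ F, BddSnd F → BddSnd (Φ F)) (hd : ∀ F, Φ (diff F) = diff (Φ F))
    {F : ℤ → ℤ → R → V} (hF : BddSnd F) (n : ℤ) : Φ (binomMul n F) = binomMul n (Φ F) := by
  have := binomMul_unique (fun n => Φ (binomMul n F)) (fun n => hΦ _ (hF.map_binomMul n))
    (fun n => by rw [binomMul_succ hF, hd]) n
  rwa [binomMul_zero] at this

theorem binomMul_sub {F G : ℤ → ℤ → R → V} (hF : BddSnd F) (hG : BddSnd G) (n : ℤ) :
    binomMul n F - binomMul n G = binomMul n (F - G) := by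
  have := binomMul_unique (fun n => binomMul n F - binomMul n G)
    (fun n => (hF.map_binomMul n).sub (hG.map_binomMul n))
    (fun n => by rw [binomMul_succ hF, binomMul_succ hG, map_sub]) n
  simpa only [binomMul_zero] using this

/-- `(x₁ - x₂)ⁿ X - (-x₂ + x₁)ⁿ Y`, where the first power is expanded in `x₂` and the second
in `x₁`. -/
noncomputable def binomComm (n : ℤ) (X Y : ℤ → ℤ → R → V) : ℤ → ℤ → R → V :=
  binomMul n X - (Int.negOnePow n : ℤ) • swap (binomMul n (swap Y))

/-- The sign from exchanging the variables in `x₁ - x₂` is absorbed by `negOnePow`, so both halves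
of `binomComm` obey the same recursion. -/
theorem diff_swap_binomMul {Y : ℤ → ℤ → R → V} (hY : BddSnd (swap Y)) (n : ℤ) :
    diff ((Int.negOnePow n : ℤ) • swap (binomMul n (swap Y)))
      = (Int.negOnePow (n + 1) : ℤ) • swap (binomMul (n + 1) (swap Y)) := by
  rw [map_zsmul, diff_swap, ← binomMul_succ hY, Int.negOnePow_succ]
  simp

theorem binomComm_succ {X Y : ℤ → ℤ → R → V} (hX : BddSnd X) (hY : BddSnd (swap Y)) (n : ℤ) :
    binomComm (n + 1) X Y = diff (binomComm n X Y) := by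
  rw [binomComm, binomComm, map_sub, diff_swap_binomMul hY, binomMul_succ hX]

theorem binomComm_zero (X Y : ℤ → ℤ → R → V) : binomComm 0 X Y = X - Y := by
  simp [binomComm, binomMul_zero, swap_swap]

theorem diff_pow_binomComm {X Y : ℤ → ℤ → R → V} (hX : BddSnd X) (hY : BddSnd (swap Y)) (n : ℤ)
    (k : ℕ) : (diff ^ k) (binomComm n X Y) = binomComm (n + k) X Y := by
  induction k with
  | zero => simp
  | succ k ih =>
    rw [pow_succ', Module.End.mul_apply, ih, ← binomComm_succ hX hY, Nat.cast_succ, add_assoc]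

theorem binomComm_nat {X Y : ℤ → ℤ → R → V} (hX : BddSnd X) (hY : BddSnd (swap Y)) (k : ℕ) :
    binomComm k X Y = (diff ^ k) (X - Y) := by
  rw [← binomComm_zero, diff_pow_binomComm hX hY, zero_add]

/-- For a nonnegative exponent the two expansions agree, so locality of order `N` kills every
exponent from `N` on. -/
theorem binomComm_eq_zero {X Y : ℤ → ℤ → R → V} (hX : BddSnd X) (hY : BddSnd (swap Y)) {N : ℕ}
    (h : (diff ^ N) (X - Y) = 0) {n : ℤ} (hn : (N : ℤ) ≤ n) : binomComm n X Y = 0 := by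
  obtain ⟨k, rfl⟩ := Int.le.dest hn
  rw [← diff_pow_binomComm hX hY, binomComm_nat hX hY, h, map_zero]

/-- Naturality of `binomComm` with respect to maps that do not mix the two variables. -/
theorem binomComm_natural (Φ : (ℤ → ℤ → R → V) →+ (ℤ → ℤ → R' → V'))
    (hΦ : ∀ F, BddSnd F → BddSnd (Φ F)) (hΦ' : ∀ F, BddSnd F → BddSnd (swap (Φ (swap F))))
    (hd : ∀ F, Φ (diff F) = diff (Φ F)) {X Y : ℤ → ℤ → R → V} (hX : BddSnd X)
    (hY : BddSnd (swap Y)) (n : ℤ) :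
    Φ (binomComm n X Y) = binomComm n (Φ X) (Φ Y) := by
  have h2 : swap (Φ (swap (binomMul n (swap Y)))) = binomMul n (swap (Φ (swap (swap Y)))) := by
    refine binomMul_natural (fun F => swap (Φ (swap F))) hΦ' (fun F => ?_) hY n
    have : swap (diff F) = -diff (swap F) := by rw [diff_swap, neg_neg]
    rw [this, map_neg, hd, map_neg, diff_swap]
  rw [binomComm, map_sub, map_zsmul, binomMul_natural Φ hΦ hd hX, binomComm,
    show binomMul n (swap (Φ Y)) = _ from h2.symm, swap_swap]

/-- A family of series that satisfies the recursion of the Borcherds identity and vanishes for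
large `l` is determined by its values at `m = 0`. -/
theorem borcherds_of_recursion {J : ℤ → ℤ → ℤ → V}
    (hJ : ∀ l m n, J (l + 1) m n = J l (m + 1) n - J l m (n + 1)) {N : ℤ}
    (hN : ∀ l, N ≤ l → ∀ m n, J l m n = 0) (l m n : ℤ) :
    J l m n = ∑ᶠ i : ℕ, Ring.choose m i • J (l + i) 0 (m + n - i) := by
  have hsum : ∀ (l m n : ℤ) {K : ℕ}, N ≤ l + K →
      ∑ᶠ i : ℕ, Ring.choose m i • J (l + i) 0 (m + n - i)
        = ∑ i ∈ Finset.range K, Ring.choose m i • J (l + i) 0 (m + n - i) := by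
    intro l m n K hK
    refine finsum_eq_sum_of_support_subset _ fun i hi => ?_
    rw [Finset.coe_range, Set.mem_Iio]
    by_contra hlt
    exact hi (by simp only [hN (l + i) (by omega), smul_zero])
  set g : ℤ → ℤ → ℤ → V := fun l m n =>
    ∑ᶠ i : ℕ, Ring.choose m i • J (l + i) 0 (m + n - i) with hg
  -- Pascal's rule in `m` gives the right-hand side the same recursion as `J`.
  have hrec : ∀ l m n, g l (m + 1) n = g l m (n + 1) + g (l + 1) m n := by
    intro l m n
    set K := (N - l).toNat with hK
    simp only [hg]
    rw [hsum l (m + 1) n (K := K + 1) (by omega), hsum l m (n + 1) (K := K + 1) (by omega),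
      hsum (l + 1) m n (K := K) (by omega), Finset.sum_range_succ',
      Finset.sum_range_succ' (n := K), add_right_comm (Finset.sum _ _), ← Finset.sum_add_distrib]
    congr 1
    · refine Finset.sum_congr rfl fun i _ => ?_
      have e1 : m + 1 + n - ((i + 1 : ℕ) : ℤ) = m + n - i := by push_cast; ring
      have e2 : m + (n + 1) - ((i + 1 : ℕ) : ℤ) = m + n - i := by push_cast; ring
      have e3 : l + ((i + 1 : ℕ) : ℤ) = l + 1 + i := by push_cast; ring
      rw [e1, e2, e3, Ring.choose_succ_succ, add_smul, add_comm]
    · simp [add_comm, add_left_comm]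
  have hg0 : ∀ l n, g l 0 n = J l 0 n := by
    intro l n
    simp only [hg]
    rw [finsum_eq_single _ 0]
    · simp
    · intro i hi
      rw [Ring.choose_zero_pos ℤ (Nat.pos_of_ne_zero hi), zero_smul]
  -- Descending induction on `l` from the region where both sides vanish; for fixed `l`, induction
  -- on `m` in both directions from `m = 0`.
  have key : ∀ (k : ℕ) (l m n : ℤ), N ≤ l + k → J l m n = g l m n := by
    intro k
    induction k with
    | zero =>
      intro l m n hl
      rw [hN l (by simpa using hl)]
      simp only [hg]
      rw [hsum l m n (K := 0) hl, Finset.sum_range_zero]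
    | succ k ih =>
      intro l m
      induction m using Int.induction_on with
      | zero => intro n _; rw [hg0]
      | succ m ihm =>
        intro n hl
        rw [hrec, ← ihm (n + 1) hl, ← ih (l + 1) _ _ (by push_cast at hl; omega), hJ]
        abel
      | pred m ihm =>
        intro n hl
        have h1 := hrec l (-m - 1) (n - 1)
        have h2 := hJ l (-m - 1) (n - 1)
        rw [sub_add_cancel, sub_add_cancel] at h1 h2
        rw [← ihm (n - 1) hl, ← ih (l + 1) _ _ (by push_cast at hl; omega), h2] at h1
        rw [add_sub_left_comm, left_eq_add, sub_eq_zero] at h1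
        exact h1.symm
  exact key (N - l).toNat l m n (by omega)

end FormalCalculus

/-! ### Mutually local vertex operators -/

namespace FormalCalculus

open VertexOperator

variable {R R' V V' : Type*} [AddCommGroup V] [Module ℂ V] [AddCommGroup V'] [Module ℂ V']

/-- Every term of the binomial expansion contains `f ^ m` or `g ^ n`. -/
theorem pow_add_apply_eq_zero {f g : Module.End ℂ V} (h : Commute f g) {v : V} {m n : ℕ}
    (hf : (f ^ m) v = 0) (hg : (g ^ n) v = 0) : ((f + g) ^ (m + n)) v = 0 := by
  rw [h.add_pow, LinearMap.sum_apply]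
  refine Finset.sum_eq_zero fun i hi => ?_
  rw [← Nat.cast_comm, Module.End.mul_apply]
  rcases le_or_gt m i with hm | hm
  · rw [(h.pow_pow i _).eq, Module.End.mul_apply, ← Nat.sub_add_cancel hm, pow_add,
      Module.End.mul_apply, hf, map_zero, map_zero, map_zero]
  · have hn : n ≤ m + n - i := by omega
    rw [Module.End.mul_apply, ← Nat.sub_add_cancel hn, pow_add,
      Module.End.mul_apply, hg, map_zero, map_zero, map_zero]

theorem pow_intertwine {W W' : Type*} [AddCommGroup W] [Module ℂ W] [AddCommGroup W'] [Module ℂ W']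
    {f : Module.End ℂ W} {g : Module.End ℂ W'} (Φ : W → W') (h : ∀ w, g (Φ w) = Φ (f w)) (k : ℕ)
    (w : W) : (g ^ k) (Φ w) = Φ ((f ^ k) w) := by
  induction k with
  | zero => rfl
  | succ k ih => rw [pow_succ', pow_succ', Module.End.mul_apply, Module.End.mul_apply, ih, h]

theorem binomMul_of_zero (n : ℤ) : binomMul n (0 : ℤ → ℤ → R → V) = 0 := by
  funext p q ρ
  simp [binomMul]

theorem binomComm_of_zero (n : ℤ) : binomComm n (0 : ℤ → ℤ → R → V) 0 = 0 := by
  simp [binomComm, binomMul_of_zero]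

theorem binomComm_sub {X Y X' Y' : ℤ → ℤ → R → V} (hX : BddSnd X) (hY : BddSnd (swap Y))
    (hX' : BddSnd X') (hY' : BddSnd (swap Y')) (n : ℤ) :
    binomComm n X Y - binomComm n X' Y' = binomComm n (X - X') (Y - Y') := by
  rw [binomComm, binomComm, binomComm, ← binomMul_sub hX hX', map_sub swap Y Y',
    ← binomMul_sub hY hY', map_sub, smul_sub]
  abel

/-- The cutoff depends on the vector, so additivity needs one large enough for `v`, `w` and `v + w`
together. -/
theorem binomMul_isLinear {F : ℤ → ℤ → V → V'} (hF : BddSnd F)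
    (hlin : ∀ p q, IsLinearMap ℂ (F p q)) (n p q : ℤ) : IsLinearMap ℂ (binomMul n F p q) where
  map_add v w := by
    obtain ⟨N, hN⟩ := hF v
    obtain ⟨M, hM⟩ := hF w
    obtain ⟨L, hL⟩ := hF (v + w)
    set K := (max N (max M L) - q).toNat
    rw [binomMul_eq_sum hN n p q (K := K) (by omega), binomMul_eq_sum hM n p q (K := K) (by omega),
      binomMul_eq_sum hL n p q (K := K) (by omega), ← Finset.sum_add_distrib]
    simp only [(hlin _ _).map_add, smul_add]
  map_smul c v := by
    obtain ⟨N, hN⟩ := hF v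
    obtain ⟨L, hL⟩ := hF (c • v)
    set K := (max N L - q).toNat
    rw [binomMul_eq_sum hN n p q (K := K) (by omega),
      binomMul_eq_sum hL n p q (K := K) (by omega), Finset.smul_sum]
    simp only [(hlin _ _).map_smul, smul_comm c]

theorem ncoeff_bdd (f : VertexOperator ℂ V) (w : V) : ∃ N : ℤ, ∀ n, N ≤ n → ncoeff f n w = 0 :=
  ⟨-HahnSeries.order ((HahnModule.of ℂ).symm (f w)), fun n hn =>
    ncoeff_eq_zero_of_lt_order f n w (by omega)⟩

theorem ext_ncoeff {f g : VertexOperator ℂ V} (h : ∀ n w, ncoeff f n w = ncoeff g n w) :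
    f = g := by
  refine HVertexOperator.coeff_inj (funext fun n => LinearMap.ext fun w => ?_)
  rw [coeff_eq_ncoeff, coeff_eq_ncoeff, h]

/-- The coefficients of `f(x₁) g(x₂)`. -/
noncomputable def comp₂ (f g : VertexOperator ℂ V) : ℤ → ℤ → V → V :=
  fun p q w => ncoeff f p (ncoeff g q w)

theorem bddSnd_comp₂ (f g : VertexOperator ℂ V) : BddSnd (comp₂ f g) := by
  intro w
  obtain ⟨N, hN⟩ := ncoeff_bdd g w
  exact ⟨N, fun q hq p => by rw [comp₂, hN q hq, map_zero]⟩

theorem bddSnd_swap_swap_comp₂ (f g : VertexOperator ℂ V) : BddSnd (swap (swap (comp₂ f g))) :=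
  bddSnd_comp₂ f g

/-- Mutual locality: `(x₁ - x₂)ᴺ [f(x₁), g(x₂)] = 0` for some `N`. -/
def MutuallyLocal (f g : VertexOperator ℂ V) : Prop :=
  ∃ N : ℕ, (diff ^ N) (comp₂ f g - swap (comp₂ g f)) = 0

theorem diff_pow_eq_zero_of_le {F : ℤ → ℤ → R → V} {N M : ℕ} (h : (diff ^ N) F = 0) (hM : N ≤ M) :
    (diff ^ M) F = 0 := by
  rw [← Nat.sub_add_cancel hM, pow_add, Module.End.mul_apply, h, map_zero]

theorem diff_pow_swap (F : ℤ → ℤ → R → V) (k : ℕ) :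
    (diff ^ k) (swap F) = (-1 : ℤ) ^ k • swap ((diff ^ k) F) := by
  induction k with
  | zero => simp
  | succ k ih =>
    rw [pow_succ', Module.End.mul_apply, ih, map_zsmul, diff_swap, pow_succ (-1 : ℤ), mul_smul,
      neg_one_smul, Module.End.mul_apply]

theorem MutuallyLocal.symm {f g : VertexOperator ℂ V} (h : MutuallyLocal f g) :
    MutuallyLocal g f := by
  obtain ⟨N, hN⟩ := h
  refine ⟨N, ?_⟩
  have h1 : comp₂ g f - swap (comp₂ f g) = swap (-(comp₂ f g - swap (comp₂ g f))) := by
    rw [neg_sub, map_sub, swap_swap]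
  rw [h1, diff_pow_swap, map_neg, hN, neg_zero, map_zero, smul_zero]

theorem MutuallyLocal.add_right {f g h : VertexOperator ℂ V} (hg : MutuallyLocal f g)
    (hh : MutuallyLocal f h) : MutuallyLocal f (g + h) := by
  obtain ⟨N, hN⟩ := hg
  obtain ⟨M, hM⟩ := hh
  refine ⟨max N M, ?_⟩
  have : comp₂ f (g + h) - swap (comp₂ (g + h) f)
      = (comp₂ f g - swap (comp₂ g f)) + (comp₂ f h - swap (comp₂ h f)) := by
    funext p q w
    simp [comp₂, swap_apply]
    abel
  rw [this, map_add, diff_pow_eq_zero_of_le hN (le_max_left _ _),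
    diff_pow_eq_zero_of_le hM (le_max_right _ _), add_zero]

theorem MutuallyLocal.smul_right {f g : VertexOperator ℂ V} (c : ℂ) (hg : MutuallyLocal f g) :
    MutuallyLocal f (c • g) := by
  obtain ⟨N, hN⟩ := hg
  refine ⟨N, ?_⟩
  have : comp₂ f (c • g) - swap (comp₂ (c • g) f) = c • (comp₂ f g - swap (comp₂ g f)) := by
    funext p q w
    simp [comp₂, swap_apply, smul_sub]
  rw [this, map_smul, hN, smul_zero]

/-- The vertex operators local to a given one. -/
def localTo (f : VertexOperator ℂ V) : Submodule ℂ (VertexOperator ℂ V) where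
  carrier := {g | MutuallyLocal f g}
  add_mem' := MutuallyLocal.add_right
  zero_mem' := ⟨0, by funext p q w; simp [comp₂, swap_apply]⟩
  smul_mem' c _ := MutuallyLocal.smul_right c

/-- The coefficients of `(x₁ - x₂)ⁿ f(x₁) g(x₂) - (-x₂ + x₁)ⁿ g(x₂) f(x₁)`. -/
noncomputable def opComm (n : ℤ) (f g : VertexOperator ℂ V) : ℤ → ℤ → V → V :=
  binomComm n (comp₂ f g) (swap (comp₂ g f))

theorem opComm_apply (n : ℤ) (f g : VertexOperator ℂ V) (p q : ℤ) (w : V) : opComm n f g p q w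
    = binomMul n (comp₂ f g) p q w - (Int.negOnePow n : ℤ) • binomMul n (comp₂ g f) q p w := rfl

theorem opComm_succ (n : ℤ) (f g : VertexOperator ℂ V) :
    opComm (n + 1) f g = diff (opComm n f g) :=
  binomComm_succ (bddSnd_comp₂ f g) (bddSnd_comp₂ g f) n

/-- The coefficients of the product `fₙ g` of vertex operators. -/
noncomputable def nprodCoeff (n : ℤ) (f g : VertexOperator ℂ V) (q : ℤ) : Module.End ℂ V where
  toFun := opComm n f g 0 q
  map_add' v w := by
    have h1 : ∀ f g : VertexOperator ℂ V, ∀ p q, IsLinearMap ℂ (comp₂ f g p q) := fun f g p q =>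
      ⟨fun v w => by simp [comp₂], fun c v => by simp [comp₂]⟩
    simp only [opComm_apply, (binomMul_isLinear (bddSnd_comp₂ f g) (h1 f g) n 0 q).map_add,
      (binomMul_isLinear (bddSnd_comp₂ g f) (h1 g f) n q 0).map_add, smul_add]
    abel
  map_smul' c v := by
    have h1 : ∀ f g : VertexOperator ℂ V, ∀ p q, IsLinearMap ℂ (comp₂ f g p q) := fun f g p q =>
      ⟨fun v w => by simp [comp₂], fun c v => by simp [comp₂]⟩
    simp only [opComm_apply, (binomMul_isLinear (bddSnd_comp₂ f g) (h1 f g) n 0 q).map_smul,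
      (binomMul_isLinear (bddSnd_comp₂ g f) (h1 g f) n q 0).map_smul, smul_sub, smul_comm c,
      RingHom.id_apply]

/-- The `f g` half is bounded uniformly. In the `g f` half only finitely many `fᵢ w` with `i ≥ 0`
are nonzero, and `g` is truncated on each of them separately. -/
theorem nprodCoeff_bdd (n : ℤ) (f g : VertexOperator ℂ V) (w : V) :
    ∃ N : ℤ, ∀ q, N ≤ q → nprodCoeff n f g q w = 0 := by
  obtain ⟨N, hN⟩ := (bddSnd_comp₂ f g).map_binomMul n w
  obtain ⟨M, hM⟩ := bddSnd_comp₂ g f w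
  have key : ∀ K : ℕ, ∃ L : ℤ, ∀ q, L ≤ q → ∀ i < K, comp₂ g f (q + n - i) (0 + i) w = 0 := by
    intro K
    induction K with
    | zero => exact ⟨0, fun q _ i hi => absurd hi (Nat.not_lt_zero i)⟩
    | succ K ih =>
      obtain ⟨L, hL⟩ := ih
      obtain ⟨L', hL'⟩ := ncoeff_bdd g (ncoeff f (0 + K) w)
      refine ⟨max L (L' - n + K), fun q hq i hi => ?_⟩
      rcases Nat.lt_succ_iff_lt_or_eq.1 hi with h | rfl
      · exact hL q (le_trans (le_max_left _ _) hq) i h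
      · exact hL' _ (by have := le_trans (le_max_right _ _) hq; omega)
  obtain ⟨L, hL⟩ := key M.toNat
  refine ⟨max N L, fun q hq => ?_⟩
  change opComm n f g 0 q w = 0
  rw [opComm_apply, hN q (le_trans (le_max_left _ _) hq),
    binomMul_eq_sum hM n q 0 (K := M.toNat) (by omega), Finset.sum_eq_zero, smul_zero, sub_zero]
  intro i hi
  rw [hL q (le_trans (le_max_right _ _) hq) i (Finset.mem_range.1 hi), smul_zero]

/-- The vertex operator with given coefficients. -/
noncomputable def ofModes (f : ℤ → Module.End ℂ V)
    (hf : ∀ w, ∃ N : ℤ, ∀ n, N ≤ n → f n w = 0) : VertexOperator ℂ V :=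
  VertexOperator.of_coeff (fun n => f (-n - 1)) fun w => by
    obtain ⟨N, hN⟩ := hf w
    refine ⟨-N, fun n hn => ?_⟩
    by_contra hlt
    exact hn (hN _ (by omega))

theorem ncoeff_ofModes (f : ℤ → Module.End ℂ V)
    (hf : ∀ w, ∃ N : ℤ, ∀ n, N ≤ n → f n w = 0) (n : ℤ) : ncoeff (ofModes f hf) n = f n := by
  rw [ofModes, ncoeff_of_coeff, show -(-n - 1) - 1 = n by ring]

/-- The product `fₙ g` of vertex operators. -/
noncomputable def nprod (n : ℤ) (f g : VertexOperator ℂ V) : VertexOperator ℂ V :=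
  ofModes (nprodCoeff n f g) (nprodCoeff_bdd n f g)

theorem ncoeff_nprod (n : ℤ) (f g : VertexOperator ℂ V) (q : ℤ) (w : V) :
    ncoeff (nprod n f g) q w = opComm n f g 0 q w := by
  rw [nprod, ncoeff_ofModes]
  rfl

/-- The Borcherds identity for a pair of mutually local vertex operators. -/
theorem MutuallyLocal.borcherds {f g : VertexOperator ℂ V} (h : MutuallyLocal f g) (w : V)
    (l m n : ℤ) : opComm l f g m n w
      = ∑ᶠ i : ℕ, Ring.choose m i • ncoeff (nprod (l + i) f g) (m + n - i) w := by
  obtain ⟨N, hN⟩ := h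
  simp only [ncoeff_nprod]
  -- The values at `m = 0` are by definition the coefficients of the products `nprod`; locality
  -- supplies the vanishing for large `l`.
  refine borcherds_of_recursion (J := fun l m n => opComm l f g m n w) (N := N) ?_ ?_ l m n
  · intro l m n
    rw [opComm_succ, diff_apply]
  · intro l hl m n
    rw [opComm, binomComm_eq_zero (bddSnd_comp₂ f g) (bddSnd_swap_swap_comp₂ g f) hN hl]
    rfl

/-! ### Three variables and Dong's lemma -/

/-- Multiplication by a third variable. -/
def shift₃ : Module.End ℂ (ℤ → ℤ → ℤ × V → V) where
  toFun F p q ρ := F p q (ρ.1 + 1, ρ.2)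
  map_add' _ _ := rfl
  map_smul' _ _ := rfl

/-- Multiplication by `x₃ - x₁`. -/
def diff₃₁ : Module.End ℂ (ℤ → ℤ → ℤ × V → V) := shift₃ - shift₁

/-- Multiplication by `x₃ - x₂`. -/
def diff₃₂ : Module.End ℂ (ℤ → ℤ → ℤ × V → V) := shift₃ - shift₂

theorem diff₃₁_apply (F : ℤ → ℤ → ℤ × V → V) (p q : ℤ) (ρ : ℤ × V) :
    diff₃₁ F p q ρ = F p q (ρ.1 + 1, ρ.2) - F (p + 1) q ρ := rfl

theorem diff₃₂_apply (F : ℤ → ℤ → ℤ × V → V) (p q : ℤ) (ρ : ℤ × V) :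
    diff₃₂ F p q ρ = F p q (ρ.1 + 1, ρ.2) - F p (q + 1) ρ := rfl

theorem commute_diff₃₁_diff₃₂ :
    Commute (diff₃₁ : Module.End ℂ (ℤ → ℤ → ℤ × V → V)) diff₃₂ := by
  refine LinearMap.ext fun F => ?_
  funext p q ρ
  simp only [Module.End.mul_apply, diff₃₁_apply, diff₃₂_apply]
  abel

theorem commute_diff₃₁_diff :
    Commute (diff₃₁ : Module.End ℂ (ℤ → ℤ → ℤ × V → V)) diff := by
  refine LinearMap.ext fun F => ?_
  funext p q ρ
  simp only [Module.End.mul_apply, diff₃₁_apply, diff_apply]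
  abel

theorem commute_diff₃₂_diff :
    Commute (diff₃₂ : Module.End ℂ (ℤ → ℤ → ℤ × V → V)) diff := by
  refine LinearMap.ext fun F => ?_
  funext p q ρ
  simp only [Module.End.mul_apply, diff₃₂_apply, diff_apply]
  abel

theorem BddSnd.map_shift₃ {F : ℤ → ℤ → ℤ × V → V} (hF : BddSnd F) : BddSnd (shift₃ F) :=
  fun ρ => hF (ρ.1 + 1, ρ.2)

theorem BddSnd.map_pow {f : Module.End ℂ (ℤ → ℤ → R → V)} (hf : ∀ F, BddSnd F → BddSnd (f F))
    (k : ℕ) {F : ℤ → ℤ → R → V} (hF : BddSnd F) : BddSnd ((f ^ k) F) := by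
  induction k with
  | zero => exact hF
  | succ k ih => rw [pow_succ', Module.End.mul_apply]; exact hf _ ih

/-- Left multiplication by `c(x₃)`. -/
noncomputable def leftMul (c : VertexOperator ℂ V) :
    (ℤ → ℤ → V → V) →ₗ[ℂ] (ℤ → ℤ → ℤ × V → V) where
  toFun F p q ρ := ncoeff c ρ.1 (F p q ρ.2)
  map_add' F G := by funext p q ρ; simp
  map_smul' a F := by funext p q ρ; simp

/-- Right multiplication by `c(x₃)`. -/
noncomputable def rightMul (c : VertexOperator ℂ V) :
    (ℤ → ℤ → V → V) →ₗ[ℂ] (ℤ → ℤ → ℤ × V → V) where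
  toFun F p q ρ := F p q (ncoeff c ρ.1 ρ.2)
  map_add' _ _ := rfl
  map_smul' _ _ := rfl

theorem diff_leftMul (c : VertexOperator ℂ V) (F : ℤ → ℤ → V → V) :
    diff (leftMul c F) = leftMul c (diff F) := by
  funext p q ρ
  simp [diff_apply, leftMul]

theorem diff_rightMul (c : VertexOperator ℂ V) (F : ℤ → ℤ → V → V) :
    diff (rightMul c F) = rightMul c (diff F) := rfl

theorem bddSnd_leftMul (c : VertexOperator ℂ V) {F : ℤ → ℤ → V → V} (hF : BddSnd F) :
    BddSnd (leftMul c F) := by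
  intro ρ
  obtain ⟨N, hN⟩ := hF ρ.2
  exact ⟨N, fun q hq p => by simp [leftMul, hN q hq p]⟩

theorem bddSnd_rightMul (c : VertexOperator ℂ V) {F : ℤ → ℤ → V → V} (hF : BddSnd F) :
    BddSnd (rightMul c F) := fun _ => hF _

/-- `[c(x₃), F(x₁, x₂)]` for `F` the product of two vertex operators local to `c` is annihilated by
a product of powers of `x₃ - x₁` and `x₃ - x₂`. -/
theorem pow_pow_leftMul_sub_rightMul {c a b : VertexOperator ℂ V} {N : ℕ}
    (hca : (diff ^ N) (comp₂ c a - swap (comp₂ a c)) = 0)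
    (hcb : (diff ^ N) (comp₂ c b - swap (comp₂ b c)) = 0) :
    (diff₃₁ ^ N) ((diff₃₂ ^ N)
      (leftMul c (comp₂ a b) - rightMul c (comp₂ a b))) = 0 := by
  -- `[c, ab] = [c, a] b + a [c, b]`: a power of `x₃ - x₁` kills the first term and a power of `x₃ -
  -- x₂` the second.
  have hsplit : leftMul c (comp₂ a b) - rightMul c (comp₂ a b)
      = (fun p q ρ => (comp₂ c a - swap (comp₂ a c)) ρ.1 p (ncoeff b q ρ.2))
        + fun p q ρ => ncoeff a p ((comp₂ c b - swap (comp₂ b c)) ρ.1 q ρ.2) := by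
    funext p q ρ
    simp [leftMul, rightMul, comp₂, swap_apply]
  have h1 := pow_intertwine (f := diff) (g := diff₃₁)
    (fun (F : ℤ → ℤ → V → V) => (fun p q ρ => F ρ.1 p (ncoeff b q ρ.2) : ℤ → ℤ → ℤ × V → V))
    (fun F => rfl) N (comp₂ c a - swap (comp₂ a c))
  have h2 := pow_intertwine (f := diff) (g := diff₃₂)
    (fun (F : ℤ → ℤ → V → V) => (fun p q ρ => ncoeff a p (F ρ.1 q ρ.2) : ℤ → ℤ → ℤ × V → V))
    (fun F => by
      funext p q ρ
      simp [diff_apply, diff₃₂_apply]) N (comp₂ c b - swap (comp₂ b c))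
  rw [hca] at h1
  rw [hcb] at h2
  have h1' : (diff₃₁ ^ N) (fun p q ρ =>
      (comp₂ c a - swap (comp₂ a c)) ρ.1 p (ncoeff b q ρ.2) : ℤ → ℤ → ℤ × V → V) = 0 := h1
  have h2' : (diff₃₂ ^ N) (fun p q ρ =>
      ncoeff a p ((comp₂ c b - swap (comp₂ b c)) ρ.1 q ρ.2) : ℤ → ℤ → ℤ × V → V) = 0 := by
    refine h2.trans ?_
    funext p q ρ
    simp
  rw [hsplit, map_add, h2', add_zero, ← Module.End.mul_apply, (commute_diff₃₁_diff₃₂.pow_pow N N).eq,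
    Module.End.mul_apply, h1', map_zero]

/-- Dong's lemma. -/
theorem MutuallyLocal.nprod {c a b : VertexOperator ℂ V} (hca : MutuallyLocal c a)
    (hcb : MutuallyLocal c b) (hab : MutuallyLocal a b) (n : ℤ) :
    MutuallyLocal c (nprod n a b) := by
  obtain ⟨N₁, h₁⟩ := hca
  obtain ⟨N₂, h₂⟩ := hcb
  obtain ⟨N₃, h₃⟩ := hab
  set N := max N₁ (max N₂ N₃) with hN
  replace h₁ := diff_pow_eq_zero_of_le h₁ (show N₁ ≤ N by omega)
  replace h₂ := diff_pow_eq_zero_of_le h₂ (show N₂ ≤ N by omega)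
  replace h₃ := diff_pow_eq_zero_of_le h₃ (show N₃ ≤ N by omega)
  -- Then `n + K ≥ N`, so `(x₁ - x₂)ᴷ` annihilates `J`.
  set K := (N - n).toNat with hK
  set E₁ : Module.End ℂ (ℤ → ℤ → ℤ × V → V) := diff₃₁ with hE₁
  set E₂ : Module.End ℂ (ℤ → ℤ → ℤ × V → V) := diff₃₂ with hE₂
  have hE₁bdd : ∀ F, BddSnd F → BddSnd (E₁ F) := fun F hF => hF.map_shift₃.sub hF.map_shift₁
  have hE₂bdd : ∀ F, BddSnd F → BddSnd (E₂ F) := fun F hF => hF.map_shift₃.sub hF.map_shift₂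
  have hE₁₂ : Commute E₁ E₂ := commute_diff₃₁_diff₃₂
  have hE₁d : Commute E₁ diff := commute_diff₃₁_diff
  have hE₂d : Commute E₂ diff := commute_diff₃₂_diff
  have hswap₁ : ∀ (k : ℕ) F, (E₁ ^ k) (swap F) = swap ((E₂ ^ k) F) :=
    fun k F => pow_intertwine swap (fun F => rfl) k F
  have hswap₂ : ∀ (k : ℕ) F, (E₂ ^ k) (swap F) = swap ((E₁ ^ k) F) :=
    fun k F => pow_intertwine swap (fun F => rfl) k F
  set J := opComm n a b with hJ
  set G := leftMul c J - rightMul c J with hG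
  have hX := bddSnd_comp₂ a b
  have hY := bddSnd_swap_swap_comp₂ b a
  have hY' := bddSnd_comp₂ b a
  -- Commutation with `c(x₃)` does not mix `x₁` and `x₂`, so it passes inside the binomial factors.
  have hGeq : G = binomComm n (leftMul c (comp₂ a b) - rightMul c (comp₂ a b))
      (leftMul c (swap (comp₂ b a)) - rightMul c (swap (comp₂ b a))) := by
    rw [← binomComm_sub (bddSnd_leftMul c hX) (Y := leftMul c (swap (comp₂ b a)))
      (bddSnd_leftMul c hY') (bddSnd_rightMul c hX) (Y' := rightMul c (swap (comp₂ b a)))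
      (bddSnd_rightMul c hY'), hG, hJ, opComm]
    congr 1
    exact binomComm_natural (leftMul c).toAddMonoidHom (fun F hF => bddSnd_leftMul c hF)
      (fun F hF => bddSnd_leftMul c hF) (fun F => (diff_leftMul c F).symm) hX hY n
  have hEG : (E₁ ^ N) ((E₂ ^ N) G) = 0 := by
    have hnat := binomComm_natural (E₁ ^ N * E₂ ^ N : Module.End ℂ _).toAddMonoidHom
      (fun F hF => BddSnd.map_pow hE₁bdd N (BddSnd.map_pow hE₂bdd N hF))
      (fun F hF => by
        change BddSnd (swap ((E₁ ^ N) ((E₂ ^ N) (swap F))))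
        rw [hswap₂, hswap₁, swap_swap]
        exact BddSnd.map_pow hE₂bdd N (BddSnd.map_pow hE₁bdd N hF))
      (fun F => by
        change (E₁ ^ N * E₂ ^ N) (diff F) = diff ((E₁ ^ N * E₂ ^ N) F)
        rw [← Module.End.mul_apply, ← Module.End.mul_apply,
          ((hE₁d.pow_left N).mul_left (hE₂d.pow_left N)).eq])
      ((bddSnd_leftMul c hX).sub (bddSnd_rightMul c hX))
      (show BddSnd (swap (leftMul c (swap (comp₂ b a)) - rightMul c (swap (comp₂ b a)))) from
        (bddSnd_leftMul c hY').sub (bddSnd_rightMul c hY')) n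
    rw [← hGeq] at hnat
    have h4 : (E₁ ^ N) ((E₂ ^ N) (leftMul c (comp₂ a b) - rightMul c (comp₂ a b))) = 0 :=
      pow_pow_leftMul_sub_rightMul h₁ h₂
    have h5 : (E₁ ^ N) ((E₂ ^ N)
        (leftMul c (swap (comp₂ b a)) - rightMul c (swap (comp₂ b a)))) = 0 := by
      change (E₁ ^ N) ((E₂ ^ N) (swap (leftMul c (comp₂ b a) - rightMul c (comp₂ b a)))) = 0
      rw [hswap₂, hswap₁, ← Module.End.mul_apply (E₂ ^ N), ← (hE₁₂.pow_pow N N).eq, Module.End.mul_apply,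
        pow_pow_leftMul_sub_rightMul h₂ h₁, map_zero]
    change (E₁ ^ N) ((E₂ ^ N) G) = binomComm n ((E₁ ^ N) ((E₂ ^ N) _)) ((E₁ ^ N) ((E₂ ^ N) _)) at hnat
    rw [hnat, h4, h5, binomComm_of_zero]
  have hdG : (diff ^ K) G = 0 := by
    have hdJ : (diff ^ K) J = 0 := by
      rw [hJ, opComm, diff_pow_binomComm hX hY, binomComm_eq_zero hX hY h₃ (by omega)]
    rw [hG, map_sub, pow_intertwine (leftMul c) (diff_leftMul c),
      pow_intertwine (rightMul c) (diff_rightMul c), hdJ, map_zero, map_zero, sub_zero]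
  -- Write `x₃ - x₂ = (x₃ - x₁) + (x₁ - x₂)`: on `(x₃ - x₂)ᴺ G` the `N`-th power of the first
  -- summand and the `K`-th power of the second vanish.
  have hfin : (E₂ ^ (N + K)) ((E₂ ^ N) G) = 0 := by
    have hsum : E₂ = E₁ + diff := by rw [hE₁, hE₂, diff, diff₃₁, diff₃₂]; abel
    have h6 := pow_add_apply_eq_zero hE₁d hEG (n := K) (by
      rw [← Module.End.mul_apply, ← (hE₂d.pow_pow N K).eq, Module.End.mul_apply, hdG, map_zero])
    rwa [← hsum] at h6
  refine ⟨(N + K) + N, ?_⟩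
  -- Taking the coefficient `p = 0`, the residue in `x₁`, commutes with multiplication by `x₃ - x₂`
  -- and turns `J` into the product `nprod n a b`.
  have h7 := pow_intertwine (f := E₂) (g := diff)
    (fun (F : ℤ → ℤ → ℤ × V → V) => (fun r q w => F 0 q (r, w) : ℤ → ℤ → V → V))
    (fun F => rfl) ((N + K) + N) G
  have h8 : comp₂ c (FormalCalculus.nprod n a b) - swap (comp₂ (FormalCalculus.nprod n a b) c)
      = fun r q w => G 0 q (r, w) := by
    funext r q w
    simp [comp₂, swap_apply, ncoeff_nprod, hG, leftMul, rightMul, hJ]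
  rw [h8, h7, pow_add, Module.End.mul_apply, hfin]
  rfl

/-! ### Translation covariance and Goddard's theorem -/

/-- Covariance of a vertex operator: `[D, f(x)] = d/dx f(x)`. -/
def Covariant (D : Module.End ℂ V) (f : VertexOperator ℂ V) : Prop :=
  ∀ n w, D (ncoeff f n w) = ncoeff f n (D w) - n • ncoeff f (n - 1) w

/-- The operator `Γ = [D, ·] - ∂₁ - ∂₂` commutes with multiplication by `x₁ - x₂`, because `∂₁ + ∂₂`
kills it. It kills `f(x₁)g(x₂)` and `g(x₂)f(x₁)`, hence also `opComm n f g`. -/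
theorem Covariant.nprod {D : Module.End ℂ V} {f g : VertexOperator ℂ V} (hf : Covariant D f)
    (hg : Covariant D g) (n : ℤ) : Covariant D (nprod n f g) := by
  let Γ : (ℤ → ℤ → V → V) →+ (ℤ → ℤ → V → V) :=
    { toFun := fun F p q w => D (F p q w) - F p q (D w) + p • F (p - 1) q w + q • F p (q - 1) w
      map_zero' := by funext p q w; simp
      map_add' := fun F G => by
        funext p q w
        simp only [Pi.add_apply, map_add, smul_add]
        abel }
  have hΓ : ∀ F p q w, Γ F p q w
      = D (F p q w) - F p q (D w) + p • F (p - 1) q w + q • F p (q - 1) w := fun F p q w => rfl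
  have hbdd : ∀ F, BddSnd F → BddSnd (Γ F) := by
    intro F hF w
    obtain ⟨N, hN⟩ := hF w
    obtain ⟨M, hM⟩ := hF (D w)
    refine ⟨max N M + 1, fun q hq p => ?_⟩
    rw [hΓ, hN q (by omega), hM q (by omega), hN q (by omega), hN (q - 1) (by omega)]
    simp
  have hbdd' : ∀ F, BddSnd F → BddSnd (swap (Γ (swap F))) := by
    intro F hF w
    obtain ⟨N, hN⟩ := hF w
    obtain ⟨M, hM⟩ := hF (D w)
    refine ⟨max N M + 1, fun q hq p => ?_⟩
    rw [swap_apply, hΓ, swap_apply, swap_apply, swap_apply, swap_apply, hN q (by omega),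
      hM q (by omega), hN q (by omega), hN (q - 1) (by omega)]
    simp
  have hd : ∀ F, Γ (diff F) = diff (Γ F) := by
    intro F
    funext p q w
    simp only [hΓ, diff_apply, map_sub, add_sub_cancel_right, add_smul, one_smul,
      smul_sub, show p - 1 + 1 = p by ring, show q - 1 + 1 = q by ring]
    abel
  have hcomp : ∀ {f g : VertexOperator ℂ V}, Covariant D f → Covariant D g →
      ∀ p q w, Γ (comp₂ f g) p q w = 0 := by
    intro f g hf hg p q w
    rw [hΓ, comp₂, comp₂, comp₂, comp₂, hf, hg, map_sub, map_zsmul]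
    abel
  have hX : Γ (comp₂ f g) = 0 := by
    funext p q w
    exact hcomp hf hg p q w
  have hY : Γ (swap (comp₂ g f)) = 0 := by
    funext p q w
    have := hcomp hg hf q p w
    rw [hΓ] at this ⊢
    simp only [swap_apply, Pi.zero_apply]
    rw [← this]
    abel
  have key := binomComm_natural Γ hbdd hbdd' hd (bddSnd_comp₂ f g)
    (bddSnd_swap_swap_comp₂ g f) n
  rw [hX, hY, binomComm_of_zero] at key
  intro q w
  -- The residue in `x₁` removes the `∂₁` term.
  have h := congrFun (congrFun (congrFun key 0) q) w
  rw [hΓ, zero_smul, add_zero] at h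
  rw [ncoeff_nprod, ncoeff_nprod, ncoeff_nprod, opComm, eq_sub_iff_add_eq, ← sub_eq_zero]
  refine Eq.trans ?_ h
  abel

/-- On the vacuum the `g f` half involves only `fᵢ vac` with `i ≥ 0` and vanishes; at `q = -1` only
the term `i = 0` of the other half survives. -/
theorem ncoeff_nprod_vac {f g : VertexOperator ℂ V} {vac : V}
    (hf : ∀ n : ℤ, 0 ≤ n → ncoeff f n vac = 0) (hg : ∀ n : ℤ, 0 ≤ n → ncoeff g n vac = 0) (n : ℤ) :
    (∀ q : ℤ, 0 ≤ q → ncoeff (nprod n f g) q vac = 0) ∧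
      ncoeff (nprod n f g) (-1) vac = ncoeff f n (ncoeff g (-1) vac) := by
  have h1 : ∀ q : ℤ, 0 ≤ q → ∀ p, comp₂ f g p q vac = 0 := fun q hq p => by
    rw [comp₂, hg q hq, map_zero]
  have h2 : ∀ q : ℤ, 0 ≤ q → ∀ p, comp₂ g f p q vac = 0 := fun q hq p => by
    rw [comp₂, hf q hq, map_zero]
  constructor
  · intro q hq
    rw [ncoeff_nprod, opComm_apply, binomMul_eq_sum h1 n 0 q (K := 0) (by simpa using hq),
      binomMul_eq_sum h2 n q 0 (K := 0) (by simp)]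
    simp
  · rw [ncoeff_nprod, opComm_apply, binomMul_eq_sum h1 n 0 (-1) (K := 1) (by simp),
      binomMul_eq_sum h2 n (-1) 0 (K := 0) (by simp)]
    simp [comp₂]

/-- Goddard's uniqueness theorem. -/
theorem eq_zero_of_ncoeff_vac {D : Module.End ℂ V} {vac : V} (hD : D vac = 0)
    {h : VertexOperator ℂ V} (hcov : Covariant D h) (hcre : ∀ n : ℤ, 0 ≤ n → ncoeff h n vac = 0)
    (h0 : ncoeff h (-1) vac = 0)
    (hloc : ∀ v : V, ∃ f, MutuallyLocal h f ∧ (∀ n : ℤ, 0 ≤ n → ncoeff f n vac = 0) ∧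
      ncoeff f (-1) vac = v) : h = 0 := by
  -- Covariance on a vector killed by `D` gives `D hₙ vac = -n hₙ₋₁ vac`, so the vanishing
  -- propagates downwards from `n = -1`.
  have hneg : ∀ k : ℕ, ncoeff h (-(k : ℤ) - 1) vac = 0 := by
    intro k
    induction k with
    | zero => simpa using h0
    | succ k ih =>
      have h1 := hcov (-(k : ℤ) - 1) vac
      rw [ih, hD, map_zero, map_zero, zero_sub, eq_comm, neg_eq_zero, ← Int.cast_smul_eq_zsmul ℂ,
        smul_eq_zero] at h1
      rcases h1 with h1 | h1
      · exfalso
        have h2 : (-(k : ℤ) - 1) = 0 := by exact_mod_cast h1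
        omega
      · rwa [show -((k + 1 : ℕ) : ℤ) - 1 = -(k : ℤ) - 1 - 1 by push_cast; ring]
  have hall : ∀ n : ℤ, ncoeff h n vac = 0 := by
    intro n
    rcases le_or_gt 0 n with hn | hn
    · exact hcre n hn
    · have := hneg (-n - 1).toNat
      rwa [show -(((-n - 1).toNat : ℕ) : ℤ) - 1 = n by omega] at this
  refine ext_ncoeff fun n v => ?_
  obtain ⟨f, ⟨N, hN⟩, hf, rfl⟩ := hloc v
  have h1 : ∀ q : ℤ, 0 ≤ q → ∀ p, comp₂ h f p q vac = 0 := fun q hq p => by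
    rw [comp₂, hf q hq, map_zero]
  -- Locality on the vacuum. At second index `-1` only the leading binomial term survives, and first
  -- index `n - N` makes it `hₙ f₋₁ vac`; the opposite order vanishes since `h` kills the vacuum.
  have h2 := congrFun (congrFun (congrFun (binomComm_eq_zero (bddSnd_comp₂ h f)
    (bddSnd_swap_swap_comp₂ f h)    hN le_rfl) (n - N)) (-1)) vac
  change opComm N h f (n - N) (-1) vac = 0 at h2
  rw [opComm_apply, binomMul_eq_sum h1 N (n - N) (-1) (K := 1) (by simp)] at h2
  have h3 : binomMul N (comp₂ f h) (-1) (n - N) vac = 0 := by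
    simp [binomMul, comp₂, hall]
  rw [h3] at h2
  simpa [comp₂] using h2

end FormalCalculus

/-! ### Reconstruction of a vertex algebra from generating vertex operators -/

namespace FormalCalculus

open VertexOperator

variable {V : Type*} [AddCommGroup V] [Module ℂ V]

/-- A cutoff `K` common to both expansions merges them into the single sum that occurs in the Jacobi
identity. -/
theorem opComm_eq_finsum (f g : VertexOperator ℂ V) (l m n : ℤ) (w : V) :
    opComm l f g m n w = ∑ᶠ i : ℕ, ((-1 : ℤ) ^ i * Ring.choose l i) •
      (ncoeff f (l + m - i) (ncoeff g (n + i) w)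
        - (Int.negOnePow l : ℤ) • ncoeff g (l + n - i) (ncoeff f (m + i) w)) := by
  obtain ⟨N, hN⟩ := bddSnd_comp₂ f g w
  obtain ⟨M, hM⟩ := bddSnd_comp₂ g f w
  obtain ⟨N', hN'⟩ := ncoeff_bdd g w
  obtain ⟨M', hM'⟩ := ncoeff_bdd f w
  set K := (max (max N N' - n) (max M M' - m)).toNat with hK
  rw [opComm_apply, binomMul_eq_sum hN l m n (K := K) (by omega),
    binomMul_eq_sum hM l n m (K := K) (by omega), Finset.smul_sum, ← Finset.sum_sub_distrib,
    finsum_eq_sum_of_support_subset (s := Finset.range K)]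
  · refine Finset.sum_congr rfl fun i _ => ?_
    rw [smul_comm (Int.negOnePow l : ℤ), ← smul_sub, add_comm l m, add_comm l n]
    rfl
  · intro i hi
    rw [Finset.coe_range, Set.mem_Iio]
    by_contra hlt
    exact hi (by simp [hN' (n + i) (by omega), hM' (m + i) (by omega)])

/-- The identity vertex operator. -/
noncomputable def idOp : VertexOperator ℂ V :=
  ofModes (fun n => if n = -1 then LinearMap.id else 0) fun w => ⟨0, fun n hn => by
    have : n ≠ -1 := by omega
    simp [this]⟩

theorem ncoeff_idOp (n : ℤ) (w : V) : ncoeff idOp n w = if n = -1 then w else 0 := by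
  rw [idOp, ncoeff_ofModes]
  split <;> simp

theorem mutuallyLocal_idOp (f : VertexOperator ℂ V) : MutuallyLocal f idOp := by
  refine ⟨0, ?_⟩
  funext p q w
  by_cases h : q = -1
  · simp [comp₂, swap_apply, ncoeff_idOp, h]
  · simp [comp₂, swap_apply, ncoeff_idOp, h]

theorem covariant_idOp (D : Module.End ℂ V) : Covariant D idOp := by
  intro n w
  simp only [ncoeff_idOp]
  by_cases h : n = -1
  · simp [h]
  · by_cases h' : n = 0
    · simp [h']
    · simp [h, h']

theorem Covariant.add {D : Module.End ℂ V} {f g : VertexOperator ℂ V} (hf : Covariant D f)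
    (hg : Covariant D g) : Covariant D (f + g) := by
  intro n w
  simp only [map_add, Pi.add_apply, LinearMap.add_apply, hf n w, hg n w, smul_add]
  abel

theorem Covariant.smul {D : Module.End ℂ V} {f : VertexOperator ℂ V} (c : ℂ)
    (hf : Covariant D f) : Covariant D (c • f) := by
  intro n w
  simp only [map_smul, Pi.smul_apply, LinearMap.smul_apply, hf n w, smul_sub, smul_comm c]

/-- The data from which a vertex algebra is reconstructed: mutually local covariant vertex
operators, regular on the vacuum and generating the space from it. -/
structure GeneratingFields {ι : Type*} (vac : V) (D : Module.End ℂ V)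
    (G : ι → VertexOperator ℂ V) : Prop where
  D_vac : D vac = 0
  mutuallyLocal : ∀ i j, MutuallyLocal (G i) (G j)
  covariant : ∀ i, Covariant D (G i)
  regular : ∀ i (n : ℤ), 0 ≤ n → ncoeff (G i) n vac = 0
  generate : ∀ W : Submodule ℂ V, vac ∈ W → (∀ i n, ∀ w ∈ W, ncoeff (G i) n w ∈ W) → W = ⊤

/-- Iterated products of the vertex operators of a family. -/
inductive IsNested {ι : Type*} (G : ι → VertexOperator ℂ V) : VertexOperator ℂ V → Prop
  | one : IsNested G idOp
  | step (i : ι) (n : ℤ) {f : VertexOperator ℂ V} : IsNested G f → IsNested G (nprod n (G i) f)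

namespace GeneratingFields

variable {ι : Type*} {vac : V} {D : Module.End ℂ V} {G : ι → VertexOperator ℂ V}

/-- The space of vertex operators spanned by the iterated products. -/
def span (_ : GeneratingFields vac D G) : Submodule ℂ (VertexOperator ℂ V) :=
  Submodule.span ℂ {f | IsNested G f}

variable (h : GeneratingFields vac D G)
include h

/-- Dong's lemma along the construction of `f`. The index `i` stays general because the step also
needs the factor `G j` to be local to the inner product. -/
theorem local_nested (i : ι) {f : VertexOperator ℂ V} (hf : IsNested G f) :
    MutuallyLocal (G i) f := by
  induction hf generalizing i with
  | one => exact mutuallyLocal_idOp _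
  | step j n _ ih => exact (h.mutuallyLocal i j).nprod (ih i) (ih j) n

theorem nested_local_nested {f g : VertexOperator ℂ V} (hf : IsNested G f) (hg : IsNested G g) :
    MutuallyLocal f g := by
  induction hf with
  | one => exact (mutuallyLocal_idOp g).symm
  | step i n hf ih => exact ((h.local_nested i hg).symm.nprod ih.symm (h.local_nested i hf) n).symm

theorem local_of_nested {f : VertexOperator ℂ V} (hf : ∀ g, IsNested G g → MutuallyLocal f g)
    {g : VertexOperator ℂ V} (hg : g ∈ h.span) : MutuallyLocal f g :=
  (Submodule.span_le (p := localTo f)).2 hf hg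

theorem span_local {f g : VertexOperator ℂ V} (hf : f ∈ h.span) (hg : g ∈ h.span) :
    MutuallyLocal f g :=
  h.local_of_nested (fun _ hg =>
    (h.local_of_nested (fun _ hf => h.nested_local_nested hg hf) hf).symm) hg

theorem span_covariant {f : VertexOperator ℂ V} (hf : f ∈ h.span) : Covariant D f := by
  induction hf using Submodule.span_induction with
  | mem f hf =>
    induction hf with
    | one => exact covariant_idOp D
    | step i n _ ih => exact (h.covariant i).nprod ih n
  | zero => intro n w; simp
  | add f g _ _ hf hg => exact hf.add hg
  | smul c f _ hf => exact hf.smul c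

theorem span_regular {f : VertexOperator ℂ V} (hf : f ∈ h.span) (n : ℤ) (hn : 0 ≤ n) :
    ncoeff f n vac = 0 := by
  induction hf using Submodule.span_induction generalizing n with
  | mem f hf =>
    induction hf generalizing n with
    | one => rw [ncoeff_idOp, if_neg (by omega)]
    | step i k _ ih => exact (ncoeff_nprod_vac (h.regular i) ih k).1 n hn
  | zero => simp
  | add f g _ _ hf hg => simp [hf n hn, hg n hn]
  | smul c f _ hf => simp [hf n hn]

/-- The state of a vertex operator. -/
noncomputable def state : h.span →ₗ[ℂ] V where
  toFun f := ncoeff f.1 (-1) vac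
  map_add' f g := by simp
  map_smul' c f := by simp

/-- The state of `nprod n (G i) f` is `(G i)ₙ` applied to the state of `f`, so the range contains
the vacuum and is stable under the generating modes. -/
theorem state_surjective : Function.Surjective h.state := by
  rw [← LinearMap.range_eq_top]
  refine h.generate _ ⟨⟨idOp, Submodule.subset_span IsNested.one⟩, by simp [state, ncoeff_idOp]⟩ ?_
  rintro i n _ ⟨⟨f, hf⟩, rfl⟩
  change ncoeff (G i) n (ncoeff f (-1) vac) ∈ _
  induction hf using Submodule.span_induction with
  | mem f hf =>
    have hf' : f ∈ h.span := Submodule.subset_span hf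
    exact ⟨⟨nprod n (G i) f, Submodule.subset_span (IsNested.step i n hf)⟩,
      (ncoeff_nprod_vac (h.regular i) (h.span_regular hf') n).2⟩
  | zero => simp
  | add f g _ _ hf hg => simpa using Submodule.add_mem _ hf hg
  | smul c f _ hf => simpa using Submodule.smul_mem _ c hf

theorem eq_zero {f : VertexOperator ℂ V} (hcov : Covariant D f)
    (hreg : ∀ n : ℤ, 0 ≤ n → ncoeff f n vac = 0) (h0 : ncoeff f (-1) vac = 0)
    (hloc : ∀ g ∈ h.span, MutuallyLocal f g) : f = 0 :=
  eq_zero_of_ncoeff_vac h.D_vac hcov hreg h0 fun v => by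
    obtain ⟨⟨g, hg⟩, rfl⟩ := h.state_surjective v
    exact ⟨g, hloc g hg, h.span_regular hg, rfl⟩

theorem state_injective : Function.Injective h.state := by
  refine (injective_iff_map_eq_zero _).2 ?_
  rintro ⟨f, hf⟩ h0
  exact Subtype.ext (h.eq_zero (h.span_covariant hf) (h.span_regular hf) h0
    fun g hg => h.span_local hf hg)

/-- The state-field correspondence. -/
noncomputable def field : V →ₗ[ℂ] VertexOperator ℂ V :=
  h.span.subtype ∘ₗ
    (LinearEquiv.ofBijective h.state ⟨h.state_injective, h.state_surjective⟩).symm.toLinearMap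

theorem field_mem (v : V) : h.field v ∈ h.span := Subtype.coe_prop _

theorem field_state (v : V) : ncoeff (h.field v) (-1) vac = v :=
  (LinearEquiv.ofBijective h.state ⟨h.state_injective, h.state_surjective⟩).apply_symm_apply v

/-- Uniqueness without assuming `f ∈ h.span`: Goddard's theorem needs only locality of the
difference with the span. -/
theorem field_eq {f : VertexOperator ℂ V} (hcov : Covariant D f)
    (hreg : ∀ n : ℤ, 0 ≤ n → ncoeff f n vac = 0) (hloc : ∀ g ∈ h.span, MutuallyLocal f g) {v : V}
    (hv : ncoeff f (-1) vac = v) : h.field v = f := by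
  have hmem := h.field_mem v
  have key : f + (-1 : ℂ) • h.field v = 0 := by
    refine h.eq_zero (hcov.add ((h.span_covariant hmem).smul _)) (fun n hn => ?_) ?_ fun g hg =>
      ((hloc g hg).symm.add_right (((h.span_local hmem hg).symm).smul_right _)).symm
    · simp [hreg n hn, h.span_regular hmem n hn]
    · simp [hv, h.field_state]
  refine ext_ncoeff fun n w => ?_
  have hnw := congrArg (fun f => ncoeff f n w) key
  simp only [map_add, map_smul, Pi.add_apply, LinearMap.add_apply, neg_smul, one_smul, map_zero,
    Pi.zero_apply, LinearMap.zero_apply, Pi.neg_apply, LinearMap.neg_apply] at hnw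
  exact (eq_of_sub_eq_zero ((sub_eq_add_neg _ _).trans hnw)).symm

/-- The right side has the correct state, and Dong's lemma makes it local to the span, so `field_eq`
applies. -/
theorem field_nprod (u v : V) (l : ℤ) :
    h.field (ncoeff (h.field u) l v) = nprod l (h.field u) (h.field v) := by
  have hu := h.field_mem u
  have hv := h.field_mem v
  obtain ⟨h1, h2⟩ := ncoeff_nprod_vac (h.span_regular hu) (h.span_regular hv) l
  refine h.field_eq ((h.span_covariant hu).nprod (h.span_covariant hv) l) h1 (fun g hg => ?_) ?_
  · exact ((h.span_local hg hu).nprod (h.span_local hg hv) (h.span_local hu hv) l).symm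
  · rw [h2, h.field_state]

/-- The vertex algebra generated by a family of vertex operators. -/
noncomputable def vertexAlgebra : VertexAlgebra V where
  vac := vac
  Y := h.field
  vacuum n v := by
    rw [h.field_eq (f := idOp) (h.span_covariant (Submodule.subset_span IsNested.one))
      (h.span_regular (Submodule.subset_span IsNested.one))
      (fun g hg => h.span_local (Submodule.subset_span IsNested.one) hg), ncoeff_idOp]
    simp [ncoeff_idOp]
  creation_regular v n hn := h.span_regular (h.field_mem v) n hn
  creation_limit := h.field_state
  jacobi u v w l m n := by
    -- The Jacobi identity is the Borcherds identity for the two fields, whose products are the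
    -- fields of the vectors `u_{l+i} v`.
    rw [← opComm_eq_finsum, (h.span_local (h.field_mem u) (h.field_mem v)).borcherds]
    simp only [h.field_nprod]

theorem vertexAlgebra_Y (i : ι) : h.vertexAlgebra.Y (ncoeff (G i) (-1) vac) = G i :=
  h.field_eq (h.covariant i) (h.regular i)
    (fun _ hg => h.local_of_nested (fun _ hg => h.local_nested i hg) hg) rfl

theorem vertexAlgebra_covariant (u : V) (n : ℤ) (w : V) :
    D (h.vertexAlgebra.mode u n w)
      = h.vertexAlgebra.mode u n (D w) - n • h.vertexAlgebra.mode u (n - 1) w :=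
  h.span_covariant (h.field_mem u) n w

end GeneratingFields

end FormalCalculus

/-! ### Consequences of the Jacobi identity, ideals and quotients -/

namespace VertexAlgebra

variable {V : Type*} [AddCommGroup V] [Module ℂ V]

/-- The operators `uₙ` as a bilinear map. -/
noncomputable def modeLin (𝒱 : VertexAlgebra V) (n : ℤ) : V →ₗ[ℂ] Module.End ℂ V where
  toFun u := 𝒱.mode u n
  map_add' u v := by simp [mode]
  map_smul' c u := by simp [mode]

theorem modeLin_apply (𝒱 : VertexAlgebra V) (n : ℤ) (u v : V) :
    𝒱.modeLin n u v = 𝒱.mode u n v := rfl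

variable (𝒱 : VertexAlgebra V)

theorem mode_bdd (u v : V) : ∃ N : ℤ, ∀ n, N ≤ n → 𝒱.mode u n v = 0 :=
  FormalCalculus.ncoeff_bdd _ _

theorem eq_of_mode {𝒱 𝒱' : VertexAlgebra V} (hvac : 𝒱.vac = 𝒱'.vac)
    (h : ∀ u n v, 𝒱.mode u n v = 𝒱'.mode u n v) : 𝒱 = 𝒱' :=
  VertexAlgebra.ext hvac (LinearMap.ext fun u => FormalCalculus.ext_ncoeff (h u))

theorem finite_support_iterate (u v w : V) (l m n : ℤ) :
    (Function.support fun i : ℕ => ((-1 : ℤ) ^ i * Ring.choose l i) •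
      (𝒱.mode u (l + m - i) (𝒱.mode v (n + i) w)
        - (Int.negOnePow l : ℤ) • 𝒱.mode v (l + n - i) (𝒱.mode u (m + i) w))).Finite := by
  obtain ⟨N, hN⟩ := 𝒱.mode_bdd u w
  obtain ⟨M, hM⟩ := 𝒱.mode_bdd v w
  refine (Finset.finite_toSet (Finset.range (max (N - m) (M - n)).toNat)).subset fun i hi => ?_
  rw [Finset.coe_range, Set.mem_Iio]
  by_contra hlt
  exact hi (by simp [hN (m + i) (by omega), hM (n + i) (by omega)])

theorem finite_support_commutator (u v w : V) (l m n : ℤ) :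
    (Function.support fun i : ℕ => Ring.choose m i •
      𝒱.mode (𝒱.mode u (l + i) v) (m + n - i) w).Finite := by
  obtain ⟨N, hN⟩ := 𝒱.mode_bdd u v
  refine (Finset.finite_toSet (Finset.range (N - l).toNat)).subset fun i hi => ?_
  rw [Finset.coe_range, Set.mem_Iio]
  by_contra hlt
  refine hi ?_
  simp only
  rw [hN (l + i) (by omega), ← modeLin_apply, map_zero, LinearMap.zero_apply, smul_zero]

/-- The iterate formula: the Jacobi identity at `m = 0`. -/
theorem mode_mode (u v w : V) (l n : ℤ) : 𝒱.mode (𝒱.mode u l v) n w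
    = ∑ᶠ i : ℕ, ((-1 : ℤ) ^ i * Ring.choose l i) • (𝒱.mode u (l - i) (𝒱.mode v (n + i) w)
        - (Int.negOnePow l : ℤ) • 𝒱.mode v (l + n - i) (𝒱.mode u i w)) := by
  have h := 𝒱.jacobi u v w l 0 n
  rw [finsum_eq_single (fun i : ℕ => Ring.choose (0 : ℤ) i • _) 0 fun i hi => by
    rw [Ring.choose_zero_pos ℤ (Nat.pos_of_ne_zero hi), zero_smul]] at h
  simp only [Ring.choose_zero_right, one_smul, Nat.cast_zero, add_zero, sub_zero, zero_add] at h
  exact h.symm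

/-- The commutator formula: the Jacobi identity at `l = 0`. -/
theorem mode_commutator (u v w : V) (m n : ℤ) :
    𝒱.mode u m (𝒱.mode v n w) - 𝒱.mode v n (𝒱.mode u m w)
      = ∑ᶠ i : ℕ, Ring.choose m i • 𝒱.mode (𝒱.mode u i v) (m + n - i) w := by
  have h := 𝒱.jacobi u v w 0 m n
  rw [finsum_eq_single _ 0 fun i hi => by
    rw [Ring.choose_zero_pos ℤ (Nat.pos_of_ne_zero hi), mul_zero, zero_smul]] at h
  simpa [mode] using h

theorem finsum_mem {P : Submodule ℂ V} {f : ℕ → V} (h : ∀ i, f i ∈ P) : ∑ᶠ i, f i ∈ P :=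
  finsum_induction (· ∈ P) P.zero_mem (fun _ _ => P.add_mem) h

theorem mode_mode_mem {P : Submodule ℂ V} {u v w : V} {l n : ℤ}
    (h1 : ∀ i : ℕ, 𝒱.mode u (l - i) (𝒱.mode v (n + i) w) ∈ P)
    (h2 : ∀ i : ℕ, 𝒱.mode v (l + n - i) (𝒱.mode u i w) ∈ P) :
    𝒱.mode (𝒱.mode u l v) n w ∈ P := by
  rw [mode_mode]
  exact finsum_mem fun i => zsmul_mem (P.sub_mem (h1 i) (zsmul_mem (h2 i) _)) _

/-- A subspace that is stable under all products with arbitrary vectors. -/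
structure IsIdeal (I : Submodule ℂ V) : Prop where
  left : ∀ u n, ∀ v ∈ I, 𝒱.mode u n v ∈ I
  right : ∀ u ∈ I, ∀ n v, 𝒱.mode u n v ∈ I

/-- Since the kernel is an ideal, `f (uₙ v)` depends only on `f u` and `f v`; products are therefore
computed on a set-theoretic section. -/
theorem exists_of_surjective {W : Type*} [AddCommGroup W] [Module ℂ W] (f : V →ₗ[ℂ] W)
    (hf : Function.Surjective f) (hI : 𝒱.IsIdeal (LinearMap.ker f)) :
    ∃ 𝒲 : VertexAlgebra W, 𝒱.IsHom 𝒲 f := by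
  have hmul : ∀ {u u' v v' : V} (n : ℤ), f u = f u' → f v = f v' →
      f (𝒱.mode u n v) = f (𝒱.mode u' n v') := by
    intro u u' v v' n hu hv
    have h1 : u - u' ∈ LinearMap.ker f := by simp [hu]
    have h2 : v - v' ∈ LinearMap.ker f := by simp [hv]
    have h3 := hI.right _ h1 n v
    have h4 := hI.left u' n _ h2
    rw [← modeLin_apply, map_sub, LinearMap.sub_apply, LinearMap.mem_ker, map_sub,
      modeLin_apply, modeLin_apply, sub_eq_zero] at h3
    rw [map_sub, LinearMap.mem_ker, map_sub, sub_eq_zero] at h4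
    exact h3.trans h4
  set g := Function.surjInv hf with hg
  have hfg : ∀ w, f (g w) = w := Function.surjInv_eq hf
  let mul : ℤ → W →ₗ[ℂ] W →ₗ[ℂ] W := fun n =>
    LinearMap.mk₂ ℂ (fun u v => f (𝒱.mode (g u) n (g v)))
      (fun u u' v => by
        rw [hmul n (u' := g u + g u') (by simp [hfg]) rfl, ← modeLin_apply]
        simp [modeLin_apply])
      (fun c u v => by
        rw [hmul n (u' := c • g u) (by simp [hfg]) rfl, ← modeLin_apply]
        simp [modeLin_apply])
      (fun u v v' => by
        rw [hmul n (v' := g v + g v') rfl (by simp [hfg])]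
        simp)
      (fun c u v => by
        rw [hmul n (v' := c • g v) rfl (by simp [hfg])]
        simp)
  have hmulf : ∀ n u v, mul n (f u) (f v) = f (𝒱.mode u n v) := fun n u v =>
    hmul n (hfg _) (hfg _)
  have hbdd : ∀ u v, ∃ N : ℤ, ∀ n, N ≤ n → mul n u v = 0 := by
    intro u v
    obtain ⟨u, rfl⟩ := hf u
    obtain ⟨v, rfl⟩ := hf v
    obtain ⟨N, hN⟩ := 𝒱.mode_bdd u v
    exact ⟨N, fun n hn => by rw [hmulf, hN n hn, map_zero]⟩
  let Y : W →ₗ[ℂ] VertexOperator ℂ W :=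
    { toFun := fun u => FormalCalculus.ofModes (fun n => mul n u) (hbdd u)
      map_add' := fun u v => FormalCalculus.ext_ncoeff fun n w => by
        simp [FormalCalculus.ncoeff_ofModes]
      map_smul' := fun c u => FormalCalculus.ext_ncoeff fun n w => by
        simp [FormalCalculus.ncoeff_ofModes] }
  have hY : ∀ n u v, VertexOperator.ncoeff (Y u) n v = mul n u v := by
    intro n u v
    change VertexOperator.ncoeff (FormalCalculus.ofModes (fun n => mul n u) (hbdd u)) n v = _
    rw [FormalCalculus.ncoeff_ofModes]
  refine ⟨{ vac := f 𝒱.vac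
            Y := Y
            vacuum := ?_
            creation_regular := ?_
            creation_limit := ?_
            jacobi := ?_ }, ⟨rfl, fun u v n => ?_⟩⟩
  · intro n v
    obtain ⟨v, rfl⟩ := hf v
    rw [hY, hmulf, mode, 𝒱.vacuum]
    split <;> simp
  · intro v n hn
    obtain ⟨v, rfl⟩ := hf v
    rw [hY, hmulf, mode, 𝒱.creation_regular v n hn, map_zero]
  · intro v
    obtain ⟨v, rfl⟩ := hf v
    rw [hY, hmulf, mode, 𝒱.creation_limit]
  · intro u v w l m n
    obtain ⟨u, rfl⟩ := hf u
    obtain ⟨v, rfl⟩ := hf v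
    obtain ⟨w, rfl⟩ := hf w
    have h := congrArg f (𝒱.jacobi u v w l m n)
    -- Finiteness of the supports in `V` is what allows `f` to pass through the sums.
    have e1 := f.toAddMonoidHom.map_finsum (𝒱.finite_support_iterate u v w l m n)
    have e2 := f.toAddMonoidHom.map_finsum (𝒱.finite_support_commutator u v w l m n)
    have h' := e1.symm.trans (h.trans e2)
    simpa only [hY, hmulf, LinearMap.toAddMonoidHom_coe, map_zsmul, map_sub] using h'
  · exact ((hY n (f u) (f v)).trans (hmulf n u v)).symm

theorem IsHom.unique {𝒱 : VertexAlgebra V} {W : Type*} [AddCommGroup W] [Module ℂ W]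
    {f : V →ₗ[ℂ] W} (hf : Function.Surjective f) {𝒲 𝒲' : VertexAlgebra W} (h : 𝒱.IsHom 𝒲 f)
    (h' : 𝒱.IsHom 𝒲' f) : 𝒲' = 𝒲 := by
  refine eq_of_mode (by rw [← h.map_vac, ← h'.map_vac]) fun u n v => ?_
  obtain ⟨u, rfl⟩ := hf u
  obtain ⟨v, rfl⟩ := hf v
  rw [← h.map_mode, ← h'.map_mode]

end VertexAlgebra

/-! ### Induced modules over universal enveloping algebras -/

namespace UniversalEnvelopingAlgebra

attribute [local instance 100] LieRing.ofAssociativeRing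

variable {L : Type*} [LieRing L] [LieAlgebra ℂ L]

theorem ι_mul_ι (x y : L) : ι ℂ x * ι ℂ y = ι ℂ y * ι ℂ x + ι ℂ ⁅x, y⁆ := by
  rw [LieHom.map_lie, LieRing.of_associative_ring_bracket]
  abel

/-- The universal property lifts `ι` to the subalgebra, and the inclusion composed with this lift is
the identity. -/
theorem adjoin_range_ι :
    Algebra.adjoin ℂ (Set.range (ι ℂ : L → UniversalEnvelopingAlgebra ℂ L)) = ⊤ := by
  set S := Algebra.adjoin ℂ (Set.range (ι ℂ : L → UniversalEnvelopingAlgebra ℂ L)) with hS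
  let f : L →ₗ⁅ℂ⁆ S :=
    { toFun := fun x => ⟨ι ℂ x, Algebra.subset_adjoin ⟨x, rfl⟩⟩
      map_add' := fun x y => Subtype.ext (map_add (ι ℂ) x y)
      map_smul' := fun c x => Subtype.ext (map_smul (ι ℂ) c x)
      map_lie' := fun {x y} => Subtype.ext (LieHom.map_lie (ι ℂ) x y) }
  have h : S.val.comp (lift ℂ f) = AlgHom.id ℂ _ := by
    refine hom_ext _ (LieHom.ext fun x => ?_)
    change ((lift ℂ f (ι ℂ x) : S) : UniversalEnvelopingAlgebra ℂ L) = ι ℂ x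
    rw [lift_ι_apply]
    rfl
  refine eq_top_iff.2 fun u _ => ?_
  have := congrArg (fun g : UniversalEnvelopingAlgebra ℂ L →ₐ[ℂ] UniversalEnvelopingAlgebra ℂ L =>
    g u) h
  rw [show u = (lift ℂ f u : S) from this.symm]
  exact Subtype.coe_prop _

variable {M : Type*} [AddCommGroup M] [Module ℂ M] [Module (UniversalEnvelopingAlgebra ℂ L) M]
  [IsScalarTower ℂ (UniversalEnvelopingAlgebra ℂ L) M]

/-- A subspace that is stable under a Lie algebra is stable under its enveloping algebra. -/
theorem smul_mem_of_ι_smul_mem {W : Submodule ℂ M} (h : ∀ x : L, ∀ w ∈ W, ι ℂ x • w ∈ W)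
    (u : UniversalEnvelopingAlgebra ℂ L) {w : M} (hw : w ∈ W) : u • w ∈ W := by
  have hu : u ∈ Algebra.adjoin ℂ (Set.range (ι ℂ : L → UniversalEnvelopingAlgebra ℂ L)) := by
    rw [adjoin_range_ι]
    trivial
  induction hu using Algebra.adjoin_induction generalizing w with
  | mem u hu =>
    obtain ⟨x, rfl⟩ := hu
    exact h x w hw
  | algebraMap r =>
    rw [algebraMap_smul]
    exact W.smul_mem r hw
  | add u v _ _ hu hv =>
    rw [add_smul]
    exact W.add_mem (hu hw) (hv hw)
  | mul u v _ _ hu hv =>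
    rw [mul_smul]
    exact hu (hv hw)

/-- The universal property of the induced module `U(L)/U(L)N`. -/
theorem exists_linearMap_of_annihilated {N : Submodule ℂ L}
    {K : Submodule (UniversalEnvelopingAlgebra ℂ L) (UniversalEnvelopingAlgebra ℂ L)}
    (hK : K = Submodule.span _ (ι ℂ '' (N : Set L))) {M : Type*} [AddCommGroup M]
    [Module ℂ M] (ρ : L →ₗ⁅ℂ⁆ Module.End ℂ M) {e : M} (he : ∀ x ∈ N, ρ x e = 0) :
    ∃ φ : (UniversalEnvelopingAlgebra ℂ L ⧸ K) →ₗ[ℂ] M,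
      φ (K.mkQ 1) = e ∧ ∀ x v, φ (ι ℂ x • v) = ρ x (φ v) := by
  let θ : UniversalEnvelopingAlgebra ℂ L →ₗ[ℂ] M :=
    LinearMap.applyₗ e ∘ₗ (lift ℂ ρ).toLinearMap
  have hθ : ∀ u v, θ (u * v) = lift ℂ ρ u (θ v) := fun u v => by
    simp [θ]
  have hker : K.restrictScalars ℂ ≤ LinearMap.ker θ := by
    intro u hu
    rw [Submodule.restrictScalars_mem, hK] at hu
    induction hu using Submodule.span_induction with
    | mem u hu =>
      obtain ⟨x, hx, rfl⟩ := hu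
      rw [LinearMap.mem_ker]
      change lift ℂ ρ (ι ℂ x) e = 0
      rw [lift_ι_apply, he x hx]
    | zero => exact Submodule.zero_mem _
    | add u v _ _ hu hv => exact Submodule.add_mem _ hu hv
    | smul u v _ hv =>
      rw [LinearMap.mem_ker] at hv ⊢
      rw [smul_eq_mul, hθ, hv, map_zero]
  refine ⟨(K.restrictScalars ℂ).liftQ θ hker, ?_, ?_⟩
  · change θ 1 = e
    simp [θ]
  · intro x v
    obtain ⟨v, rfl⟩ := Submodule.mkQ_surjective _ v
    change θ (ι ℂ x * v) = ρ x (θ v)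
    rw [hθ, lift_ι_apply]

theorem ι_smul_mkQ_one {N : Submodule ℂ L}
    {K : Submodule (UniversalEnvelopingAlgebra ℂ L) (UniversalEnvelopingAlgebra ℂ L)}
    (hK : K = Submodule.span _ (ι ℂ '' (N : Set L))) {x : L} (hx : x ∈ N) :
    ι ℂ x • K.mkQ 1 = 0 := by
  rw [← map_smul, smul_eq_mul, mul_one]
  exact (Submodule.Quotient.mk_eq_zero _).2 (hK ▸ Submodule.subset_span ⟨x, hx, rfl⟩)

theorem ι_smul_ι_smul (x y : L) (v : M) :
    ι ℂ x • ι ℂ y • v = ι ℂ y • ι ℂ x • v + ι ℂ ⁅x, y⁆ • v := by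
  rw [← mul_smul, ι_mul_ι, add_smul, mul_smul]

/-- The subspaces that are stable under `L` and contain the cyclic vector. -/
theorem induced_induction
    {K : Submodule (UniversalEnvelopingAlgebra ℂ L) (UniversalEnvelopingAlgebra ℂ L)}
    {W : Submodule ℂ (UniversalEnvelopingAlgebra ℂ L ⧸ K)}
    (h1 : K.mkQ 1 ∈ W) (h : ∀ x : L, ∀ w ∈ W, ι ℂ x • w ∈ W) : W = ⊤ := by
  refine eq_top_iff.2 fun v _ => ?_
  obtain ⟨u, rfl⟩ := Submodule.mkQ_surjective _ v
  have := smul_mem_of_ι_smul_mem h u h1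
  rwa [← map_smul, smul_eq_mul, mul_one] at this

/-- A derivation of `L` that preserves `N` acts on the induced module. -/
theorem exists_derivation {N : Submodule ℂ L}
    {K : Submodule (UniversalEnvelopingAlgebra ℂ L) (UniversalEnvelopingAlgebra ℂ L)}
    (hK : K = Submodule.span _ (ι ℂ '' (N : Set L))) (δ : L →ₗ[ℂ] L)
    (hδ : ∀ x y, δ ⁅x, y⁆ = ⁅δ x, y⁆ + ⁅x, δ y⁆) (hN : ∀ x ∈ N, δ x ∈ N) :
    ∃ D : Module.End ℂ (UniversalEnvelopingAlgebra ℂ L ⧸ K),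
      D (K.mkQ 1) = 0 ∧ ∀ x v, D (ι ℂ x • v) = ι ℂ (δ x) • v + ι ℂ x • D v := by
  let I := UniversalEnvelopingAlgebra ℂ L ⧸ K
  let act : UniversalEnvelopingAlgebra ℂ L →ₐ[ℂ] Module.End ℂ I := Algebra.lsmul ℂ ℂ I
  -- With `I × I` read as `I[ε]`, `ε² = 0`, this is `x ↦ x + ε δ(x)`, a representation because `δ`
  -- is a derivation.
  let ρ : L →ₗ⁅ℂ⁆ Module.End ℂ (I × I) :=
    { toFun := fun x => LinearMap.prod (act (ι ℂ x) ∘ₗ LinearMap.fst ℂ I I)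
        (act (ι ℂ (δ x)) ∘ₗ LinearMap.fst ℂ I I + act (ι ℂ x) ∘ₗ LinearMap.snd ℂ I I)
      map_add' := fun x y => by
        refine LinearMap.ext fun v => Prod.ext ?_ ?_
        · simp
        · simp only [map_add, LinearMap.prod_apply, Function.prod_apply, LinearMap.add_apply,
            LinearMap.comp_apply, Prod.snd_add]
          abel
      map_smul' := fun c x => by
        refine LinearMap.ext fun v => Prod.ext ?_ ?_
        · simp
        · simp
      map_lie' := fun {x y} => by
        refine LinearMap.ext fun v => Prod.ext ?_ ?_
        · change ι ℂ ⁅x, y⁆ • v.1 = ι ℂ x • ι ℂ y • v.1 - ι ℂ y • ι ℂ x • v.1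
          rw [ι_smul_ι_smul x y]
          abel
        · change ι ℂ (δ ⁅x, y⁆) • v.1 + ι ℂ ⁅x, y⁆ • v.2
            = (ι ℂ (δ x) • ι ℂ y • v.1 + ι ℂ x • (ι ℂ (δ y) • v.1 + ι ℂ y • v.2))
              - (ι ℂ (δ y) • ι ℂ x • v.1 + ι ℂ y • (ι ℂ (δ x) • v.1 + ι ℂ x • v.2))
          rw [hδ, map_add, add_smul, smul_add, smul_add, ι_smul_ι_smul x y, ι_smul_ι_smul (δ x) y,
            ι_smul_ι_smul x (δ y)]
          abel }
  obtain ⟨φ, h1, h2⟩ := exists_linearMap_of_annihilated hK ρ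
    (e := (K.mkQ 1, 0)) fun x hx => by
      refine Prod.ext ?_ ?_
      · change ι ℂ x • K.mkQ 1 = 0
        exact ι_smul_mkQ_one hK hx
      · change ι ℂ (δ x) • K.mkQ 1 + ι ℂ x • (0 : I) = 0
        rw [ι_smul_mkQ_one hK (hN x hx), smul_zero, add_zero]
  -- The map is `v ↦ v + ε D v`; its `ε`-component is the required operator.
  have hfst : LinearMap.fst ℂ I I ∘ₗ φ = LinearMap.id := by
    have : LinearMap.eqLocus (LinearMap.fst ℂ I I ∘ₗ φ) LinearMap.id = ⊤ := by
      refine induced_induction ?_ fun x w hw => ?_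
      · change (φ _).1 = _
        rw [h1]
        rfl
      · change (φ w).1 = w at hw
        change (φ (ι ℂ x • w)).1 = ι ℂ x • w
        rw [h2]
        change ι ℂ x • (φ w).1 = _
        rw [hw]
    exact LinearMap.eqLocus_eq_top.1 this
  refine ⟨LinearMap.snd ℂ I I ∘ₗ φ, ?_, fun x v => ?_⟩
  · change (φ _).2 = 0
    rw [h1]
  · change (φ (ι ℂ x • v)).2 = _
    rw [h2]
    change ι ℂ (δ x) • (φ v).1 + ι ℂ x • (φ v).2 = _
    rw [show (φ v).1 = v from LinearMap.congr_fun hfst v]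
    rfl

end UniversalEnvelopingAlgebra

/-! ### The vertex algebra of a `1`-truncated conformal algebra -/

namespace OneTruncatedConformalAlgebra

open UniversalEnvelopingAlgebra FormalCalculus

attribute [local instance 100] LieRing.ofAssociativeRing

variable {C₀ C₁ : Type*} [AddCommGroup C₀] [Module ℂ C₀] [AddCommGroup C₁] [Module ℂ C₁]
variable (C : OneTruncatedConformalAlgebra C₀ C₁)
variable {M : Type*} [AddCommGroup M] [Module ℂ M]

/-- `a(n) ∈ 𝓛` for `a ∈ C₀`. -/
noncomputable def x0 (n : ℤ) : C₀ →ₗ[ℂ] C.LieAlg := C.rho ∘ₗ t0 C₀ C₁ n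

/-- `u(n) ∈ 𝓛` for `u ∈ C₁`. -/
noncomputable def x1 (n : ℤ) : C₁ →ₗ[ℂ] C.LieAlg := C.rho ∘ₗ t1 C₀ C₁ n

theorem m0_eq (n : ℤ) (a : C₀) : C.m0 n a = ι ℂ (C.x0 n a) := rfl

theorem m1_eq (n : ℤ) (u : C₁) : C.m1 n u = ι ℂ (C.x1 n u) := rfl

theorem x1_d (n : ℤ) (a : C₀) : C.x1 n (C.d a) = -((n : ℂ) • C.x0 (n - 1) a) := by
  rw [eq_neg_iff_add_eq_zero]
  exact (Submodule.Quotient.mk_eq_zero _).2 (C.dHat_mem n a)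

theorem lie_x0_x0 (m n : ℤ) (a a' : C₀) : ⁅C.x0 m a, C.x0 n a'⁆ = 0 := by
  change C.rho (C.bracket _ _) = 0
  rw [bracket_t0_t0, map_zero]

theorem lie_x0_x1 (m n : ℤ) (a : C₀) (u : C₁) :
    ⁅C.x0 m a, C.x1 n u⁆ = C.x0 (m + n) (C.zero01 a u) := by
  change C.rho (C.bracket _ _) = _
  rw [bracket_t0_t1]
  rfl

theorem lie_x1_x0 (m n : ℤ) (u : C₁) (a : C₀) :
    ⁅C.x1 m u, C.x0 n a⁆ = C.x0 (m + n) (C.zero10 u a) := by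
  change C.rho (C.bracket _ _) = _
  rw [bracket_t1_t0]
  rfl

theorem lie_x1_x1 (m n : ℤ) (u v : C₁) : ⁅C.x1 m u, C.x1 n v⁆
    = C.x1 (m + n) (C.zero11 u v) + (m : ℂ) • C.x0 (m + n - 1) (C.one11 u v) := by
  change C.rho (C.bracket _ _) = _
  rw [bracket_t1_t1, map_add, map_smul]
  rfl

theorem lie_induction {p : C.LieAlg → Prop} (h0 : ∀ n a, p (C.x0 n a)) (h1 : ∀ n u, p (C.x1 n u))
    (hadd : ∀ x y, p x → p y → p (x + y)) (x : C.LieAlg) : p x := by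
  obtain ⟨x, rfl⟩ := C.rho_surjective x
  induction x using loop_induction with
  | h0 m a => exact h0 m a
  | h1 m u => exact h1 m u
  | hadd x y hx hy =>
    rw [map_add]
    exact hadd _ _ hx hy

/-- A linear map on `𝓛` is given by its values on the spanning elements, which have to respect the
defining relations. -/
theorem exists_lieLift (f₀ : ℤ → C₀ →ₗ[ℂ] M) (f₁ : ℤ → C₁ →ₗ[ℂ] M)
    (h : ∀ n a, f₁ n (C.d a) + (n : ℂ) • f₀ (n - 1) a = 0) :
    ∃ f : C.LieAlg →ₗ[ℂ] M, (∀ n a, f (C.x0 n a) = f₀ n a) ∧ ∀ n u, f (C.x1 n u) = f₁ n u := by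
  let g : LoopModule C₀ C₁ →ₗ[ℂ] M := LinearMap.coprod (Finsupp.lsum ℂ f₀) (Finsupp.lsum ℂ f₁)
  have g0 : ∀ n a, g (t0 C₀ C₁ n a) = f₀ n a := fun n a => by simp [g, t0]
  have g1 : ∀ n u, g (t1 C₀ C₁ n u) = f₁ n u := fun n a => by simp [g, t1]
  refine ⟨C.dHatRange.liftQ g (C.dHatRange_le fun n a => ?_), g0, g1⟩
  rw [LinearMap.mem_ker, map_add, map_smul, g0, g1, h]

/-- This is `-d/dt`, which descends because it commutes with `∂ + d/dt`. -/
theorem exists_lieDerivation_D : ∃ δ : C.LieAlg →ₗ[ℂ] C.LieAlg,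
    (∀ n a, δ (C.x0 n a) = -((n : ℂ) • C.x0 (n - 1) a)) ∧
      (∀ n u, δ (C.x1 n u) = -((n : ℂ) • C.x1 (n - 1) u)) ∧
      ∀ x y, δ ⁅x, y⁆ = ⁅δ x, y⁆ + ⁅x, δ y⁆ := by
  obtain ⟨δ, h0, h1⟩ := C.exists_lieLift (fun n => -((n : ℂ) • C.x0 (n - 1)))
    (fun n => -((n : ℂ) • C.x1 (n - 1))) fun n a => by
      simp only [LinearMap.neg_apply, LinearMap.smul_apply, x1_d]
      push_cast
      module
  simp only [LinearMap.neg_apply, LinearMap.smul_apply] at h0 h1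
  refine ⟨δ, h0, h1, fun x y => ?_⟩
  have e1 : ∀ m n : ℤ, m - 1 + n = m + n - 1 := fun m n => by ring
  have e2 : ∀ m n : ℤ, m + (n - 1) = m + n - 1 := fun m n => by ring
  induction x using C.lie_induction with
  | hadd x x' hx hx' =>
    simp only [map_add, add_lie, hx, hx']
    abel
  | h0 m a =>
    induction y using C.lie_induction with
    | hadd y y' hy hy' =>
      simp only [map_add, lie_add, hy, hy']
      abel
    | h0 n a' => simp [h0, lie_x0_x0]
    | h1 n u =>
      simp only [h0, h1, lie_x0_x1, neg_lie, lie_neg, smul_lie, lie_smul, e1, e2]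
      push_cast
      module
  | h1 m u =>
    induction y using C.lie_induction with
    | hadd y y' hy hy' =>
      simp only [map_add, lie_add, hy, hy']
      abel
    | h0 n a =>
      simp only [h0, h1, lie_x1_x0, neg_lie, lie_neg, smul_lie, lie_smul, e1, e2]
      push_cast
      module
    | h1 n v =>
      simp only [h0, h1, lie_x1_x1, neg_lie, lie_neg, smul_lie, lie_smul, e1, e2, map_add, map_smul]
      push_cast
      module

/-- The relation `(∂a)(n) + n a(n-1) = 0` is homogeneous of degree `-n`, so the degree is well
defined on `𝓛`. -/
theorem exists_lieDerivation_degree : ∃ δ : C.LieAlg →ₗ[ℂ] C.LieAlg,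
    (∀ n a, δ (C.x0 n a) = (-(n : ℂ) - 1) • C.x0 n a) ∧
      (∀ n u, δ (C.x1 n u) = (-(n : ℂ)) • C.x1 n u) ∧
      ∀ x y, δ ⁅x, y⁆ = ⁅δ x, y⁆ + ⁅x, δ y⁆ := by
  obtain ⟨δ, h0, h1⟩ := C.exists_lieLift (fun n => (-(n : ℂ) - 1) • C.x0 n)
    (fun n => (-(n : ℂ)) • C.x1 n) fun n a => by
      simp only [LinearMap.smul_apply, x1_d]
      push_cast
      module
  simp only [LinearMap.smul_apply] at h0 h1
  refine ⟨δ, h0, h1, fun x y => ?_⟩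
  induction x using C.lie_induction with
  | hadd x x' hx hx' =>
    simp only [map_add, add_lie, hx, hx']
    abel
  | h0 m a =>
    induction y using C.lie_induction with
    | hadd y y' hy hy' =>
      simp only [map_add, lie_add, hy, hy']
      abel
    | h0 n a' => simp [h0, lie_x0_x0]
    | h1 n u =>
      simp only [h0, h1, lie_x0_x1, smul_lie, lie_smul]
      push_cast
      module
  | h1 m u =>
    induction y using C.lie_induction with
    | hadd y y' hy hy' =>
      simp only [map_add, lie_add, hy, hy']
      abel
    | h0 n a =>
      simp only [h0, h1, lie_x1_x0, smul_lie, lie_smul]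
      push_cast
      module
    | h1 n v =>
      simp only [h0, h1, lie_x1_x1, smul_lie, lie_smul, map_add, map_smul]
      push_cast
      module

theorem x0_mem_nonnegPart {n : ℤ} (hn : 0 ≤ n) (a : C₀) : C.x0 n a ∈ C.nonnegPart :=
  Submodule.subset_span ⟨n, hn, Or.inl ⟨a, rfl⟩⟩

theorem x1_mem_nonnegPart {n : ℤ} (hn : 0 ≤ n) (u : C₁) : C.x1 n u ∈ C.nonnegPart :=
  Submodule.subset_span ⟨n, hn, Or.inr ⟨u, rfl⟩⟩

theorem nonnegPart_le {W : Submodule ℂ C.LieAlg} (h0 : ∀ n : ℤ, 0 ≤ n → ∀ a, C.x0 n a ∈ W)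
    (h1 : ∀ n : ℤ, 0 ≤ n → ∀ u, C.x1 n u ∈ W) : C.nonnegPart ≤ W := by
  refine Submodule.span_le.2 ?_
  rintro x ⟨n, hn, ⟨a, rfl⟩ | ⟨u, rfl⟩⟩
  · exact h0 n hn a
  · exact h1 n hn u

/-- Subspaces of an `𝓛`-module stable under all `a(n)` and `u(n)` are stable under `𝓛`. -/
theorem ι_smul_mem {M : Type*} [AddCommGroup M] [Module ℂ M]
    [Module (UniversalEnvelopingAlgebra ℂ C.LieAlg) M]
    [IsScalarTower ℂ (UniversalEnvelopingAlgebra ℂ C.LieAlg) M] {W : Submodule ℂ M} {w : M}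
    (h0 : ∀ n a, C.m0 n a • w ∈ W) (h1 : ∀ n u, C.m1 n u • w ∈ W) (x : C.LieAlg) :
    ι ℂ x • w ∈ W := by
  induction x using C.lie_induction with
  | h0 n a => exact h0 n a
  | h1 n u => exact h1 n u
  | hadd x y hx hy =>
    rw [map_add, add_smul]
    exact W.add_mem hx hy

theorem VL_induction {W : Submodule ℂ C.VL} (h : C.one ∈ W)
    (h0 : ∀ n a, ∀ w ∈ W, C.m0 n a • w ∈ W) (h1 : ∀ n u, ∀ w ∈ W, C.m1 n u • w ∈ W) : W = ⊤ :=
  induced_induction h fun x w hw =>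
    C.ι_smul_mem (fun n a => h0 n a w hw) (fun n u => h1 n u w hw) x

theorem m0_smul_one {n : ℤ} (hn : 0 ≤ n) (a : C₀) : C.m0 n a • C.one = 0 :=
  ι_smul_mkQ_one (N := C.nonnegPart) rfl (C.x0_mem_nonnegPart hn a)

theorem m1_smul_one {n : ℤ} (hn : 0 ≤ n) (u : C₁) : C.m1 n u • C.one = 0 :=
  ι_smul_mkQ_one (N := C.nonnegPart) rfl (C.x1_mem_nonnegPart hn u)

section Commutators

variable [Module (UniversalEnvelopingAlgebra ℂ C.LieAlg) M]
  [IsScalarTower ℂ (UniversalEnvelopingAlgebra ℂ C.LieAlg) M]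

theorem m0_m0 (m n : ℤ) (a a' : C₀) (v : M) :
    C.m0 m a • C.m0 n a' • v = C.m0 n a' • C.m0 m a • v := by
  rw [m0_eq, m0_eq, ι_smul_ι_smul, lie_x0_x0, map_zero, zero_smul, add_zero]

theorem m1_m0 (m n : ℤ) (u : C₁) (a : C₀) (v : M) : C.m1 m u • C.m0 n a • v
    = C.m0 n a • C.m1 m u • v + C.m0 (m + n) (C.zero10 u a) • v := by
  rw [m0_eq, m0_eq, m1_eq, ι_smul_ι_smul, lie_x1_x0]

theorem m0_m1 (m n : ℤ) (a : C₀) (u : C₁) (v : M) : C.m0 m a • C.m1 n u • v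
    = C.m1 n u • C.m0 m a • v + C.m0 (m + n) (C.zero01 a u) • v := by
  rw [m0_eq, m0_eq, m1_eq, ι_smul_ι_smul, lie_x0_x1]

theorem m1_m1 (m n : ℤ) (u u' : C₁) (v : M) : C.m1 m u • C.m1 n u' • v
    = C.m1 n u' • C.m1 m u • v + (C.m1 (m + n) (C.zero11 u u') • v
      + (m : ℂ) • C.m0 (m + n - 1) (C.one11 u u') • v) := by
  rw [m0_eq, m1_eq, m1_eq, m1_eq, ι_smul_ι_smul, lie_x1_x1, map_add, map_smul, add_smul,
    smul_assoc]

theorem m1_d (n : ℤ) (a : C₀) : C.m1 n (C.d a) = -((n : ℂ) • C.m0 (n - 1) a) := by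
  rw [m1_eq, x1_d, map_neg, map_smul, m0_eq]

end Commutators

/-- Restrictedness of the module `V_𝓛`. -/
theorem VL_bdd (v : C.VL) : (∀ a, ∃ N : ℤ, ∀ n, N ≤ n → C.m0 n a • v = 0) ∧
    ∀ u, ∃ N : ℤ, ∀ n, N ≤ n → C.m1 n u • v = 0 := by
  let W : Submodule ℂ C.VL :=
    { carrier := {v | (∀ a, ∃ N : ℤ, ∀ n, N ≤ n → C.m0 n a • v = 0) ∧
        ∀ u, ∃ N : ℤ, ∀ n, N ≤ n → C.m1 n u • v = 0}
      zero_mem' := ⟨fun a => ⟨0, fun n _ => smul_zero _⟩, fun u => ⟨0, fun n _ => smul_zero _⟩⟩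
      add_mem' := fun {v w} hv hw => by
        constructor
        · intro a
          obtain ⟨N, hN⟩ := hv.1 a
          obtain ⟨N', hN'⟩ := hw.1 a
          exact ⟨max N N', fun n hn => by
            rw [smul_add, hN n (by omega), hN' n (by omega), add_zero]⟩
        · intro a
          obtain ⟨N, hN⟩ := hv.2 a
          obtain ⟨N', hN'⟩ := hw.2 a
          exact ⟨max N N', fun n hn => by
            rw [smul_add, hN n (by omega), hN' n (by omega), add_zero]⟩
      smul_mem' := fun c v hv => by
        constructor
        · intro a
          obtain ⟨N, hN⟩ := hv.1 a
          exact ⟨N, fun n hn => by rw [smul_comm, hN n hn, smul_zero]⟩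
        · intro a
          obtain ⟨N, hN⟩ := hv.2 a
          exact ⟨N, fun n hn => by rw [smul_comm, hN n hn, smul_zero]⟩ }
  have hW : W = ⊤ := by
    refine C.VL_induction ⟨fun a => ⟨0, fun n hn => C.m0_smul_one hn a⟩,
      fun u => ⟨0, fun n hn => C.m1_smul_one hn u⟩⟩ ?_ ?_
    · intro k b v hv
      constructor
      · intro a
        obtain ⟨N, hN⟩ := hv.1 a
        exact ⟨N, fun n hn => by rw [m0_m0, hN n hn, smul_zero]⟩
      · intro u
        obtain ⟨N, hN⟩ := hv.2 u
        obtain ⟨N', hN'⟩ := hv.1 (C.zero10 u b)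
        exact ⟨max N (N' - k), fun n hn => by
          rw [m1_m0, hN n (by omega), hN' (n + k) (by omega), smul_zero, add_zero]⟩
    · intro k b v hv
      constructor
      · intro a
        obtain ⟨N, hN⟩ := hv.1 a
        obtain ⟨N', hN'⟩ := hv.1 (C.zero01 a b)
        exact ⟨max N (N' - k), fun n hn => by
          rw [m0_m1, hN n (by omega), hN' (n + k) (by omega), smul_zero, add_zero]⟩
      · intro u
        obtain ⟨N, hN⟩ := hv.2 u
        obtain ⟨N', hN'⟩ := hv.2 (C.zero11 u b)
        obtain ⟨N'', hN''⟩ := hv.1 (C.one11 u b)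
        exact ⟨max N (max (N' - k) (N'' - k + 1)), fun n hn => by
          rw [m1_m1, hN n (by omega), hN' (n + k) (by omega), hN'' (n + k - 1) (by omega),
            smul_zero, smul_zero, add_zero, add_zero]⟩
  have : v ∈ W := hW ▸ Submodule.mem_top
  exact this

/-- The generating vertex operators `a(x)` and `u(x)` on `V_𝓛`. -/
noncomputable def genField : C₀ ⊕ C₁ → VertexOperator ℂ C.VL
  | Sum.inl a => ofModes (fun n => Algebra.lsmul ℂ ℂ C.VL (C.m0 n a)) fun v => by
      simpa only [Algebra.lsmul_coe] using (C.VL_bdd v).1 a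
  | Sum.inr u => ofModes (fun n => Algebra.lsmul ℂ ℂ C.VL (C.m1 n u)) fun v => by
      simpa only [Algebra.lsmul_coe] using (C.VL_bdd v).2 u

theorem ncoeff_genField_inl (a : C₀) (n : ℤ) (v : C.VL) :
    VertexOperator.ncoeff (C.genField (Sum.inl a)) n v = C.m0 n a • v := by
  rw [genField, ncoeff_ofModes]
  rfl

theorem ncoeff_genField_inr (u : C₁) (n : ℤ) (v : C.VL) :
    VertexOperator.ncoeff (C.genField (Sum.inr u)) n v = C.m1 n u • v := by
  rw [genField, ncoeff_ofModes]
  rfl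

/-- The commutators involve no delta function for two elements of `C₀`, the delta function for mixed
pairs, and also its first derivative for two elements of `C₁`; hence the orders 0, 1 and 2. -/
theorem genField_local (i j : C₀ ⊕ C₁) : MutuallyLocal (C.genField i) (C.genField j) := by
  have h01 : ∀ a u, MutuallyLocal (C.genField (Sum.inl a)) (C.genField (Sum.inr u)) := by
    intro a u
    refine ⟨1, ?_⟩
    funext p q w
    have e : p + 1 + q = p + (q + 1) := by ring
    simp only [pow_one, diff_apply, Pi.sub_apply, comp₂, swap_apply, ncoeff_genField_inl,
      ncoeff_genField_inr, m0_m1, add_sub_cancel_left, e, sub_self, Pi.zero_apply]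
  match i, j with
  | Sum.inl a, Sum.inl a' =>
    refine ⟨0, ?_⟩
    funext p q w
    simp only [pow_zero, Module.End.one_apply, Pi.sub_apply, comp₂, swap_apply,
      ncoeff_genField_inl, m0_m0 C p q, sub_self, Pi.zero_apply]
  | Sum.inl a, Sum.inr u => exact h01 a u
  | Sum.inr u, Sum.inl a => exact (h01 a u).symm
  | Sum.inr u, Sum.inr u' =>
    refine ⟨2, ?_⟩
    funext p q w
    have e1 : p + 1 + (q + 1) = p + (q + 1 + 1) := by ring
    have e2 : p + 1 + 1 + q = p + (q + 1 + 1) := by ring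
    simp only [pow_two, Module.End.mul_apply, diff_apply, Pi.sub_apply, comp₂, swap_apply,
      ncoeff_genField_inr, m1_m1 C _ _ u u', add_sub_cancel_left, e1, e2, Pi.zero_apply]
    generalize C.m1 _ _ • w = x
    generalize C.m0 _ _ • w = y
    push_cast
    module

/-- The reconstruction theorem applied to `genField`. The operator `D` induced by `-d/dt` is
returned too, to be recognized later as `𝒟`. -/
theorem exists_isCanonical : ∃ (𝒱 : VertexAlgebra C.VL) (D : Module.End ℂ C.VL), C.IsCanonical 𝒱 ∧
    D C.one = 0 ∧
    (∀ n a v, D (C.m0 n a • v) = C.m0 n a • D v - (n : ℂ) • C.m0 (n - 1) a • v) ∧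
    (∀ n u v, D (C.m1 n u • v) = C.m1 n u • D v - (n : ℂ) • C.m1 (n - 1) u • v) ∧
    ∀ u n v, D (𝒱.mode u n v) = 𝒱.mode u n (D v) - n • 𝒱.mode u (n - 1) v := by
  obtain ⟨δ, hδ0, hδ1, hδ⟩ := C.exists_lieDerivation_D
  have hN : C.nonnegPart ≤ C.nonnegPart.comap δ := by
    refine C.nonnegPart_le (fun n hn a => ?_) (fun n hn u => ?_)
    · rw [Submodule.mem_comap, hδ0]
      rcases hn.eq_or_lt with rfl | hn
      · simp
      · exact neg_mem (Submodule.smul_mem _ _ (C.x0_mem_nonnegPart (by omega) a))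
    · rw [Submodule.mem_comap, hδ1]
      rcases hn.eq_or_lt with rfl | hn
      · simp
      · exact neg_mem (Submodule.smul_mem _ _ (C.x1_mem_nonnegPart (by omega) u))
  obtain ⟨D, hD1, hD⟩ := exists_derivation (N := C.nonnegPart) (K := C.vacIdeal) rfl δ hδ fun x hx => hN hx
  have hD0 : ∀ n a (v : C.VL),
      D (C.m0 n a • v) = C.m0 n a • D v - (n : ℂ) • C.m0 (n - 1) a • v := by
    intro n a v
    rw [m0_eq, m0_eq]
    refine (hD _ v).trans ?_
    rw [hδ0, map_neg, map_smul, neg_smul, smul_assoc, neg_add_eq_sub]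
  have hD1' : ∀ n u (v : C.VL),
      D (C.m1 n u • v) = C.m1 n u • D v - (n : ℂ) • C.m1 (n - 1) u • v := by
    intro n a v
    rw [m1_eq, m1_eq]
    refine (hD _ v).trans ?_
    rw [hδ1, map_neg, map_smul, neg_smul, smul_assoc, neg_add_eq_sub]
  have hG : GeneratingFields C.one D C.genField :=
    { D_vac := hD1
      mutuallyLocal := C.genField_local
      covariant := fun i n w => by
        rw [← Int.cast_smul_eq_zsmul ℂ]
        match i with
        | Sum.inl a => simp only [ncoeff_genField_inl, hD0]
        | Sum.inr u => simp only [ncoeff_genField_inr, hD1']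
      regular := fun i n hn => by
        match i with
        | Sum.inl a => rw [ncoeff_genField_inl, m0_smul_one C hn]
        | Sum.inr u => rw [ncoeff_genField_inr, m1_smul_one C hn]
      generate := fun W h1 h => C.VL_induction h1
        (fun n a w hw => by rw [← ncoeff_genField_inl]; exact h _ n w hw)
        (fun n u w hw => by rw [← ncoeff_genField_inr]; exact h _ n w hw) }
  refine ⟨hG.vertexAlgebra, D, ⟨rfl, fun a n v => ?_, fun u n v => ?_⟩, hD1, hD0, hD1',
    hG.vertexAlgebra_covariant⟩
  · rw [← ncoeff_genField_inl, ← ncoeff_genField_inl]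
    change VertexOperator.ncoeff (hG.vertexAlgebra.Y _) n v = _
    rw [hG.vertexAlgebra_Y]
  · rw [← ncoeff_genField_inr, ← ncoeff_genField_inr]
    change VertexOperator.ncoeff (hG.vertexAlgebra.Y _) n v = _
    rw [hG.vertexAlgebra_Y]

namespace IsCanonical

variable {C} {𝒱 : VertexAlgebra C.VL} (h : C.IsCanonical 𝒱)
include h

/-- A property of vectors of `V_𝓛` that is inherited by products with the generators holds
everywhere. -/
theorem induction {W : Submodule ℂ C.VL} (h1 : 𝒱.vac ∈ W)
    (h0 : ∀ a n, ∀ w ∈ W, 𝒱.mode (C.m0 (-1) a • C.one) n w ∈ W)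
    (h1' : ∀ u n, ∀ w ∈ W, 𝒱.mode (C.m1 (-1) u • C.one) n w ∈ W) : W = ⊤ :=
  C.VL_induction (h.vac_eq ▸ h1) (fun n a w hw => h.mode_zero a n w ▸ h0 a n w hw)
    (fun n u w hw => h.mode_one u n w ▸ h1' u n w hw)

/-- By the iterate formula, the vectors whose modes agree in both structures are stable under the
generators. -/
theorem unique {𝒱' : VertexAlgebra C.VL} (h' : C.IsCanonical 𝒱') : 𝒱' = 𝒱 := by
  refine VertexAlgebra.eq_of_mode (h'.vac_eq.trans h.vac_eq.symm) fun u n v => ?_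
  let W : Submodule ℂ C.VL :=
    { carrier := {u | ∀ n v, 𝒱'.mode u n v = 𝒱.mode u n v}
      zero_mem' := fun n v => by
        rw [← VertexAlgebra.modeLin_apply, ← VertexAlgebra.modeLin_apply, map_zero, map_zero]
      add_mem' := fun {u w} hu hw n v => by
        have hu' := hu n v
        have hw' := hw n v
        rw [← VertexAlgebra.modeLin_apply, ← VertexAlgebra.modeLin_apply] at hu' hw' ⊢
        rw [map_add, map_add, LinearMap.add_apply, LinearMap.add_apply, hu', hw']
      smul_mem' := fun c u hu n v => by
        have hu' := hu n v
        rw [← VertexAlgebra.modeLin_apply, ← VertexAlgebra.modeLin_apply] at hu' ⊢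
        rw [map_smul, map_smul, LinearMap.smul_apply, LinearMap.smul_apply, hu'] }
  have hW : W = ⊤ := by
    refine h.induction (fun n v => ?_) (fun a k w hw n v => ?_) (fun a k w hw n v => ?_)
    · rw [VertexAlgebra.mode, VertexAlgebra.mode, 𝒱.vacuum, h.vac_eq, ← h'.vac_eq, 𝒱'.vacuum]
    · have hw' : ∀ n v, 𝒱'.mode w n v = 𝒱.mode w n v := hw
      rw [𝒱.mode_mode, show 𝒱.mode (C.m0 (-1) a • C.one) k w = 𝒱'.mode (C.m0 (-1) a • C.one) k w by
        rw [h.mode_zero, h'.mode_zero], 𝒱'.mode_mode]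
      simp only [h'.mode_zero, h.mode_zero, hw']
    · have hw' : ∀ n v, 𝒱'.mode w n v = 𝒱.mode w n v := hw
      rw [𝒱.mode_mode, show 𝒱.mode (C.m1 (-1) a • C.one) k w = 𝒱'.mode (C.m1 (-1) a • C.one) k w by
        rw [h.mode_one, h'.mode_one], 𝒱'.mode_mode]
      simp only [h'.mode_one, h.mode_one, hw']
  have : u ∈ W := hW ▸ Submodule.mem_top
  exact this n v

end IsCanonical

end OneTruncatedConformalAlgebra

/-! ### Factorization of enveloping algebras along a splitting into subalgebras -/

/-- A decomposition of a Lie algebra into the direct sum of two subalgebras, given by the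
projection onto the first along the second. -/
structure LieSplitting (L : Type*) [LieRing L] [LieAlgebra ℂ L] where
  proj : L →ₗ[ℂ] L
  proj_proj : ∀ x, proj (proj x) = proj x
  lie_range : ∀ x y, proj ⁅proj x, proj y⁆ = ⁅proj x, proj y⁆
  lie_ker : ∀ x y, proj ⁅x - proj x, y - proj y⁆ = 0

namespace LieSplitting

attribute [local instance 100] LieRing.ofAssociativeRing

open UniversalEnvelopingAlgebra

variable {L : Type*} [LieRing L] [LieAlgebra ℂ L] (S : LieSplitting L)

/-- The first subalgebra. -/
def P : LieSubalgebra ℂ L where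
  toSubmodule := LinearMap.eqLocus S.proj LinearMap.id
  lie_mem' := fun {x y} hx hy => by
    have hx' : S.proj x = x := hx
    have hy' : S.proj y = y := hy
    have := S.lie_range x y
    rwa [hx', hy'] at this

/-- The second subalgebra. -/
def Q : LieSubalgebra ℂ L where
  toSubmodule := LinearMap.ker S.proj
  lie_mem' := fun {x y} hx hy => by
    have hx' : S.proj x = 0 := hx
    have hy' : S.proj y = 0 := hy
    have := S.lie_ker x y
    rwa [hx', hy', sub_zero, sub_zero] at this

/-- The projection onto the first subalgebra. -/
def prP : L →ₗ[ℂ] S.P := LinearMap.codRestrict S.P.toSubmodule S.proj S.proj_proj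

/-- The projection onto the second subalgebra. -/
def prQ : L →ₗ[ℂ] S.Q := LinearMap.codRestrict S.Q.toSubmodule (LinearMap.id - S.proj) fun x => by
  change S.proj (x - S.proj x) = 0
  rw [map_sub, S.proj_proj, sub_self]

theorem prP_add_prQ (x : L) : (S.prP x : L) + S.prQ x = x := by
  change S.proj x + (x - S.proj x) = x
  abel

theorem prP_P (p : S.P) : S.prP p = p := Subtype.ext p.2

theorem prQ_P (p : S.P) : S.prQ p = 0 := Subtype.ext (sub_eq_zero.2 p.2.symm)

theorem prP_Q (q : S.Q) : S.prP q = 0 := Subtype.ext q.2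

theorem prQ_Q (q : S.Q) : S.prQ q = q := by
  refine Subtype.ext ?_
  change (q : L) - S.proj q = q
  rw [show S.proj (q : L) = 0 from q.2, sub_zero]

/-- The component of `[q, p]` in the first subalgebra. -/
noncomputable def α (q : S.Q) (p : S.P) : S.P := S.prP ⁅(q : L), (p : L)⁆

/-- The component of `[q, p]` in the second subalgebra. -/
noncomputable def β : S.Q →ₗ[ℂ] S.P →ₗ[ℂ] S.Q :=
  LinearMap.mk₂ ℂ (fun q p => S.prQ ⁅(q : L), (p : L)⁆)
    (fun q q' p => by simp) (fun c q p => by simp) (fun q p p' => by simp) (fun c q p => by simp)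

theorem β_apply (q : S.Q) (p : S.P) : S.β q p = S.prQ ⁅(q : L), (p : L)⁆ := rfl

theorem lie_eq (q : S.Q) (p : S.P) : ⁅(q : L), (p : L)⁆ = S.α q p + S.β q p :=
  (S.prP_add_prQ _).symm

theorem prP_lie_P (p p' : S.P) : S.prP ⁅(p : L), (p' : L)⁆ = ⁅p, p'⁆ := S.prP_P ⁅p, p'⁆

theorem prQ_lie_P (p p' : S.P) : S.prQ ⁅(p : L), (p' : L)⁆ = 0 := S.prQ_P ⁅p, p'⁆

theorem prP_lie_Q (q q' : S.Q) : S.prP ⁅(q : L), (q' : L)⁆ = 0 := S.prP_Q ⁅q, q'⁆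

theorem prQ_lie_Q (q q' : S.Q) : S.prQ ⁅(q : L), (q' : L)⁆ = ⁅q, q'⁆ := S.prQ_Q ⁅q, q'⁆

theorem prP_lie_QP (q : S.Q) (p : S.P) : S.prP ⁅(q : L), (p : L)⁆ = S.α q p := rfl

theorem prQ_lie_QP (q : S.Q) (p : S.P) : S.prQ ⁅(q : L), (p : L)⁆ = S.β q p := rfl

theorem prP_lie_PQ (p : S.P) (q : S.Q) : S.prP ⁅(p : L), (q : L)⁆ = -S.α q p := by
  rw [← lie_skew, map_neg, prP_lie_QP]

theorem prQ_lie_PQ (p : S.P) (q : S.Q) : S.prQ ⁅(p : L), (q : L)⁆ = -S.β q p := by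
  rw [← lie_skew, map_neg, prQ_lie_QP]

theorem α_add (q : S.Q) (p p' : S.P) : S.α q (p + p') = S.α q p + S.α q p' := by
  simp [α]

theorem jacobi_QPP (q : S.Q) (p p' : S.P) : ⁅(q : L), ((⁅p, p'⁆ : S.P) : L)⁆
    = ⁅(S.α q p : L), (p' : L)⁆ + ⁅(S.β q p : L), (p' : L)⁆
      + (⁅(p : L), (S.α q p' : L)⁆ + ⁅(p : L), (S.β q p' : L)⁆) := by
  rw [← add_lie, ← lie_add, ← lie_eq, ← lie_eq, LieSubalgebra.coe_bracket, leibniz_lie]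

theorem jacobi_QQP (q q' : S.Q) (p : S.P) : ⁅((⁅q, q'⁆ : S.Q) : L), (p : L)⁆
    = ⁅(q : L), (S.α q' p : L)⁆ + ⁅(q : L), (S.β q' p : L)⁆
      - (⁅(q' : L), (S.α q p : L)⁆ + ⁅(q' : L), (S.β q p : L)⁆) := by
  rw [← lie_add, ← lie_add, ← lie_eq, ← lie_eq, LieSubalgebra.coe_bracket, lie_lie]

/-- This and the next three identities are the matched pair conditions, the components of the Jacobi
identity. The first two make `pushRep` a representation; the last two give the action of `Q` in
`exists_rep`. -/
theorem α_lie (q : S.Q) (p p' : S.P) : S.α q ⁅p, p'⁆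
    = ⁅S.α q p, p'⁆ + ⁅p, S.α q p'⁆ + S.α (S.β q p) p' - S.α (S.β q p') p := by
  rw [α, jacobi_QPP]
  simp only [map_add, prP_lie_P, prP_lie_QP, prP_lie_PQ]
  abel

theorem β_lie (q : S.Q) (p p' : S.P) :
    S.β q ⁅p, p'⁆ = S.β (S.β q p) p' - S.β (S.β q p') p := by
  rw [β_apply, jacobi_QPP]
  simp only [map_add, prQ_lie_P, prQ_lie_QP, prQ_lie_PQ]
  abel

theorem lie_α (q q' : S.Q) (p : S.P) :
    S.α ⁅q, q'⁆ p = S.α q (S.α q' p) - S.α q' (S.α q p) := by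
  rw [α, jacobi_QQP]
  simp only [map_add, map_sub, prP_lie_Q, prP_lie_QP]
  abel

theorem lie_β (q q' : S.Q) (p : S.P) : S.β ⁅q, q'⁆ p
    = S.β q (S.α q' p) - S.β q' (S.α q p) + (⁅q, S.β q' p⁆ - ⁅q', S.β q p⁆) := by
  rw [β_apply, jacobi_QQP]
  simp only [map_add, map_sub, prQ_lie_Q, prQ_lie_QP]
  abel

/-- The enveloping algebra of the first subalgebra. -/
abbrev UP : Type _ := UniversalEnvelopingAlgebra ℂ S.P

/-- `q ↦ α(q, p) u`, as a bilinear map. -/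
noncomputable def αMul (p : S.P) (u : S.UP) : S.Q →ₗ[ℂ] S.UP where
  toFun q := ι ℂ (S.α q p) * u
  map_add' q q' := by simp [α, add_mul]
  map_smul' c q := by simp [α]

/-- The action of the first subalgebra that encodes the commutation past elements of the second. -/
noncomputable def pushRep : S.P →ₗ⁅ℂ⁆ Module.End ℂ ((S.Q →ₗ[ℂ] S.UP) × S.UP) where
  toFun p :=
    { toFun := fun x => (LinearMap.mulLeft ℂ (ι ℂ p) ∘ₗ x.1 + S.αMul p x.2 + x.1 ∘ₗ S.β.flip p,
        ι ℂ p * x.2)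
      map_add' := fun x y => by
        refine Prod.ext (LinearMap.ext fun q => ?_) ?_
        · simp only [αMul, LinearMap.add_apply, LinearMap.comp_apply, LinearMap.mulLeft_apply,
            LinearMap.coe_mk, AddHom.coe_mk, Prod.fst_add, Prod.snd_add, mul_add]
          abel
        · simp [mul_add]
      map_smul' := fun c x => by
        refine Prod.ext (LinearMap.ext fun q => ?_) ?_
        · simp [αMul]
        · simp }
  map_add' p p' := by
    refine LinearMap.ext fun x => Prod.ext (LinearMap.ext fun q => ?_) ?_
    · simp only [αMul, S.α_add, LinearMap.add_apply, LinearMap.comp_apply, LinearMap.mulLeft_apply,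
        LinearMap.coe_mk, AddHom.coe_mk, Prod.fst_add, add_mul, map_add,
        LinearMap.flip_apply]
      abel
    · simp [add_mul]
  map_smul' c p := by
    refine LinearMap.ext fun x => Prod.ext (LinearMap.ext fun q => ?_) ?_
    · simp [αMul, α]
    · simp
  map_lie' := fun {p p'} => by
    refine LinearMap.ext fun x => Prod.ext (LinearMap.ext fun q => ?_) ?_
    · change ι ℂ ⁅p, p'⁆ * x.1 q + ι ℂ (S.α q ⁅p, p'⁆) * x.2 + x.1 (S.β q ⁅p, p'⁆)
        = (ι ℂ p * (ι ℂ p' * x.1 q + ι ℂ (S.α q p') * x.2 + x.1 (S.β q p'))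
            + ι ℂ (S.α q p) * (ι ℂ p' * x.2)
            + (ι ℂ p' * x.1 (S.β q p) + ι ℂ (S.α (S.β q p) p') * x.2 + x.1 (S.β (S.β q p) p')))
          - (ι ℂ p' * (ι ℂ p * x.1 q + ι ℂ (S.α q p) * x.2 + x.1 (S.β q p))
            + ι ℂ (S.α q p') * (ι ℂ p * x.2)
            + (ι ℂ p * x.1 (S.β q p') + ι ℂ (S.α (S.β q p') p) * x.2 + x.1 (S.β (S.β q p') p)))
      rw [α_lie, β_lie]
      simp only [map_add, map_sub, LieHom.map_lie, LieRing.of_associative_ring_bracket, mul_add,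
        add_mul, sub_mul, mul_assoc]
      abel
    · change ι ℂ ⁅p, p'⁆ * x.2 = ι ℂ p * (ι ℂ p' * x.2) - ι ℂ p' * (ι ℂ p * x.2)
      rw [LieHom.map_lie, LieRing.of_associative_ring_bracket, sub_mul, mul_assoc, mul_assoc]

theorem UP_induction {W : Submodule ℂ S.UP} (h1 : 1 ∈ W) (h : ∀ p : S.P, ∀ u ∈ W, ι ℂ p * u ∈ W)
    (u : S.UP) : u ∈ W := by
  have := smul_mem_of_ι_smul_mem (L := S.P) (W := W) h u h1
  rwa [smul_eq_mul, mul_one] at this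

/-- The rule moves `q` to the right through a product from `P` until it reaches `1` and dies. Its
compatibility with the relations of `U(P)` is encoded in `pushRep`: the pair `(q ↦ q·u, u)` is the
image of `(0, 1)` under `u`. -/
theorem exists_act : ∃ act : S.Q →ₗ[ℂ] Module.End ℂ S.UP, (∀ q, act q 1 = 0) ∧
    ∀ q p u, act q (ι ℂ p * u) = ι ℂ p * act q u + ι ℂ (S.α q p) * u + act (S.β q p) u := by
  let Ψ : S.UP →ₗ[ℂ] (S.Q →ₗ[ℂ] S.UP) × S.UP :=
    LinearMap.applyₗ (0, 1) ∘ₗ (lift ℂ S.pushRep).toLinearMap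
  have h1 : Ψ 1 = (0, 1) := by simp [Ψ]
  have hmul : ∀ p u, Ψ (ι ℂ p * u) = S.pushRep p (Ψ u) := by
    intro p u
    change lift ℂ S.pushRep (ι ℂ p * u) (0, 1) = S.pushRep p (lift ℂ S.pushRep u (0, 1))
    rw [map_mul, lift_ι_apply, Module.End.mul_apply]
  have hsnd : ∀ u, (Ψ u).2 = u := by
    refine S.UP_induction (W := LinearMap.eqLocus (LinearMap.snd ℂ _ _ ∘ₗ Ψ) LinearMap.id) ?_ ?_
    · change (Ψ 1).2 = 1
      rw [h1]
    · intro p u hu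
      have hu' : (Ψ u).2 = u := hu
      change (Ψ (ι ℂ p * u)).2 = ι ℂ p * u
      rw [hmul]
      change ι ℂ p * (Ψ u).2 = _
      rw [hu']
  refine ⟨(LinearMap.fst ℂ _ _ ∘ₗ Ψ).flip, fun q => ?_, fun q p u => ?_⟩
  · change (Ψ 1).1 q = 0
    rw [h1]
    rfl
  · change (Ψ (ι ℂ p * u)).1 q = ι ℂ p * (Ψ u).1 q + ι ℂ (S.α q p) * u + (Ψ u).1 (S.β q p)
    rw [hmul]
    change ι ℂ p * (Ψ u).1 q + ι ℂ (S.α q p) * (Ψ u).2 + (Ψ u).1 (S.β q p) = _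
    rw [hsnd]

/-- The Lie algebra acts on the enveloping algebra of the first subalgebra, which acts by left
multiplication, while the second subalgebra annihilates the identity. -/
theorem exists_rep : ∃ ρ : L →ₗ⁅ℂ⁆ Module.End ℂ S.UP, (∀ p : S.P, ∀ u, ρ p u = ι ℂ p * u) ∧
    ∀ q : S.Q, ρ q 1 = 0 := by
  obtain ⟨act, h1, hact⟩ := S.exists_act
  -- Induction on `u`, with all `q`, `q'` at once: moving past `p` replaces them by `β q p` and `β
  -- q' p`.
  have hlie : ∀ u, ∀ q q', act q (act q' u) = act q' (act q u) + act ⁅q, q'⁆ u := by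
    let W : Submodule ℂ S.UP :=
      { carrier := {u | ∀ q q', act q (act q' u) = act q' (act q u) + act ⁅q, q'⁆ u}
        zero_mem' := fun q q' => by simp
        add_mem' := fun {u v} hu hv q q' => by
          simp only [map_add, hu q q', hv q q']
          abel
        smul_mem' := fun c u hu q q' => by simp only [map_smul, hu q q', smul_add] }
    refine S.UP_induction (W := W) (fun q q' => by simp [h1]) fun p u hu q q' => ?_
    have hu' : ∀ q q', act q (act q' u) = act q' (act q u) + act ⁅q, q'⁆ u := hu
    simp only [hact, map_add, hu' q q', hu' (S.β q p) q', hu' q (S.β q' p), lie_α, lie_β, map_sub,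
      mul_add, sub_mul, LinearMap.add_apply, LinearMap.sub_apply, ← lie_skew (S.β q p) q', map_neg,
      LinearMap.neg_apply]
    abel
  have hPP : ∀ p p' : S.P, ∀ u : S.UP,
      ι ℂ p * (ι ℂ p' * u) = ι ℂ p' * (ι ℂ p * u) + ι ℂ ⁅p, p'⁆ * u := by
    intro p p' u
    rw [← mul_assoc, ι_mul_ι, add_mul, mul_assoc]
  let ρ : L →ₗ⁅ℂ⁆ Module.End ℂ S.UP :=
    { toFun := fun x => LinearMap.mulLeft ℂ (ι ℂ (S.prP x)) + act (S.prQ x)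
      map_add' := fun x y => by
        refine LinearMap.ext fun u => ?_
        simp only [map_add, LinearMap.add_apply, LinearMap.mulLeft_apply, add_mul]
        abel
      map_smul' := fun c x => by
        refine LinearMap.ext fun u => ?_
        simp [smul_add]
      map_lie' := fun {x y} => by
        refine LinearMap.ext fun u => ?_
        change ι ℂ (S.prP ⁅x, y⁆) * u + act (S.prQ ⁅x, y⁆) u
          = (ι ℂ (S.prP x) * (ι ℂ (S.prP y) * u + act (S.prQ y) u)
              + act (S.prQ x) (ι ℂ (S.prP y) * u + act (S.prQ y) u))
            - (ι ℂ (S.prP y) * (ι ℂ (S.prP x) * u + act (S.prQ x) u)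
              + act (S.prQ y) (ι ℂ (S.prP x) * u + act (S.prQ x) u))
        have hxy : ⁅x, y⁆ = ⁅(S.prP x : L), (S.prP y : L)⁆ + ⁅(S.prP x : L), (S.prQ y : L)⁆
            + (⁅(S.prQ x : L), (S.prP y : L)⁆ + ⁅(S.prQ x : L), (S.prQ y : L)⁆) := by
          rw [← lie_add, ← lie_add, ← add_lie, prP_add_prQ, prP_add_prQ]
        rw [hxy]
        simp only [map_add, prP_lie_P, prP_lie_PQ, prP_lie_QP, prP_lie_Q, prQ_lie_P, prQ_lie_PQ,
          prQ_lie_QP, prQ_lie_Q, mul_add, add_mul, hact, hPP (S.prP x) (S.prP y),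
          hlie u (S.prQ x) (S.prQ y), map_neg, neg_mul, LinearMap.add_apply, LinearMap.neg_apply,
          map_zero, zero_mul, LinearMap.zero_apply]
        abel }
  refine ⟨ρ, fun p u => ?_, fun q => ?_⟩
  · change ι ℂ (S.prP p) * u + act (S.prQ p) u = _
    rw [prP_P, prQ_P, map_zero, LinearMap.zero_apply, add_zero]
  · change ι ℂ (S.prP q) * 1 + act (S.prQ q) 1 = _
    rw [prP_Q, h1, map_zero, zero_mul, add_zero]

/-- A module of the first subalgebra receives a map from the module induced from the second. -/
theorem exists_linearMap {K : Submodule (UniversalEnvelopingAlgebra ℂ L)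
      (UniversalEnvelopingAlgebra ℂ L)}
    (hK : K = Submodule.span _ (ι ℂ '' (LinearMap.ker S.proj : Set L))) {T : Type*}
    [AddCommGroup T] [Module ℂ T] (τ : L →ₗ[ℂ] Module.End ℂ T)
    (hτ : ∀ x y, τ ⁅S.proj x, S.proj y⁆ = ⁅τ (S.proj x), τ (S.proj y)⁆) (e : T) :
    ∃ φ : (UniversalEnvelopingAlgebra ℂ L ⧸ K) →ₗ[ℂ] T, φ (K.mkQ 1) = e ∧
      ∀ x v, φ (ι ℂ (S.proj x) • v) = τ (S.proj x) (φ v) := by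
  obtain ⟨ρ, hρP, hρQ⟩ := S.exists_rep
  obtain ⟨φ, h1, hφ⟩ := exists_linearMap_of_annihilated hK ρ (e := 1) fun x hx => hρQ ⟨x, hx⟩
  let σ : S.P →ₗ⁅ℂ⁆ Module.End ℂ T :=
    { toFun := fun p => τ p
      map_add' := fun p p' => by simp
      map_smul' := fun c p => by simp
      map_lie' := fun {p p'} => by
        have := hτ p p'
        rwa [show S.proj p = p from p.2, show S.proj p' = p' from p'.2] at this }
  -- The composite `U(L)/K → U(P) → T`; both maps respect the action of `P`, the second being `u ↦ u
  -- e`.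
  refine ⟨LinearMap.applyₗ e ∘ₗ (lift ℂ σ).toLinearMap ∘ₗ φ, ?_, fun x v => ?_⟩
  · change lift ℂ σ (φ (K.mkQ 1)) e = e
    rw [h1, map_one, Module.End.one_apply]
  · change lift ℂ σ (φ (ι ℂ (S.proj x) • v)) e = τ (S.proj x) (lift ℂ σ (φ v) e)
    rw [hφ, show S.proj x = (S.prP x : L) from rfl, hρP, map_mul, lift_ι_apply]
    rfl

end LieSplitting

/-! ### Creation operators, the translation operator and ideals of `V_𝓛` -/

namespace VertexAlgebra

variable {V : Type*} [AddCommGroup V] [Module ℂ V]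

/-- The operator `𝒟` as a linear map. -/
noncomputable def translation (𝒱 : VertexAlgebra V) : Module.End ℂ V :=
  LinearMap.applyₗ 𝒱.vac ∘ₗ 𝒱.modeLin (-2)

theorem translation_apply (𝒱 : VertexAlgebra V) (v : V) : 𝒱.translation v = 𝒱.D v := rfl

end VertexAlgebra

namespace OneTruncatedConformalAlgebra

open UniversalEnvelopingAlgebra FormalCalculus

variable {C₀ C₁ : Type*} [AddCommGroup C₀] [Module ℂ C₀] [AddCommGroup C₁] [Module ℂ C₁]
variable (C : OneTruncatedConformalAlgebra C₀ C₁)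

/-- The relation `(∂a)(n) + n a(n-1) = 0` pairs a nonnegative mode with a negative one only at `n =
0`, where the coefficient vanishes; so cutting off by the sign of the index is well defined. -/
theorem exists_negProj : ∃ S : LieSplitting C.LieAlg, LinearMap.ker S.proj = C.nonnegPart ∧
    (∀ n : ℤ, n < 0 → ∀ a, S.proj (C.x0 n a) = C.x0 n a) ∧
    (∀ n : ℤ, n < 0 → ∀ u, S.proj (C.x1 n u) = C.x1 n u) ∧
    (∀ n : ℤ, 0 ≤ n → ∀ a, S.proj (C.x0 n a) = 0) ∧
    (∀ n : ℤ, 0 ≤ n → ∀ u, S.proj (C.x1 n u) = 0) := by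
  obtain ⟨f, h0, h1⟩ := C.exists_lieLift (fun n => if n < 0 then C.x0 n else 0)
    (fun n => if n < 0 then C.x1 n else 0) fun n a => by
      rcases lt_trichotomy n 0 with h | h | h
      · rw [if_pos h, if_pos (by omega), x1_d, neg_add_cancel]
      · simp [h]
      · rw [if_neg (by omega), if_neg (by omega)]
        simp
  have n0 : ∀ n : ℤ, n < 0 → ∀ a, f (C.x0 n a) = C.x0 n a := fun n hn a => by rw [h0, if_pos hn]
  have n1 : ∀ n : ℤ, n < 0 → ∀ u, f (C.x1 n u) = C.x1 n u := fun n hn u => by rw [h1, if_pos hn]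
  have p0 : ∀ n : ℤ, 0 ≤ n → ∀ a, f (C.x0 n a) = 0 := fun n hn a => by
    rw [h0, if_neg (by omega), LinearMap.zero_apply]
  have p1 : ∀ n : ℤ, 0 ≤ n → ∀ u, f (C.x1 n u) = 0 := fun n hn u => by
    rw [h1, if_neg (by omega), LinearMap.zero_apply]
  have hproj : ∀ x, f (f x) = f x := by
    intro x
    induction x using C.lie_induction with
    | hadd x y hx hy => rw [map_add, map_add, hx, hy]
    | h0 n a =>
      rcases lt_or_ge n 0 with h | h
      · rw [n0 n h, n0 n h]
      · rw [p0 n h, map_zero]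
    | h1 n a =>
      rcases lt_or_ge n 0 with h | h
      · rw [n1 n h, n1 n h]
      · rw [p1 n h, map_zero]
  have hmem : ∀ x, x - f x ∈ C.nonnegPart := by
    intro x
    induction x using C.lie_induction with
    | hadd x y hx hy =>
      rw [map_add, add_sub_add_comm]
      exact add_mem hx hy
    | h0 n a =>
      rcases lt_or_ge n 0 with h | h
      · rw [n0 n h, sub_self]
        exact zero_mem _
      · rw [p0 n h, sub_zero]
        exact C.x0_mem_nonnegPart h a
    | h1 n a =>
      rcases lt_or_ge n 0 with h | h
      · rw [n1 n h, sub_self]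
        exact zero_mem _
      · rw [p1 n h, sub_zero]
        exact C.x1_mem_nonnegPart h a
  have hker : LinearMap.ker f = C.nonnegPart := by
    refine le_antisymm (fun x hx => ?_) (C.nonnegPart_le p0 p1)
    have := hmem x
    rwa [LinearMap.mem_ker.1 hx, sub_zero] at this
  refine ⟨⟨f, hproj, fun x y => ?_, fun x y => ?_⟩, hker, n0, n1, p0, p1⟩
  · induction x using C.lie_induction with
    | hadd x x' hx hx' => rw [map_add, add_lie, map_add, hx, hx']
    | h0 m a =>
      rcases lt_or_ge m 0 with hm | hm
      · rw [n0 m hm]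
        induction y using C.lie_induction with
        | hadd y y' hy hy' => rw [map_add, lie_add, map_add, hy, hy']
        | h0 n a' =>
          rcases lt_or_ge n 0 with hn | hn
          · rw [n0 n hn, lie_x0_x0, map_zero]
          · rw [p0 n hn, lie_zero, map_zero]
        | h1 n u =>
          rcases lt_or_ge n 0 with hn | hn
          · rw [n1 n hn, lie_x0_x1, n0 _ (by omega)]
          · rw [p1 n hn, lie_zero, map_zero]
      · rw [p0 m hm, zero_lie, map_zero]
    | h1 m u =>
      rcases lt_or_ge m 0 with hm | hm
      · rw [n1 m hm]
        induction y using C.lie_induction with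
        | hadd y y' hy hy' => rw [map_add, lie_add, map_add, hy, hy']
        | h0 n a' =>
          rcases lt_or_ge n 0 with hn | hn
          · rw [n0 n hn, lie_x1_x0, n0 _ (by omega)]
          · rw [p0 n hn, lie_zero, map_zero]
        | h1 n u =>
          rcases lt_or_ge n 0 with hn | hn
          · rw [n1 n hn, lie_x1_x1, map_add, map_smul, n0 _ (by omega), n1 _ (by omega)]
          · rw [p1 n hn, lie_zero, map_zero]
      · rw [p1 m hm, zero_lie, map_zero]
  · have hx := hmem x
    have hy := hmem y
    rw [nonnegPart] at hx hy
    change f ⁅x - f x, y - f y⁆ = 0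
    generalize x - f x = z at hx ⊢
    generalize y - f y = z' at hy ⊢
    induction hx using Submodule.span_induction with
    | zero => rw [zero_lie, map_zero]
    | add x x' _ _ hx hx' => rw [add_lie, map_add, hx, hx', add_zero]
    | smul c x _ hx => rw [smul_lie, map_smul, hx, smul_zero]
    | mem x hx =>
      induction hy using Submodule.span_induction with
      | zero => rw [lie_zero, map_zero]
      | add y y' _ _ hy hy' => rw [lie_add, map_add, hy, hy', add_zero]
      | smul c y _ hy => rw [lie_smul, map_smul, hy, smul_zero]
      | mem y hy =>
        obtain ⟨m, hm, ⟨a, rfl⟩ | ⟨u, rfl⟩⟩ := hx <;> obtain ⟨n, hn, ⟨a', rfl⟩ | ⟨v, rfl⟩⟩ := hy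
        · change f ⁅C.x0 m a, C.x0 n a'⁆ = 0
          rw [lie_x0_x0, map_zero]
        · change f ⁅C.x0 m a, C.x1 n v⁆ = 0
          rw [lie_x0_x1, p0 _ (by omega)]
        · change f ⁅C.x1 m u, C.x0 n a'⁆ = 0
          rw [lie_x1_x0, p0 _ (by omega)]
        · change f ⁅C.x1 m u, C.x1 n v⁆ = 0
          rw [lie_x1_x1, map_add, map_smul, p1 _ (by omega)]
          -- The index `m + n - 1` can be negative only for `m = n = 0`, and the factor `m` kills
          -- that case.
          rcases hm.eq_or_lt with rfl | hm
          · simp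
          · rw [p0 _ (by omega), smul_zero, add_zero]

/-- All modes of `C₀` except `a(-1)` are thereby modes of `C₁`, which is why later inductions treat
only `a(-1)` separately. -/
theorem m0_eq_m1_d {n : ℤ} (hn : n ≠ 0) (a : C₀) :
    C.m0 (n - 1) a = (-(n : ℂ)⁻¹) • C.m1 n (C.d a) := by
  have hn' : (n : ℂ) ≠ 0 := by exact_mod_cast hn
  rw [m1_d, smul_neg, neg_smul, neg_neg, smul_smul, inv_mul_cancel₀ hn', one_smul]

section Creation

variable {M : Type*} [AddCommGroup M] [Module ℂ M]
  [Module (UniversalEnvelopingAlgebra ℂ C.LieAlg) M]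
  [IsScalarTower ℂ (UniversalEnvelopingAlgebra ℂ C.LieAlg) M]

/-- The vectors obtained by creation operators from a given subspace. -/
inductive Created (W : Submodule ℂ M) : M → Prop
  | base {w : M} : w ∈ W → Created W w
  | zero_mode {w : M} {n : ℤ} (a : C₀) : n < 0 → Created W w → Created W (C.m0 n a • w)
  | one_mode {w : M} {n : ℤ} (u : C₁) : n < 0 → Created W w → Created W (C.m1 n u • w)

/-- If a subspace is stable under `𝓛^{≥ 0}`, then the `𝓛`-module generated by it is spanned by
the vectors obtained by creation operators. -/
theorem smul_mem_of_creation {W N : Submodule ℂ M} (hWN : W ≤ N)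
    (hW0 : ∀ n : ℤ, 0 ≤ n → ∀ a, ∀ w ∈ W, C.m0 n a • w ∈ W)
    (hW1 : ∀ n : ℤ, 0 ≤ n → ∀ u, ∀ w ∈ W, C.m1 n u • w ∈ W)
    (hN0 : ∀ a, ∀ w ∈ N, C.m0 (-1) a • w ∈ N)
    (hN1 : ∀ n : ℤ, n < 0 → ∀ u, ∀ w ∈ N, C.m1 n u • w ∈ N)
    (z : UniversalEnvelopingAlgebra ℂ C.LieAlg) {w : M} (hw : w ∈ W) : z • w ∈ N := by
  have hN0' : ∀ n : ℤ, n < 0 → ∀ a, ∀ w ∈ N, C.m0 n a • w ∈ N := by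
    intro n hn a w hw
    rcases eq_or_ne n (-1) with rfl | hn'
    · exact hN0 a w hw
    · have := C.m0_eq_m1_d (n := n + 1) (by omega) a
      rw [add_sub_cancel_right] at this
      rw [this, smul_assoc]
      exact N.smul_mem _ (hN1 _ (by omega) _ _ hw)
  set X := Submodule.span ℂ {w | C.Created W w} with hX
  have hXN : X ≤ N := by
    refine Submodule.span_le.2 fun w hw => ?_
    induction hw with
    | base hw => exact hWN hw
    | zero_mode a hn _ ih => exact hN0' _ hn a _ ih
    | one_mode u hn _ ih => exact hN1 _ hn u _ ih
  have hXs0 : ∀ n : ℤ, n < 0 → ∀ a, ∀ w ∈ X, C.m0 n a • w ∈ X := by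
    intro n hn a w hw
    induction hw using Submodule.span_induction with
    | mem w hw => exact Submodule.subset_span (hw.zero_mode a hn)
    | zero => rw [smul_zero]; exact X.zero_mem
    | add v w _ _ hv hw => rw [smul_add]; exact X.add_mem hv hw
    | smul c w _ hw => rw [smul_comm]; exact X.smul_mem c hw
  have hXs1 : ∀ n : ℤ, n < 0 → ∀ u, ∀ w ∈ X, C.m1 n u • w ∈ X := by
    intro n hn a w hw
    induction hw using Submodule.span_induction with
    | mem w hw => exact Submodule.subset_span (hw.one_mode a hn)
    | zero => rw [smul_zero]; exact X.zero_mem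
    | add v w _ _ hv hw => rw [smul_add]; exact X.add_mem hv hw
    | smul c w _ hw => rw [smul_comm]; exact X.smul_mem c hw
  -- Move `x` past the outermost creation operator: both `x` and the commutator then act on a
  -- shorter word, so the claim is kept for all `x` simultaneously.
  have hstep : ∀ w, C.Created W w → ∀ x : C.LieAlg, ι ℂ x • w ∈ X := by
    intro w hw
    induction hw with
    | base hw =>
      refine C.ι_smul_mem (fun n a => ?_) fun n u => ?_
      · rcases lt_or_ge n 0 with hn | hn
        · exact Submodule.subset_span ((Created.base hw).zero_mode a hn)
        · exact Submodule.subset_span (Created.base (hW0 n hn a _ hw))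
      · rcases lt_or_ge n 0 with hn | hn
        · exact Submodule.subset_span ((Created.base hw).one_mode u hn)
        · exact Submodule.subset_span (Created.base (hW1 n hn u _ hw))
    | zero_mode a hn _ ih =>
      intro x
      rw [m0_eq, ι_smul_ι_smul]
      exact X.add_mem (hXs0 _ hn a _ (ih x)) (ih _)
    | one_mode u hn _ ih =>
      intro x
      rw [m1_eq, ι_smul_ι_smul]
      exact X.add_mem (hXs1 _ hn u _ (ih x)) (ih _)
  have hstable : ∀ x : C.LieAlg, ∀ w ∈ X, ι ℂ x • w ∈ X := by
    intro x w hw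
    induction hw using Submodule.span_induction with
    | mem w hw => exact hstep w hw x
    | zero => rw [smul_zero]; exact X.zero_mem
    | add v w _ _ hv hw => rw [smul_add]; exact X.add_mem hv hw
    | smul c w _ hw => rw [smul_comm]; exact X.smul_mem c hw
  exact hXN (smul_mem_of_ι_smul_mem hstable z (Submodule.subset_span (Created.base hw)))

/-- The module generated by a vacuum vector is spanned by the vectors obtained from it by creation
operators. -/
theorem smul_mem_of_creation_vac {N : Submodule ℂ M} {e : M} (he : e ∈ N)
    (h0 : ∀ n : ℤ, 0 ≤ n → ∀ a, C.m0 n a • e = 0) (h1 : ∀ n : ℤ, 0 ≤ n → ∀ u, C.m1 n u • e = 0)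
    (hN0 : ∀ a, ∀ w ∈ N, C.m0 (-1) a • w ∈ N)
    (hN1 : ∀ n : ℤ, n < 0 → ∀ u, ∀ w ∈ N, C.m1 n u • w ∈ N)
    (z : UniversalEnvelopingAlgebra ℂ C.LieAlg) : z • e ∈ N := by
  refine C.smul_mem_of_creation (W := Submodule.span ℂ {e}) ?_ (fun n hn a w hw => ?_)
    (fun n hn u w hw => ?_) hN0 hN1 z (Submodule.mem_span_singleton_self e)
  · exact (Submodule.span_singleton_le_iff_mem _ _).2 he
  · obtain ⟨c, rfl⟩ := Submodule.mem_span_singleton.1 hw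
    rw [smul_comm, h0 n hn, smul_zero]
    exact zero_mem _
  · obtain ⟨c, rfl⟩ := Submodule.mem_span_singleton.1 hw
    rw [smul_comm, h1 n hn, smul_zero]
    exact zero_mem _

end Creation

theorem VL_creation_induction {N : Submodule ℂ C.VL} (he : C.one ∈ N)
    (hN0 : ∀ a, ∀ w ∈ N, C.m0 (-1) a • w ∈ N)
    (hN1 : ∀ n : ℤ, n < 0 → ∀ u, ∀ w ∈ N, C.m1 n u • w ∈ N) (v : C.VL) : v ∈ N := by
  obtain ⟨z, rfl⟩ := Submodule.mkQ_surjective _ v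
  have := C.smul_mem_of_creation_vac he (fun n hn => C.m0_smul_one hn)
    (fun n hn => C.m1_smul_one hn) hN0 hN1 z
  rwa [one, ← map_smul, smul_eq_mul, mul_one] at this

namespace IsCanonical

variable {C} {𝒱 : VertexAlgebra C.VL} (h : C.IsCanonical 𝒱)
include h

/-- By uniqueness `𝒱` is the constructed structure, and covariance of `v₋₁` on the vacuum gives `D v
= v₋₂ 𝟏`. -/
theorem translation_spec : 𝒱.translation C.one = 0 ∧
    (∀ n a v, 𝒱.translation (C.m0 n a • v)
      = C.m0 n a • 𝒱.translation v - (n : ℂ) • C.m0 (n - 1) a • v) ∧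
    (∀ n u v, 𝒱.translation (C.m1 n u • v)
      = C.m1 n u • 𝒱.translation v - (n : ℂ) • C.m1 (n - 1) u • v) ∧
    ∀ u n v, 𝒱.translation (𝒱.mode u n v)
      = 𝒱.mode u n (𝒱.translation v) - n • 𝒱.mode u (n - 1) v := by
  obtain ⟨𝒱', D, h', hD, hD0, hD1, hDm⟩ := C.exists_isCanonical
  obtain rfl := h.unique h'
  have : 𝒱'.translation = D := by
    refine LinearMap.ext fun v => ?_
    have h2 := hDm v (-1) 𝒱'.vac
    rw [VertexAlgebra.mode, VertexAlgebra.mode, 𝒱'.creation_limit, h.vac_eq, hD, map_zero, zero_sub,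
      neg_one_zsmul, neg_neg] at h2
    rw [h2, ← h.vac_eq]
    rfl
  rw [this]
  exact ⟨hD, hD0, hD1, hDm⟩

/-- The iterate formula extends stability from the generators to all left products. Right products
follow from the commutator formula, once `uₙ 𝟏 ∈ I` for `u ∈ I`, which needs stability under `𝒟`. -/
theorem isIdeal_of_stable (I : Submodule (UniversalEnvelopingAlgebra ℂ C.LieAlg) C.VL)
    (hI : ∀ v ∈ I, 𝒱.translation v ∈ I) : 𝒱.IsIdeal (I.restrictScalars ℂ) := by
  obtain ⟨hD, -, -, hDm⟩ := h.translation_spec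
  have hvac : 𝒱.translation 𝒱.vac = 0 := by rw [h.vac_eq, hD]
  have hleft : ∀ u, ∀ n, ∀ v ∈ I, 𝒱.mode u n v ∈ I := by
    let W : Submodule ℂ C.VL :=
      { carrier := {u | ∀ n, ∀ v ∈ I, 𝒱.mode u n v ∈ I}
        zero_mem' := fun n v _ => by
          rw [← VertexAlgebra.modeLin_apply, map_zero]
          exact I.zero_mem
        add_mem' := fun {u w} hu hw n v hv => by
          rw [← VertexAlgebra.modeLin_apply, map_add]
          exact I.add_mem (hu n v hv) (hw n v hv)
        smul_mem' := fun c u hu n v hv => by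
          rw [← VertexAlgebra.modeLin_apply, map_smul]
          exact (I.restrictScalars ℂ).smul_mem c (hu n v hv) }
    have hW : W = ⊤ := by
      refine h.induction (fun n v hv => ?_) (fun a k w hw n v hv => ?_) fun u k w hw n v hv => ?_
      · rw [VertexAlgebra.mode, 𝒱.vacuum]
        split
        · exact hv
        · exact I.zero_mem
      · refine 𝒱.mode_mode_mem (P := I.restrictScalars ℂ) (fun i => ?_) fun i => ?_
        · rw [h.mode_zero]
          exact I.smul_mem _ (hw _ _ hv)
        · rw [h.mode_zero]
          exact hw _ _ (I.smul_mem _ hv)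
      · refine 𝒱.mode_mode_mem (P := I.restrictScalars ℂ) (fun i => ?_) fun i => ?_
        · rw [h.mode_one]
          exact I.smul_mem _ (hw _ _ hv)
        · rw [h.mode_one]
          exact hw _ _ (I.smul_mem _ hv)
    intro u
    have : u ∈ W := hW ▸ Submodule.mem_top
    exact this
  refine ⟨hleft, fun u hu n v => ?_⟩
  let W : Submodule ℂ C.VL :=
    { carrier := {v | ∀ u ∈ I, ∀ n, 𝒱.mode u n v ∈ I}
      zero_mem' := fun u _ n => by
        rw [map_zero]
        exact I.zero_mem
      add_mem' := fun {v w} hv hw u hu n => by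
        rw [map_add]
        exact I.add_mem (hv u hu n) (hw u hu n)
      smul_mem' := fun c v hv u hu n => by
        rw [map_smul]
        exact (I.restrictScalars ℂ).smul_mem c (hv u hu n) }
  -- `uₙ gₖ w` differs from `gₖ uₙ w` by products of the vectors `gᵢ u`, again in `I`, with `w`.
  have hgen : ∀ g : C.VL, ∀ k, ∀ w ∈ W, 𝒱.mode g k w ∈ W := by
    intro g k w hw u hu n
    have hc := 𝒱.mode_commutator g u w k n
    rw [sub_eq_iff_eq_add, ← sub_eq_iff_eq_add'] at hc
    rw [← hc]
    exact I.sub_mem (hleft _ _ _ (hw u hu n)) (VertexAlgebra.finsum_mem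
      (P := I.restrictScalars ℂ) fun i => zsmul_mem (hw _ (hleft _ _ _ hu) _) _)
  have hW : W = ⊤ := by
    refine h.induction (fun u hu n => ?_) (fun a k w hw => hgen _ k w hw)
      fun a k w hw => hgen _ k w hw
    -- Up to a nonzero scalar, `u_{-k-1} 𝟏` is `𝒟ᵏ u`.
    have hneg : ∀ k : ℕ, 𝒱.mode u (-(k : ℤ) - 1) 𝒱.vac ∈ I := by
      intro k
      induction k with
      | zero =>
        rw [Nat.cast_zero, neg_zero, zero_sub, VertexAlgebra.mode, 𝒱.creation_limit]
        exact hu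
      | succ k ih =>
        have h1 := hDm u (-(k : ℤ) - 1) 𝒱.vac
        rw [hvac, map_zero, zero_sub] at h1
        have h2 := hI _ ih
        rw [h1, ← Int.cast_smul_eq_zsmul ℂ, ← neg_smul] at h2
        have hk : (-(((-(k : ℤ) - 1 : ℤ)) : ℂ)) ≠ 0 := by
          rw [neg_ne_zero, Int.cast_ne_zero]
          omega
        have h3 := (I.restrictScalars ℂ).smul_mem (-(((-(k : ℤ) - 1 : ℤ)) : ℂ))⁻¹ h2
        rw [smul_smul, inv_mul_cancel₀ hk, one_smul] at h3
        rwa [show -((k + 1 : ℕ) : ℤ) - 1 = -(k : ℤ) - 1 - 1 by push_cast; ring]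
    rcases le_or_gt 0 n with hn | hn
    · rw [VertexAlgebra.mode, 𝒱.creation_regular u n hn]
      exact I.zero_mem
    · have := hneg (-n - 1).toNat
      rwa [show -(((-n - 1).toNat : ℕ) : ℤ) - 1 = n by omega] at this
  have : v ∈ W := hW ▸ Submodule.mem_top
  exact this u hu n

end IsCanonical

end OneTruncatedConformalAlgebra

/-! ### The ideal `I_B` -/

namespace VertexAlgebroid

open UniversalEnvelopingAlgebra OneTruncatedConformalAlgebra

variable {A B : Type*} [CommRing A] [Algebra ℂ A] [AddCommGroup B] [Module ℂ B]
variable (S : VertexAlgebroid A B)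

theorem d_one : S.d 1 = 0 := by
  have h := S.d_mul 1 1
  rw [one_mul, S.one_act] at h
  simpa using h

theorem zero10_apply (b : B) (a : A) : S.toConformal.zero10 b a = S.anchor b a := rfl

theorem zero01_apply (a : A) (b : B) : S.toConformal.zero01 a b = -S.anchor b a := rfl

theorem d_apply (a : A) : S.toConformal.d a = S.d a := rfl

section Truncation

attribute [local instance 100] LieRing.ofAssociativeRing

/-- `a(-1)` on `A ⊕ B`. -/
noncomputable def truncA : A →ₗ[ℂ] Module.End ℂ (A × B) :=
  LinearMap.mk₂ ℂ (fun a x => (a * x.1, S.act a x.2)) (by intros; simp [add_mul])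
    (by intros; simp) (by intros; simp [mul_add]) (by intros; simp)

/-- `a(-2)` on `A ⊕ B`. -/
noncomputable def truncDA : A →ₗ[ℂ] Module.End ℂ (A × B) :=
  LinearMap.mk₂ ℂ (fun a x => (0, S.act x.1 (S.d a))) (by intros; simp)
    (by intros; simp) (by intros; simp) (by intros; simp)

/-- `b(-1)` on `A ⊕ B`. -/
noncomputable def truncB : B →ₗ[ℂ] Module.End ℂ (A × B) :=
  -- In `V_B` one must have `b(-1)a = a(-1)b + (π(b)(a))(-2)𝟏`, and `a'(-2)𝟏` is `∂a'`.
  LinearMap.mk₂ ℂ (fun b x => (0, S.act x.1 b + S.d (S.anchor b x.1)))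
    (by intros; simp; abel) (by intros; simp) (by intros; simp; abel) (by intros; simp)

theorem truncA_apply (a : A) (x : A × B) : S.truncA a x = (a * x.1, S.act a x.2) := rfl

theorem truncDA_apply (a : A) (x : A × B) : S.truncDA a x = (0, S.act x.1 (S.d a)) := rfl

theorem truncB_apply (b : B) (x : A × B) :
    S.truncB b x = (0, S.act x.1 b + S.d (S.anchor b x.1)) := rfl

/-- The action is not associative, but its associator is symmetric in `a` and `a'`. -/
theorem truncA_truncA (a a' : A) : ⁅S.truncA a, S.truncA a'⁆ = 0 := by
  refine LinearMap.ext fun x => ?_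
  have h := S.act_act a a' x.2
  have h' := S.act_act a' a x.2
  rw [mul_comm a' a, add_comm, ← h, sub_left_inj] at h'
  simp only [Ring.lie_def, LinearMap.sub_apply, Module.End.mul_apply, truncA_apply, h',
    LinearMap.zero_apply, mul_left_comm a, sub_self]

theorem truncA_truncDA (a a' : A) : ⁅S.truncA a, S.truncDA a'⁆ = 0 := by
  refine LinearMap.ext fun x => ?_
  have h := S.act_act a x.1 (S.d a')
  simp only [S.anchor_d, Derivation.zero_apply, map_zero, LinearMap.zero_apply, add_zero] at h
  simp only [Ring.lie_def, LinearMap.sub_apply, Module.End.mul_apply, truncA_apply, truncDA_apply,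
    LinearMap.zero_apply, mul_zero, Prod.mk_sub_mk, sub_self, h, Prod.mk_zero_zero]

theorem truncDA_truncDA (a a' : A) : ⁅S.truncDA a, S.truncDA a'⁆ = 0 := by
  refine LinearMap.ext fun x => ?_
  simp [Ring.lie_def, truncDA_apply]

/-- The associator of `a`, `x`, `b` cancels against the Leibniz terms of `∂(π(b)(a x))`, leaving `x
* ∂(π(b)(a))`. -/
theorem truncB_truncA (b : B) (a : A) : ⁅S.truncB b, S.truncA a⁆ = S.truncDA (S.anchor b a) := by
  refine LinearMap.ext fun x => ?_
  have h := S.act_act a x.1 b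
  rw [sub_eq_iff_eq_add] at h
  simp only [Ring.lie_def, LinearMap.sub_apply, Module.End.mul_apply, truncA_apply, truncDA_apply,
    truncB_apply, mul_zero, Prod.mk_sub_mk, sub_self, map_add, h, Derivation.leibniz, smul_eq_mul,
    S.d_mul]
  congr 1
  abel

theorem truncB_truncDA (b : B) (a : A) : ⁅S.truncB b, S.truncDA a⁆ = 0 := by
  refine LinearMap.ext fun x => ?_
  simp [Ring.lie_def, truncDA_apply, truncB_apply]

theorem truncB_truncB (b b' : B) : ⁅S.truncB b, S.truncB b'⁆ = 0 := by
  refine LinearMap.ext fun x => ?_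
  simp [Ring.lie_def, truncB_apply]

/-- The truncation of `V_𝓛` to `A ⊕ B`. -/
theorem exists_truncation : ∃ φ : S.VL →ₗ[ℂ] A × B, φ S.one = (1, 0) ∧
    (∀ a v, φ (S.modeA a (-1) • v) = (a * (φ v).1, S.act a (φ v).2)) ∧
    (∀ b v, φ (S.modeB b (-1) • v) = (0, S.act (φ v).1 b + S.d (S.anchor b (φ v).1))) ∧
    ∀ n : ℤ, n < -1 → ∀ b v, φ (S.modeB b n • v) = 0 := by
  -- Modes raising the degree by more than 1 act by zero. The zeros at nonnegative indices are
  -- placeholders, since only brackets of negative modes must be respected. At `n = -1` the defining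
  -- relation requires `truncB (∂a) = truncDA a`.
  obtain ⟨τ, τ0, τ1⟩ := S.toConformal.exists_lieLift
    (fun n => if n = -1 then S.truncA else if n = -2 then S.truncDA else 0)
    (fun n => if n = -1 then S.truncB else 0) fun n a => by
      rcases eq_or_ne n (-1) with rfl | h1
      · refine LinearMap.ext fun x => ?_
        simp [truncB_apply, truncDA_apply, S.anchor_d, d_apply]
      · rcases eq_or_ne n 0 with rfl | h0
        · simp
        · rw [if_neg h1, if_neg (by omega), if_neg (by omega)]
          simp
  have A1 : ∀ a, τ (S.toConformal.x0 (-1) a) = S.truncA a := fun a => by rw [τ0, if_pos rfl]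
  have A2 : ∀ a, τ (S.toConformal.x0 (-2) a) = S.truncDA a := fun a => by
    rw [τ0, if_neg (by norm_num), if_pos rfl]
  have A3 : ∀ n : ℤ, n < -2 → ∀ a, τ (S.toConformal.x0 n a) = 0 := fun n hn a => by
    rw [τ0, if_neg (by omega), if_neg (by omega), LinearMap.zero_apply]
  have B1 : ∀ b, τ (S.toConformal.x1 (-1) b) = S.truncB b := fun a => by rw [τ1, if_pos rfl]
  have B2 : ∀ n : ℤ, n < -1 → ∀ b, τ (S.toConformal.x1 n b) = 0 := fun n hn a => by
    rw [τ1, if_neg (by omega), LinearMap.zero_apply]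
  obtain ⟨P, hP, n0, n1, p0, p1⟩ := S.toConformal.exists_negProj
  have h00 : ∀ m n : ℤ, m < 0 → n < 0 → ∀ a a',
      ⁅τ (S.toConformal.x0 m a), τ (S.toConformal.x0 n a')⁆ = 0 := by
    intro m n hm hn a a'
    obtain rfl | rfl | hm : m = -1 ∨ m = -2 ∨ m < -2 := by omega
    · obtain rfl | rfl | hn : n = -1 ∨ n = -2 ∨ n < -2 := by omega
      · rw [A1, A1, truncA_truncA]
      · rw [A1, A2, truncA_truncDA]
      · rw [A3 n hn, lie_zero]
    · obtain rfl | rfl | hn : n = -1 ∨ n = -2 ∨ n < -2 := by omega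
      · rw [A1, A2, ← lie_skew, truncA_truncDA, neg_zero]
      · rw [A2, A2, truncDA_truncDA]
      · rw [A3 n hn, lie_zero]
    · rw [A3 m hm, zero_lie]
  have h10 : ∀ m n : ℤ, m < 0 → n < 0 → ∀ b a,
      τ (S.toConformal.x0 (m + n) (S.anchor b a))
        = ⁅τ (S.toConformal.x1 m b), τ (S.toConformal.x0 n a)⁆ := by
    intro m n hm hn b a
    obtain rfl | hm : m = -1 ∨ m < -1 := by omega
    · obtain rfl | rfl | hn : n = -1 ∨ n = -2 ∨ n < -2 := by omega
      · rw [A1, B1, truncB_truncA]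
        exact A2 _
      · rw [A2, B1, truncB_truncDA, A3 _ (by omega)]
      · rw [A3 n hn, lie_zero, A3 _ (by omega)]
    · rw [B2 m hm, zero_lie, A3 _ (by omega)]
  have h11 : ∀ m n : ℤ, m < 0 → n < 0 → ∀ b b',
      ⁅τ (S.toConformal.x1 m b), τ (S.toConformal.x1 n b')⁆ = 0 := by
    intro m n hm hn b b'
    obtain rfl | hm : m = -1 ∨ m < -1 := by omega
    · obtain rfl | hn : n = -1 ∨ n < -1 := by omega
      · rw [B1, B1, truncB_truncB]
      · rw [B2 n hn, lie_zero]
    · rw [B2 m hm, zero_lie]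
  have hτ : ∀ x y, τ ⁅P.proj x, P.proj y⁆ = ⁅τ (P.proj x), τ (P.proj y)⁆ := by
    intro x y
    induction x using S.toConformal.lie_induction with
    | hadd x x' hx hx' => simp only [map_add, add_lie, hx, hx']
    | h0 m a =>
      rcases le_or_gt 0 m with hm | hm
      · rw [p0 m hm, zero_lie, map_zero, zero_lie]
      rw [n0 m hm]
      induction y using S.toConformal.lie_induction with
      | hadd y y' hy hy' => simp only [map_add, lie_add, hy, hy']
      | h0 n a' =>
        rcases le_or_gt 0 n with hn | hn
        · rw [p0 n hn, lie_zero, map_zero, lie_zero]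
        · rw [n0 n hn, h00 m n hm hn, lie_x0_x0, map_zero]
      | h1 n b =>
        rcases le_or_gt 0 n with hn | hn
        · rw [p1 n hn, lie_zero, map_zero, lie_zero]
        · rw [n1 n hn, lie_x0_x1, ← lie_skew, ← h10 n m hn hm, zero01_apply, map_neg, map_neg,
            add_comm]
    | h1 m b =>
      rcases le_or_gt 0 m with hm | hm
      · rw [p1 m hm, zero_lie, map_zero, zero_lie]
      rw [n1 m hm]
      induction y using S.toConformal.lie_induction with
      | hadd y y' hy hy' => simp only [map_add, lie_add, hy, hy']
      | h0 n a =>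
        rcases le_or_gt 0 n with hn | hn
        · rw [p0 n hn, lie_zero, map_zero, lie_zero]
        · rw [n0 n hn, lie_x1_x0, ← h10 m n hm hn, zero10_apply]
      | h1 n b' =>
        rcases le_or_gt 0 n with hn | hn
        · rw [p1 n hn, lie_zero, map_zero, lie_zero]
        · rw [n1 n hn, h11 m n hm hn, lie_x1_x1, map_add, map_smul, B2 _ (by omega),
            A3 _ (by omega), smul_zero, add_zero]
  obtain ⟨φ, he, hφ⟩ := P.exists_linearMap (K := S.toConformal.vacIdeal) (by rw [hP]; rfl) τ hτ
    ((1, 0) : A × B)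
  refine ⟨φ, he, fun a v => ?_, fun b v => ?_, fun n hn b v => ?_⟩
  · have := hφ (S.toConformal.x0 (-1) a) v
    rwa [n0 _ (by norm_num), A1] at this
  · have := hφ (S.toConformal.x1 (-1) b) v
    rwa [n1 _ (by norm_num), B1] at this
  · have := hφ (S.toConformal.x1 n b) v
    rwa [n1 _ (by omega), B2 n hn] at this

end Truncation

end VertexAlgebroid

/-! ### Stability of `E` and `I_B`, and injectivity of `A` and `B` in `V_B` -/

namespace VertexAlgebroid

open UniversalEnvelopingAlgebra OneTruncatedConformalAlgebra

variable {A B : Type*} [CommRing A] [Algebra ℂ A] [AddCommGroup B] [Module ℂ B]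
variable (S : VertexAlgebroid A B)

section Modes

variable {M : Type*} [AddCommGroup M] [Module ℂ M] [Module S.U M] [IsScalarTower ℂ S.U M]

theorem modeA_modeA (a a' : A) (m n : ℤ) (v : M) :
    S.modeA a m • S.modeA a' n • v = S.modeA a' n • S.modeA a m • v :=
  S.toConformal.m0_m0 m n a a' v

theorem modeB_modeA (b : B) (a : A) (m n : ℤ) (v : M) : S.modeB b m • S.modeA a n • v
    = S.modeA a n • S.modeB b m • v + S.modeA (S.anchor b a) (m + n) • v :=
  S.toConformal.m1_m0 m n b a v

theorem modeA_modeB (a : A) (b : B) (m n : ℤ) (v : M) : S.modeA a m • S.modeB b n • v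
    = S.modeB b n • S.modeA a m • v - S.modeA (S.anchor b a) (m + n) • v := by
  rw [modeB_modeA, add_comm n m, add_sub_cancel_right]

theorem modeB_modeB (b b' : B) (m n : ℤ) (v : M) : S.modeB b m • S.modeB b' n • v
    = S.modeB b' n • S.modeB b m • v + (S.modeB (S.br b b') (m + n) • v
      + (m : ℂ) • S.modeA (S.pair b b') (m + n - 1) • v) :=
  S.toConformal.m1_m1 m n b b' v

theorem modeA_add (a a' : A) (n : ℤ) (v : M) :
    S.modeA (a + a') n • v = S.modeA a n • v + S.modeA a' n • v := by
  rw [modeA, map_add, add_smul]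

theorem modeB_add (b b' : B) (n : ℤ) (v : M) :
    S.modeB (b + b') n • v = S.modeB b n • v + S.modeB b' n • v := by
  rw [modeB, map_add, add_smul]

theorem modeA_eq {n : ℤ} (hn : n ≠ 0) (a : A) (v : M) :
    S.modeA a (n - 1) • v = (-(n : ℂ)⁻¹) • S.modeB (S.d a) n • v := by
  rw [modeA, S.toConformal.m0_eq_m1_d hn a, smul_assoc]
  rfl

end Modes

theorem modeA_one {n : ℤ} (hn : 0 ≤ n) (a : A) : S.modeA a n • S.one = 0 :=
  S.toConformal.m0_smul_one hn a

theorem modeB_one {n : ℤ} (hn : 0 ≤ n) (b : B) : S.modeB b n • S.one = 0 :=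
  S.toConformal.m1_smul_one hn b

theorem E_le {W : Submodule ℂ S.VL} (h1 : S.modeA 1 (-1) • S.one - S.one ∈ W)
    (h2 : ∀ a a', S.modeA a (-1) • S.modeA a' (-1) • S.one - S.modeA (a * a') (-1) • S.one ∈ W)
    (h3 : ∀ a b, S.modeA a (-1) • S.modeB b (-1) • S.one - S.modeB (S.act a b) (-1) • S.one ∈ W) :
    S.E ≤ W := by
  refine Submodule.span_le.2 ?_
  rintro _ ((rfl | ⟨a, a', rfl⟩) | ⟨a, b, rfl⟩)
  exacts [h1, h2 a a', h3 a b]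

theorem one_mem_E : S.modeA 1 (-1) • S.one - S.one ∈ S.E :=
  Submodule.subset_span (Or.inl (Or.inl rfl))

theorem mul_mem_E (a a' : A) :
    S.modeA a (-1) • S.modeA a' (-1) • S.one - S.modeA (a * a') (-1) • S.one ∈ S.E :=
  Submodule.subset_span (Or.inl (Or.inr ⟨a, a', rfl⟩))

theorem act_mem_E (a : A) (b : B) :
    S.modeA a (-1) • S.modeB b (-1) • S.one - S.modeB (S.act a b) (-1) • S.one ∈ S.E :=
  Submodule.subset_span (Or.inr ⟨a, b, rfl⟩)

/-- An element of `U(𝓛)` as a `ℂ`-linear operator. -/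
noncomputable def smulLin (z : S.U) : S.VL →ₗ[ℂ] S.VL where
  toFun v := z • v
  map_add' := smul_add z
  map_smul' c v := smul_comm z c v

/-- Only `c(0)` on the generators with `a(-1)b` gives something nonzero: by `anchor_act`, minus the
generator for the product of `a` and `π(b)(c)`. -/
theorem modeA_smul_mem_E {n : ℤ} (hn : 0 ≤ n) (c : A) {w : S.VL} (hw : w ∈ S.E) :
    S.modeA c n • w ∈ S.E := by
  suffices h : S.E ≤ S.E.comap (S.smulLin (S.modeA c n)) from h hw
  refine S.E_le ?_ (fun a a' => ?_) fun a b => ?_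
  · change S.modeA c n • (_ - _ : S.VL) ∈ S.E
    rw [smul_sub, modeA_modeA, modeA_one S hn, smul_zero, sub_zero]
    exact zero_mem _
  · change S.modeA c n • (_ - _ : S.VL) ∈ S.E
    rw [smul_sub, modeA_modeA, modeA_modeA S c a', modeA_modeA S c (a * a'), modeA_one S hn]
    simp
  · change S.modeA c n • (_ - _ : S.VL) ∈ S.E
    rw [smul_sub, modeA_modeA, modeA_modeB, modeA_modeB, modeA_one S hn, smul_zero, smul_zero,
      zero_sub, zero_sub, smul_neg, S.anchor_act, Derivation.smul_apply, smul_eq_mul]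
    rcases hn.eq_or_lt with rfl | hn
    · rw [zero_add, ← neg_sub']
      exact neg_mem (S.mul_mem_E _ _)
    · rw [modeA_one S (by omega), modeA_one S (by omega)]
      simp

/-- `c(0)` acts on generators by the Leibniz rules for `π(c)` and for `[c, a*b]`; `c(1)` uses the
axiom on `⟨a*u, v⟩`; higher modes vanish for degree reasons. -/
theorem modeB_smul_mem_E {n : ℤ} (hn : 0 ≤ n) (c : B) {w : S.VL} (hw : w ∈ S.E) :
    S.modeB c n • w ∈ S.E := by
  suffices h : S.E ≤ S.E.comap (S.smulLin (S.modeB c n)) from h hw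
  refine S.E_le ?_ (fun a a' => ?_) fun a b => ?_
  · change S.modeB c n • (_ - _ : S.VL) ∈ S.E
    rw [smul_sub, modeB_modeA, modeB_one S hn]
    simp
  · change S.modeB c n • (_ - _ : S.VL) ∈ S.E
    rw [smul_sub, modeB_modeA, modeB_modeA, modeB_modeA, modeB_one S hn, smul_zero, smul_zero,
      zero_add, zero_add, Derivation.leibniz, smul_eq_mul, smul_eq_mul]
    rcases hn.eq_or_lt with rfl | hn
    · rw [zero_add, modeA_add, add_sub_add_comm, mul_comm a']
      exact add_mem (S.mul_mem_E _ _) (S.mul_mem_E _ _)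
    · have hn' : 0 ≤ n + -1 := by omega
      rw [S.modeA_modeA _ a', modeA_one S hn', modeA_one S hn', modeA_one S hn']
      simp
  · change S.modeB c n • (_ - _ : S.VL) ∈ S.E
    rw [smul_sub, modeB_modeA, S.modeB_modeB c b, S.modeB_modeB c, modeB_one S hn, smul_zero,
      smul_zero, zero_add, zero_add, S.br_act]
    rcases hn.eq_or_lt with rfl | hn
    · simp only [zero_add, Int.cast_zero, zero_smul, add_zero]
      rw [modeB_add, add_comm (S.modeB (S.act (S.anchor c a) b) _ • _), add_sub_add_comm]
      exact add_mem (S.act_mem_E _ _) (S.act_mem_E _ _)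
    · have hn' : 0 ≤ n + -1 := by omega
      rw [modeB_one S hn', modeB_one S hn', modeA_modeB, modeA_one S hn', smul_zero, zero_sub,
        zero_add, zero_add]
      -- The correction `π(b)(π(c)(a))` in `pair_act` cancels the term from `(π(c)(a))(0) b(-1)𝟏`.
      rcases eq_or_ne n 1 with rfl | h
      · rw [S.pair_symm c (S.act a b), S.pair_act, S.pair_symm b c]
        simp only [Int.cast_one, one_smul, modeA, map_sub, sub_smul, add_neg_cancel, zero_sub]
        convert S.mul_mem_E a (S.pair c b) using 1
        norm_num
        abel
      · rw [modeA_one S (by omega), modeA_one S (by omega), modeA_one S (by omega)]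
        simp

theorem toVB_eq_zero_iff {𝒱 : VertexAlgebra S.VL} {v : S.VL} :
    S.toVB 𝒱 v = 0 ↔ v ∈ S.idealB 𝒱 :=
  Submodule.Quotient.mk_eq_zero (S.idealB 𝒱)

theorem toVB_surjective (𝒱 : VertexAlgebra S.VL) : Function.Surjective (S.toVB 𝒱) :=
  Submodule.mkQ_surjective (S.idealB 𝒱)

theorem ker_toVB (𝒱 : VertexAlgebra S.VL) :
    LinearMap.ker (S.toVB 𝒱) = (S.idealB 𝒱).restrictScalars ℂ :=
  Submodule.ext fun _ => S.toVB_eq_zero_iff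

theorem toVB_smul (𝒱 : VertexAlgebra S.VL) (z : S.U) (v : S.VL) :
    S.toVB 𝒱 (z • v) = z • S.toVB 𝒱 v := rfl

section Canonical

variable {S} {𝒱 : VertexAlgebra S.VL} (h : S.toConformal.IsCanonical 𝒱)

/-- The space `ℂ[𝒟]E`. -/
noncomputable def derivedE (S : VertexAlgebroid A B) (𝒱 : VertexAlgebra S.VL) :
    Submodule ℂ S.VL :=
  Submodule.span ℂ {v | ∃ k : ℕ, ∃ x ∈ S.E, v = 𝒱.D^[k] x}

theorem iterate_mem_derivedE (k : ℕ) {x : S.VL} (hx : x ∈ S.E) : 𝒱.D^[k] x ∈ S.derivedE 𝒱 :=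
  Submodule.subset_span ⟨k, x, hx, rfl⟩

theorem translation_mem_derivedE {v : S.VL} (hv : v ∈ S.derivedE 𝒱) :
    𝒱.translation v ∈ S.derivedE 𝒱 := by
  suffices h : S.derivedE 𝒱 ≤ (S.derivedE 𝒱).comap 𝒱.translation from h hv
  refine Submodule.span_le.2 ?_
  rintro _ ⟨k, x, hx, rfl⟩
  change 𝒱.D _ ∈ S.derivedE 𝒱
  rw [← Function.iterate_succ_apply' 𝒱.D]
  exact iterate_mem_derivedE _ hx

include h

/-- `[𝒟, a(n)] = -n a(n-1)` stays within nonnegative modes, the coefficient vanishing at `n = 0`. So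
stability passes from `E` to `ℂ[𝒟]E`. -/
theorem modeA_smul_mem_derivedE {n : ℤ} (hn : 0 ≤ n) (a : A) {v : S.VL}
    (hv : v ∈ S.derivedE 𝒱) : S.modeA a n • v ∈ S.derivedE 𝒱 := by
  suffices hle : S.derivedE 𝒱 ≤ (S.derivedE 𝒱).comap (S.smulLin (S.modeA a n)) from hle hv
  refine Submodule.span_le.2 ?_
  rintro _ ⟨k, x, hx, rfl⟩
  change S.modeA a n • _ ∈ S.derivedE 𝒱
  induction k generalizing n with
  | zero => exact iterate_mem_derivedE 0 (S.modeA_smul_mem_E hn a hx)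
  | succ k ih =>
    rw [Function.iterate_succ_apply', ← VertexAlgebra.translation_apply]
    have := h.translation_spec.2.1 n a (𝒱.D^[k] x)
    rw [eq_sub_iff_add_eq] at this
    rw [modeA, ← this]
    refine add_mem (translation_mem_derivedE (ih hn)) ?_
    rcases hn.eq_or_lt with rfl | hn
    · simp
    · exact Submodule.smul_mem _ _ (ih (by omega))

theorem modeB_smul_mem_derivedE {n : ℤ} (hn : 0 ≤ n) (a : B) {v : S.VL}
    (hv : v ∈ S.derivedE 𝒱) : S.modeB a n • v ∈ S.derivedE 𝒱 := by
  suffices hle : S.derivedE 𝒱 ≤ (S.derivedE 𝒱).comap (S.smulLin (S.modeB a n)) from hle hv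
  refine Submodule.span_le.2 ?_
  rintro _ ⟨k, x, hx, rfl⟩
  change S.modeB a n • _ ∈ S.derivedE 𝒱
  induction k generalizing n with
  | zero => exact iterate_mem_derivedE 0 (S.modeB_smul_mem_E hn a hx)
  | succ k ih =>
    rw [Function.iterate_succ_apply', ← VertexAlgebra.translation_apply]
    have := h.translation_spec.2.2.1 n a (𝒱.D^[k] x)
    rw [eq_sub_iff_add_eq] at this
    rw [modeB, ← this]
    refine add_mem (translation_mem_derivedE (ih hn)) ?_
    rcases hn.eq_or_lt with rfl | hn
    · simp
    · exact Submodule.smul_mem _ _ (ih (by omega))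

/-- The truncation intertwines `𝒟` with `(a, b) ↦ (0, ∂a)`; the step for `a(-1)` is the Leibniz rule
for `∂`. -/
theorem translation_truncation {φ : S.VL →ₗ[ℂ] A × B} (h1 : φ S.one = (1, 0))
    (hA : ∀ a v, φ (S.modeA a (-1) • v) = (a * (φ v).1, S.act a (φ v).2))
    (hB : ∀ b v, φ (S.modeB b (-1) • v) = (0, S.act (φ v).1 b + S.d (S.anchor b (φ v).1)))
    (hB' : ∀ n : ℤ, n < -1 → ∀ b v, φ (S.modeB b n • v) = 0) (v : S.VL) :
    φ (𝒱.translation v) = (0, S.d (φ v).1) := by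
  obtain ⟨T1, TA, TB, -⟩ := h.translation_spec
  suffices hv : v ∈ LinearMap.eqLocus (φ ∘ₗ 𝒱.translation)
      (LinearMap.inr ℂ A B ∘ₗ S.d ∘ₗ LinearMap.fst ℂ A B ∘ₗ φ) from hv
  refine S.toConformal.VL_creation_induction ?_ (fun a w hw => ?_) (fun n hn b w hw => ?_) v
  · change φ (𝒱.translation S.one) = (0, S.d (φ S.one).1)
    rw [T1, h1, map_zero, S.d_one]
    rfl
  · replace hw : φ (𝒱.translation w) = (0, S.d (φ w).1) := hw
    change φ (𝒱.translation (S.modeA a (-1) • w)) = (0, S.d (φ (S.modeA a (-1) • w)).1)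
    have h2 := S.modeA_eq (n := -1) (by norm_num) a w
    rw [TA, map_sub, φ.map_smul, hA, hA, hw, ← modeA, h2, φ.map_smul, hB, S.anchor_d, S.d_mul]
    simp
  · replace hw : φ (𝒱.translation w) = (0, S.d (φ w).1) := hw
    change φ (𝒱.translation (S.modeB b n • w)) = (0, S.d (φ (S.modeB b n • w)).1)
    rw [TB, map_sub, φ.map_smul, hB' (n - 1) (by omega)]
    rcases eq_or_ne n (-1) with rfl | hn'
    · rw [hB, hB, hw]
      simp
    · rw [hB' n (by omega), hB' n (by omega), smul_zero, sub_zero, Prod.fst_zero, map_zero,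
        Prod.mk_zero_zero]

/-- The truncation of `V_𝓛` factors through `V_B`. -/
theorem exists_truncation_of_idealB : ∃ φ : S.VL →ₗ[ℂ] A × B,
    (∀ v ∈ S.idealB 𝒱, φ v = 0) ∧ (∀ a, φ (S.modeA a (-1) • S.one) = (a, 0)) ∧
      ∀ b, φ (S.modeB b (-1) • S.one) = (0, b) := by
  obtain ⟨φ, h1, hA, hB, hB'⟩ := S.exists_truncation
  have hT := translation_truncation h h1 hA hB hB'
  have hA1 : ∀ a, φ (S.modeA a (-1) • S.one) = (a, 0) := fun a => by simp [hA, h1]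
  have hB1 : ∀ b, φ (S.modeB b (-1) • S.one) = (0, b) := fun b => by
    simp [hB, h1, S.one_act]
  refine ⟨φ, fun v hv => ?_, hA1, hB1⟩
  have hE : S.E ≤ LinearMap.ker φ := by
    refine S.E_le ?_ (fun a a' => ?_) fun a b => ?_
    · rw [LinearMap.mem_ker, map_sub, hA1, h1, sub_self]
    · rw [LinearMap.mem_ker, map_sub, hA, hA1, hA1]
      simp
    · rw [LinearMap.mem_ker, map_sub, hA, hB1, hB1]
      simp
  have hDE : S.derivedE 𝒱 ≤ LinearMap.ker φ := by
    refine Submodule.span_le.2 ?_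
    rintro _ ⟨k, x, hx, rfl⟩
    induction k with
    | zero => exact hE hx
    | succ k ih =>
      have ih' : φ (𝒱.D^[k] x) = 0 := ih
      rw [Function.iterate_succ_apply']
      change φ (𝒱.translation _) = 0
      rw [hT, ih']
      simp
  -- The formulas for `φ` cover creation operators only. They suffice because `ℂ[𝒟]E` is stable
  -- under `𝓛^{≥0}`.
  have hmem : ∀ z : S.U, ∀ w ∈ S.derivedE 𝒱, φ (z • w) = 0 := fun z w hw =>
    S.toConformal.smul_mem_of_creation hDE (fun n hn a w hw => modeA_smul_mem_derivedE h hn a hw)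
      (fun n hn a w hw => modeB_smul_mem_derivedE h hn a hw)
      (fun a w hw => by
        have hw' : φ w = 0 := hw
        change φ (S.modeA a (-1) • w) = 0
        rw [hA, hw']
        simp)
      (fun n hn b w hw => by
        have hw' : φ w = 0 := hw
        change φ (S.modeB b n • w) = 0
        rcases eq_or_ne n (-1) with rfl | hn'
        · rw [hB, hw']
          simp
        · exact hB' n (by omega) b w) z hw
  -- `φ` is not `U(𝓛)`-linear, so the induction over the span carries every multiple of `v`.
  have hv' : ∀ z : S.U, φ (z • v) = 0 := by
    rw [idealB] at hv
    induction hv using Submodule.span_induction with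
    | mem v hv => exact fun z => hmem z v (Submodule.subset_span hv)
    | zero => simp
    | add v w _ _ hv hw => exact fun z => by rw [smul_add, map_add, hv, hw, add_zero]
    | smul y v _ hv => exact fun z => by rw [smul_smul, hv]
  simpa using hv' 1

/-- Since `[𝒟, 𝓛] ⊆ 𝓛`, the vectors of `I_B` that `𝒟` keeps in `I_B` form an `𝓛`-submodule
containing `ℂ[𝒟]E`. -/
theorem translation_mem_idealB {v : S.VL} (hv : v ∈ S.idealB 𝒱) :
    𝒱.translation v ∈ S.idealB 𝒱 := by
  obtain ⟨-, TA, TB, -⟩ := h.translation_spec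
  set W : Submodule ℂ S.VL := (S.idealB 𝒱).restrictScalars ℂ ⊓
    ((S.idealB 𝒱).restrictScalars ℂ).comap 𝒱.translation with hW
  have hWι : ∀ x : S.Lie, ∀ w ∈ W, ι ℂ x • w ∈ W := by
    intro x w hw
    refine S.toConformal.ι_smul_mem (fun n a => ?_) (fun n b => ?_) x
    · refine ⟨(S.idealB 𝒱).smul_mem _ hw.1, ?_⟩
      change 𝒱.translation _ ∈ S.idealB 𝒱
      rw [TA]
      exact sub_mem ((S.idealB 𝒱).smul_mem _ hw.2)
        (((S.idealB 𝒱).restrictScalars ℂ).smul_mem _ ((S.idealB 𝒱).smul_mem _ hw.1))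
    · refine ⟨(S.idealB 𝒱).smul_mem _ hw.1, ?_⟩
      change 𝒱.translation _ ∈ S.idealB 𝒱
      rw [TB]
      exact sub_mem ((S.idealB 𝒱).smul_mem _ hw.2)
        (((S.idealB 𝒱).restrictScalars ℂ).smul_mem _ ((S.idealB 𝒱).smul_mem _ hw.1))
  suffices hvW : v ∈ W from hvW.2
  rw [idealB] at hv
  induction hv using Submodule.span_induction with
  | mem v hv =>
    obtain ⟨k, x, hx, rfl⟩ := hv
    refine ⟨Submodule.subset_span ⟨k, x, hx, rfl⟩, Submodule.subset_span ⟨k + 1, x, hx, ?_⟩⟩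
    rw [Function.iterate_succ_apply']
    rfl
  | zero => exact zero_mem _
  | add v w _ _ hv hw => exact add_mem hv hw
  | smul y v _ hv => exact smul_mem_of_ι_smul_mem hWι y hv

theorem exists_quotient : ∃ 𝒲 : VertexAlgebra (S.VB 𝒱), 𝒱.IsHom 𝒲 (S.toVB 𝒱) := by
  refine 𝒱.exists_of_surjective (S.toVB 𝒱) (S.toVB_surjective 𝒱) ?_
  rw [ker_toVB]
  exact h.isIdeal_of_stable (S.idealB 𝒱) fun _ => translation_mem_idealB h

theorem inA_injective : Function.Injective (S.inA 𝒱) := by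
  obtain ⟨φ, hφ, hA, -⟩ := exists_truncation_of_idealB h
  refine (injective_iff_map_eq_zero _).2 fun a ha => ?_
  have := hφ _ ((Submodule.Quotient.mk_eq_zero (S.idealB 𝒱)).1 ha)
  rw [hA] at this
  exact congrArg Prod.fst this

theorem inB_injective : Function.Injective (S.inB 𝒱) := by
  obtain ⟨φ, hφ, -, hB⟩ := exists_truncation_of_idealB h
  refine (injective_iff_map_eq_zero _).2 fun a ha => ?_
  have := hφ _ ((Submodule.Quotient.mk_eq_zero (S.idealB 𝒱)).1 ha)
  rw [hB] at this
  exact congrArg Prod.snd this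

end Canonical

end VertexAlgebroid

/-! ### The vertex algebra `V_B` and its grading -/

namespace VertexAlgebra

variable {V : Type*} [AddCommGroup V] [Module ℂ V] (𝒱 : VertexAlgebra V)

/-- The leading term of the iterate formula for `u₋₁ v`. -/
theorem mode_mode_sub_mem {P : Submodule ℂ V} {u v w : V} {n : ℤ}
    (h1 : ∀ i : ℕ, 𝒱.mode u (-2 - i) (𝒱.mode v (n + 1 + i) w) ∈ P)
    (h2 : ∀ i : ℕ, 𝒱.mode v (n - 1 - i) (𝒱.mode u i w) ∈ P) :
    𝒱.mode (𝒱.mode u (-1) v) n w - 𝒱.mode u (-1) (𝒱.mode v n w) ∈ P := by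
  have hfin := 𝒱.finite_support_iterate u v w (-1) 0 n
  simp only [add_zero, zero_add] at hfin
  obtain ⟨N, hN⟩ := hfin.toFinset.exists_nat_subset_range
  rw [mode_mode, finsum_eq_sum_of_support_subset (s := Finset.range (N + 1)), Finset.sum_range_succ',
    add_sub_assoc]
  · refine P.add_mem (P.sum_mem fun i _ => zsmul_mem (P.sub_mem ?_ (zsmul_mem ?_ _)) _) ?_
    · rw [show (-1 : ℤ) - ((i + 1 : ℕ) : ℤ) = -2 - i by push_cast; ring,
        show n + ((i + 1 : ℕ) : ℤ) = n + 1 + i by push_cast; ring]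
      exact h1 i
    · rw [show (-1 : ℤ) + n - ((i + 1 : ℕ) : ℤ) = n - 1 - (i + 1 : ℕ) by push_cast; ring]
      exact h2 (i + 1)
    · have h0 := h2 0
      rw [Nat.cast_zero, sub_zero, show n - 1 = -1 + n by ring] at h0
      simpa using h0
  · intro i hi
    have := hN (hfin.mem_toFinset.2 hi)
    rw [Finset.mem_range] at this
    exact Finset.mem_coe.2 (Finset.mem_range.2 (by omega))

end VertexAlgebra

/-- By the modular law nothing in `E i` lies outside `F i` once the other `E j` are split off. This
turns a spanning statement into an exact description of graded pieces. -/
theorem eq_of_le_of_iSup_eq_top {ι α : Type*} [CompleteLattice α] [IsModularLattice α]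
    {F E : ι → α} (hFE : ∀ i, F i ≤ E i) (hE : iSupIndep E) (hF : ⨆ i, F i = ⊤) (i : ι) :
    F i = E i := by
  refine le_antisymm (hFE i) ?_
  have h1 : F i ⊔ (⨆ (j) (_ : j ≠ i), E j) = ⊤ := by
    refine top_le_iff.1 (hF ▸ iSup_le fun j => ?_)
    rcases eq_or_ne j i with rfl | h
    · exact le_sup_left
    · exact le_sup_of_le_right (le_iSup₂_of_le j h (hFE j))
  calc E i ≤ (F i ⊔ (⨆ (j) (_ : j ≠ i), E j)) ⊓ E i := by rw [h1, top_inf_eq]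
    _ = F i ⊔ (⨆ (j) (_ : j ≠ i), E j) ⊓ E i := sup_inf_assoc_of_le _ (hFE i)
    _ = F i := by rw [(hE i).symm.eq_bot, sup_bot_eq]

namespace OneTruncatedConformalAlgebra

variable {C₀ C₁ : Type*} [AddCommGroup C₀] [Module ℂ C₀] [AddCommGroup C₁] [Module ℂ C₁]
variable {C : OneTruncatedConformalAlgebra C₀ C₁}

theorem m0_smul_mem_gradeVL (a : C₀) (m : ℤ) {n : ℤ} {v : C.VL} (hv : v ∈ C.gradeVL n) :
    C.m0 m a • v ∈ C.gradeVL (n - m - 1) := by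
  rw [gradeVL] at hv
  induction hv using Submodule.span_induction with
  | mem v hv => exact Submodule.subset_span (hv.zero_mode a m)
  | zero => rw [smul_zero]; exact zero_mem _
  | add v w _ _ hv hw => rw [smul_add]; exact add_mem hv hw
  | smul c v _ hv => rw [smul_comm]; exact Submodule.smul_mem _ c hv

theorem m1_smul_mem_gradeVL (u : C₁) (m : ℤ) {n : ℤ} {v : C.VL} (hv : v ∈ C.gradeVL n) :
    C.m1 m u • v ∈ C.gradeVL (n - m) := by
  rw [gradeVL] at hv
  induction hv using Submodule.span_induction with
  | mem v hv => exact Submodule.subset_span (hv.one_mode u m)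
  | zero => rw [smul_zero]; exact zero_mem _
  | add v w _ _ hv hw => rw [smul_add]; exact add_mem hv hw
  | smul c v _ hv => rw [smul_comm]; exact Submodule.smul_mem _ c hv

/-- Every term of the iterate formula has the same degree, so the claim follows by induction on the
monomial `u`. -/
theorem IsCanonical.mode_mem_gradeVL {𝒱 : VertexAlgebra C.VL} (h : C.IsCanonical 𝒱) {k n : ℤ}
    {u v : C.VL} (hu : u ∈ C.gradeVL k) (hv : v ∈ C.gradeVL n) (m : ℤ) :
    𝒱.mode u m v ∈ C.gradeVL (k + n - m - 1) := by
  have hmon : ∀ k u, C.IsMonomial k u → ∀ m n : ℤ, ∀ v ∈ C.gradeVL n,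
      𝒱.mode u m v ∈ C.gradeVL (k + n - m - 1) := by
    intro k u hu
    have hvac : ∀ u', 𝒱.mode u' (-1) C.one = u' := fun u' => by
      rw [← h.vac_eq]
      exact 𝒱.creation_limit u'
    induction hu with
    | one =>
      intro m n v hv
      rw [← h.vac_eq, VertexAlgebra.mode, 𝒱.vacuum]
      split_ifs with hm
      · subst hm
        simpa using hv
      · exact zero_mem _
    | zero_mode a l n' u _ ih =>
      intro m n v hv
      rw [← h.mode_zero]
      refine 𝒱.mode_mode_mem (fun i => ?_) fun i => ?_
      · rw [h.mode_zero]
        convert m0_smul_mem_gradeVL a (l - i) (ih (m + i) n v hv) using 1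
        congr 1
        ring
      · rw [h.mode_zero]
        convert ih (l + m - i) _ _ (m0_smul_mem_gradeVL a i hv) using 1
        congr 1
        ring
    | one_mode a l n' u _ ih =>
      intro m n v hv
      rw [← h.mode_one]
      refine 𝒱.mode_mode_mem (fun i => ?_) fun i => ?_
      · rw [h.mode_one]
        convert m1_smul_mem_gradeVL a (l - i) (ih (m + i) n v hv) using 1
        congr 1
        ring
      · rw [h.mode_one]
        convert ih (l + m - i) _ _ (m1_smul_mem_gradeVL a i hv) using 1
        congr 1
        ring
  rw [gradeVL] at hu
  induction hu using Submodule.span_induction with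
  | mem u hu => exact hmon _ _ hu _ _ _ hv
  | zero => rw [← VertexAlgebra.modeLin_apply, map_zero]; exact zero_mem _
  | add u u' _ _ hu hu' =>
    rw [← VertexAlgebra.modeLin_apply, map_add]
    exact add_mem hu hu'
  | smul c u _ hu =>
    rw [← VertexAlgebra.modeLin_apply, map_smul]
    exact Submodule.smul_mem _ c hu

/-- The degree operator of `V_𝓛`. -/
theorem exists_degree (C : OneTruncatedConformalAlgebra C₀ C₁) : ∃ δ : Module.End ℂ C.VL,
    δ C.one = 0 ∧
    (∀ n a v, δ (C.m0 n a • v) = C.m0 n a • δ v + (-(n : ℂ) - 1) • C.m0 n a • v) ∧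
    ∀ n u v, δ (C.m1 n u • v) = C.m1 n u • δ v + (-(n : ℂ)) • C.m1 n u • v := by
  obtain ⟨δ, h0, h1, hδ⟩ := C.exists_lieDerivation_degree
  have hN : ∀ x ∈ C.nonnegPart, δ x ∈ C.nonnegPart := fun x hx => by
    refine C.nonnegPart_le (W := C.nonnegPart.comap δ) (fun n hn a => ?_) (fun n hn a => ?_) hx
    · rw [Submodule.mem_comap, h0]
      exact Submodule.smul_mem _ _ (C.x0_mem_nonnegPart hn a)
    · rw [Submodule.mem_comap, h1]
      exact Submodule.smul_mem _ _ (C.x1_mem_nonnegPart hn a)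
  obtain ⟨D, hD, hDx⟩ := UniversalEnvelopingAlgebra.exists_derivation (K := C.vacIdeal) rfl δ hδ hN
  refine ⟨D, hD, fun n a v => ?_, fun n a v => ?_⟩
  · rw [m0_eq, hDx, h0, map_smul, smul_assoc, add_comm]
  · rw [m1_eq, hDx, h1, map_smul, smul_assoc, add_comm]

end OneTruncatedConformalAlgebra

namespace VertexAlgebroid

open UniversalEnvelopingAlgebra OneTruncatedConformalAlgebra

variable {A B : Type*} [CommRing A] [Algebra ℂ A] [AddCommGroup B] [Module ℂ B]
variable {S : VertexAlgebroid A B} {𝒱 : VertexAlgebra S.VL}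

theorem inA_apply (a : A) : S.inA 𝒱 a = S.modeA a (-1) • S.vacB 𝒱 := rfl

theorem inB_apply (b : B) : S.inB 𝒱 b = S.modeB b (-1) • S.vacB 𝒱 := rfl

theorem modeA_vacB {n : ℤ} (hn : 0 ≤ n) (a : A) : S.modeA a n • S.vacB 𝒱 = 0 := by
  rw [vacB, ← toVB_smul, modeA_one S hn, map_zero]

theorem modeB_vacB {n : ℤ} (hn : 0 ≤ n) (b : B) : S.modeB b n • S.vacB 𝒱 = 0 := by
  rw [vacB, ← toVB_smul, modeB_one S hn, map_zero]

theorem toVB_eq_zero_of_mem_E {v : S.VL} (hv : v ∈ S.E) : S.toVB 𝒱 v = 0 :=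
  S.toVB_eq_zero_iff.2 (Submodule.subset_span ⟨0, v, hv, rfl⟩)

theorem inA_one : S.inA 𝒱 1 = S.vacB 𝒱 :=
  sub_eq_zero.1 (toVB_eq_zero_of_mem_E S.one_mem_E)

theorem modeA_inA (a a' : A) : S.modeA a (-1) • S.inA 𝒱 a' = S.inA 𝒱 (a * a') :=
  sub_eq_zero.1 (toVB_eq_zero_of_mem_E (S.mul_mem_E a a'))

theorem modeA_inB (a : A) (b : B) : S.modeA a (-1) • S.inB 𝒱 b = S.inB 𝒱 (S.act a b) :=
  sub_eq_zero.1 (toVB_eq_zero_of_mem_E (S.act_mem_E a b))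

theorem modeB_zero_inA (b : B) (a : A) : S.modeB b 0 • S.inA 𝒱 a = S.inA 𝒱 (S.anchor b a) := by
  rw [inA_apply, modeB_modeA, modeB_vacB le_rfl, smul_zero, zero_add, zero_add, inA_apply]

theorem modeB_zero_inB (b b' : B) : S.modeB b 0 • S.inB 𝒱 b' = S.inB 𝒱 (S.br b b') := by
  rw [inB_apply, modeB_modeB, modeB_vacB le_rfl, smul_zero, zero_add, zero_add, inB_apply,
    Int.cast_zero, zero_smul, add_zero]

theorem modeB_one_inB (b b' : B) : S.modeB b 1 • S.inB 𝒱 b' = S.inA 𝒱 (S.pair b b') := by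
  rw [inB_apply, modeB_modeB, modeB_vacB zero_le_one, smul_zero, zero_add,
    modeB_vacB (by norm_num), Int.cast_one, one_smul, zero_add, inA_apply]
  norm_num

theorem modeA_neg_two (a : A) : S.modeA a (-2) • S.vacB 𝒱 = S.inB 𝒱 (S.d a) := by
  have := S.modeA_eq (n := -1) (by norm_num) a (S.vacB 𝒱)
  norm_num at this
  rw [inB_apply, ← this]

theorem VB_creation_induction {N : Submodule ℂ (S.VB 𝒱)} (he : S.vacB 𝒱 ∈ N)
    (hN0 : ∀ a, ∀ w ∈ N, S.modeA a (-1) • w ∈ N)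
    (hN1 : ∀ n : ℤ, n < 0 → ∀ b, ∀ w ∈ N, S.modeB b n • w ∈ N) : N = ⊤ := by
  refine Submodule.eq_top_iff'.2 fun v => ?_
  obtain ⟨v, rfl⟩ := S.toVB_surjective 𝒱 v
  have := S.toConformal.VL_creation_induction (N := N.comap (S.toVB 𝒱)) he
    (fun a w hw => hN0 a _ hw) (fun n hn u w hw => hN1 n hn u _ hw) v
  exact this

theorem modeA_smul_mem_gradeVB (a : A) (m : ℤ) {n : ℤ} {v : S.VB 𝒱} (hv : v ∈ S.gradeVB 𝒱 n) :
    S.modeA a m • v ∈ S.gradeVB 𝒱 (n - m - 1) := by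
  obtain ⟨v, hv, rfl⟩ := hv
  exact ⟨_, m0_smul_mem_gradeVL a m hv, rfl⟩

theorem modeB_smul_mem_gradeVB (b : B) (m : ℤ) {n : ℤ} {v : S.VB 𝒱} (hv : v ∈ S.gradeVB 𝒱 n) :
    S.modeB b m • v ∈ S.gradeVB 𝒱 (n - m) := by
  obtain ⟨v, hv, rfl⟩ := hv
  exact ⟨_, m1_smul_mem_gradeVL b m hv, rfl⟩

theorem vacB_mem_gradeVB : S.vacB 𝒱 ∈ S.gradeVB 𝒱 0 :=
  ⟨S.one, Submodule.subset_span IsMonomial.one, rfl⟩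

theorem inA_mem_gradeVB (a : A) : S.inA 𝒱 a ∈ S.gradeVB 𝒱 0 := by
  simpa [inA_apply] using modeA_smul_mem_gradeVB a (-1) (vacB_mem_gradeVB (𝒱 := 𝒱))

section Degree

variable (h : S.toConformal.IsCanonical 𝒱)
include h

/-- The degree operator of `V_B`. -/
theorem exists_degree_VB : ∃ δ : Module.End ℂ (S.VB 𝒱), δ (S.vacB 𝒱) = 0 ∧
    (∀ n a v, δ (S.modeA a n • v) = S.modeA a n • δ v + (-(n : ℂ) - 1) • S.modeA a n • v) ∧
    ∀ n b v, δ (S.modeB b n • v) = S.modeB b n • δ v + (-(n : ℂ)) • S.modeB b n • v := by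
  obtain ⟨δ, δ1, δA, δB⟩ := S.toConformal.exists_degree
  obtain ⟨T1, TA, TB, -⟩ := h.translation_spec
  -- `𝒟` raises the degree by one.
  have hcomm : ∀ v, δ (𝒱.translation v) = 𝒱.translation (δ v) + 𝒱.translation v := by
    intro v
    suffices hv : v ∈ LinearMap.eqLocus (δ ∘ₗ 𝒱.translation)
        (𝒱.translation ∘ₗ δ + 𝒱.translation) from hv
    have hW : LinearMap.eqLocus (δ ∘ₗ 𝒱.translation) (𝒱.translation ∘ₗ δ + 𝒱.translation) = ⊤ := by
      refine S.toConformal.VL_induction ?_ (fun n a w hw => ?_) fun n b w hw => ?_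
      · change δ (𝒱.translation S.one) = 𝒱.translation (δ S.one) + 𝒱.translation S.one
        rw [T1, δ1, map_zero, map_zero, add_zero]
      · replace hw : δ (𝒱.translation w) = 𝒱.translation (δ w) + 𝒱.translation w := hw
        change δ (𝒱.translation (S.modeA a n • w))
          = 𝒱.translation (δ (S.modeA a n • w)) + 𝒱.translation (S.modeA a n • w)
        rw [TA, map_sub, δ.map_smul, δA, δA, δA, map_add, 𝒱.translation.map_smul, TA, TA, hw,
          smul_add]
        push_cast
        generalize S.toConformal.m0 n a • 𝒱.translation (δ w) = x₁
        generalize S.toConformal.m0 n a • 𝒱.translation w = x₂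
        generalize S.toConformal.m0 (n - 1) a • δ w = x₃
        generalize S.toConformal.m0 (n - 1) a • w = x₄
        module
      · replace hw : δ (𝒱.translation w) = 𝒱.translation (δ w) + 𝒱.translation w := hw
        change δ (𝒱.translation (S.modeB b n • w))
          = 𝒱.translation (δ (S.modeB b n • w)) + 𝒱.translation (S.modeB b n • w)
        rw [TB, map_sub, δ.map_smul, δB, δB, δB, map_add, 𝒱.translation.map_smul, TB, TB, hw,
          smul_add]
        push_cast
        generalize S.toConformal.m1 n b • 𝒱.translation (δ w) = x₁
        generalize S.toConformal.m1 n b • 𝒱.translation w = x₂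
        generalize S.toConformal.m1 (n - 1) b • δ w = x₃
        generalize S.toConformal.m1 (n - 1) b • w = x₄
        module
    rw [hW]
    exact Submodule.mem_top
  have hA1 : ∀ a, δ (S.modeA a (-1) • S.one) = 0 := fun a => by
    rw [δA, δ1]
    simp
  -- The generators of `E` are homogeneous of degree 0 or 1.
  have hE : ∀ x ∈ S.E, δ x ∈ S.E := by
    suffices hle : S.E ≤ S.E.comap δ from fun x hx => hle hx
    refine S.E_le ?_ (fun a a' => ?_) fun a b => ?_
    · rw [Submodule.mem_comap, map_sub, hA1, δ1, sub_zero]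
      exact zero_mem _
    · rw [Submodule.mem_comap, map_sub, hA1, δA, hA1]
      simp
    · rw [Submodule.mem_comap, map_sub, δA, δB, δB, δ1]
      convert S.act_mem_E a b using 1
      simp
  have hDE : ∀ k : ℕ, ∀ x ∈ S.E, δ (𝒱.D^[k] x) ∈ S.derivedE 𝒱 := by
    intro k x hx
    induction k with
    | zero => exact iterate_mem_derivedE 0 (hE x hx)
    | succ k ih =>
      rw [Function.iterate_succ_apply', ← VertexAlgebra.translation_apply, hcomm]
      exact add_mem (translation_mem_derivedE ih)
        (translation_mem_derivedE (iterate_mem_derivedE k hx))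
  have hle : S.derivedE 𝒱 ≤ (S.idealB 𝒱).restrictScalars ℂ :=
    Submodule.span_le.2 fun _ hv => Submodule.subset_span hv
  have hideal : ∀ v ∈ S.idealB 𝒱, δ v ∈ S.idealB 𝒱 := by
    set W : Submodule ℂ S.VL := (S.idealB 𝒱).restrictScalars ℂ ⊓
      ((S.idealB 𝒱).restrictScalars ℂ).comap δ with hW
    have hWι : ∀ x : S.Lie, ∀ w ∈ W, ι ℂ x • w ∈ W := by
      intro x w hw
      refine S.toConformal.ι_smul_mem (fun n a => ?_) (fun n b => ?_) x
      · refine ⟨(S.idealB 𝒱).smul_mem _ hw.1, ?_⟩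
        change δ _ ∈ S.idealB 𝒱
        rw [δA]
        exact add_mem ((S.idealB 𝒱).smul_mem _ hw.2)
          (((S.idealB 𝒱).restrictScalars ℂ).smul_mem _ ((S.idealB 𝒱).smul_mem _ hw.1))
      · refine ⟨(S.idealB 𝒱).smul_mem _ hw.1, ?_⟩
        change δ _ ∈ S.idealB 𝒱
        rw [δB]
        exact add_mem ((S.idealB 𝒱).smul_mem _ hw.2)
          (((S.idealB 𝒱).restrictScalars ℂ).smul_mem _ ((S.idealB 𝒱).smul_mem _ hw.1))
    intro v hv
    suffices hvW : v ∈ W from hvW.2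
    rw [idealB] at hv
    induction hv using Submodule.span_induction with
    | mem v hv =>
      obtain ⟨k, x, hx, rfl⟩ := hv
      exact ⟨Submodule.subset_span ⟨k, x, hx, rfl⟩, hle (hDE k x hx)⟩
    | zero => exact zero_mem _
    | add v w _ _ hv hw => exact add_mem hv hw
    | smul y v _ hv => exact smul_mem_of_ι_smul_mem hWι y hv
  let δ' : Module.End ℂ (S.VB 𝒱) :=
    ((S.idealB 𝒱).restrictScalars ℂ).liftQ (S.toVB 𝒱 ∘ₗ δ)
      (fun v hv => S.toVB_eq_zero_iff.2 (hideal v hv)) ∘ₗ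
        (Submodule.Quotient.restrictScalarsEquiv ℂ (S.idealB 𝒱)).symm.toLinearMap
  have hδ' : ∀ v, δ' (S.toVB 𝒱 v) = S.toVB 𝒱 (δ v) := fun v => rfl
  refine ⟨δ', ?_, fun n a v => ?_, fun n b v => ?_⟩
  · rw [vacB, hδ', δ1, map_zero]
  · obtain ⟨v, rfl⟩ := S.toVB_surjective 𝒱 v
    rw [← toVB_smul, hδ', hδ', δA, map_add, (S.toVB 𝒱).map_smul, toVB_smul]
  · obtain ⟨v, rfl⟩ := S.toVB_surjective 𝒱 v
    rw [← toVB_smul, hδ', hδ', δB, map_add, (S.toVB 𝒱).map_smul, toVB_smul]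

/-- The component of degree `n` lies in the `n`-eigenspace of the degree operator, and distinct
integers stay distinct in `ℂ`. -/
theorem iSupIndep_gradeVB : iSupIndep (S.gradeVB 𝒱) := by
  obtain ⟨δ, δ1, δA, δB⟩ := exists_degree_VB h
  have hind := (Module.End.eigenspaces_iSupIndep δ).comp
    (Int.cast_injective : Function.Injective (Int.cast : ℤ → ℂ))
  refine hind.mono fun n => ?_
  refine Submodule.map_le_iff_le_comap.2 (Submodule.span_le.2 fun v hv => ?_)
  change S.toVB 𝒱 v ∈ δ.eigenspace (n : ℂ)
  rw [Module.End.mem_eigenspace_iff]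
  induction hv with
  | one => simpa [vacB] using δ1
  | zero_mode a m n v _ ih =>
    rw [toVB_smul, δA, ih, smul_comm, ← add_smul]
    congr 1
    push_cast
    ring
  | one_mode a m n v _ ih =>
    rw [toVB_smul, δB, ih, smul_comm, ← add_smul]
    congr 1
    push_cast
    ring

end Degree

end VertexAlgebroid

/-! ### Homogeneous components of `V_B` and ordered monomials -/

namespace VertexAlgebroid

open UniversalEnvelopingAlgebra OneTruncatedConformalAlgebra

variable {A B : Type*} [CommRing A] [Algebra ℂ A] [AddCommGroup B] [Module ℂ B]
variable {S : VertexAlgebroid A B} {𝒱 : VertexAlgebra S.VL}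

theorem modeA_smul_mem_of_modeB {P : Submodule ℂ (S.VB 𝒱)} {n : ℤ} (hn : n ≠ 0) {a : A}
    {w : S.VB 𝒱} (hw : S.modeB (S.d a) n • w ∈ P) : S.modeA a (n - 1) • w ∈ P := by
  rw [S.modeA_eq hn]
  exact P.smul_mem _ hw

/-- The span of the vectors `b(-m)w` of degree `n`, with `b ∈ B` and `m ≥ 1`. -/
noncomputable def creationSpan (S : VertexAlgebroid A B) (𝒱 : VertexAlgebra S.VL) (n : ℤ) :
    Submodule ℂ (S.VB 𝒱) :=
  Submodule.span ℂ {v | ∃ (b : B) (m : ℤ), 1 ≤ m ∧ ∃ w ∈ S.gradeVB 𝒱 (n - m),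
    v = S.modeB b (-m) • w}

theorem mem_creationSpan (b : B) {m n : ℤ} (hm : 1 ≤ m) {w : S.VB 𝒱}
    (hw : w ∈ S.gradeVB 𝒱 (n - m)) : S.modeB b (-m) • w ∈ S.creationSpan 𝒱 n :=
  Submodule.subset_span ⟨b, m, hm, w, hw, rfl⟩

theorem creationSpan_le {n : ℤ} {P : Submodule ℂ (S.VB 𝒱)} (hP : ∀ b : B, ∀ m : ℤ, 1 ≤ m →
    ∀ w ∈ S.gradeVB 𝒱 (n - m), S.modeB b (-m) • w ∈ P) : S.creationSpan 𝒱 n ≤ P := by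
  refine Submodule.span_le.2 ?_
  rintro _ ⟨b, m, hm, w, hw, rfl⟩
  exact hP b m hm w hw

theorem creationSpan_le_gradeVB (n : ℤ) : S.creationSpan 𝒱 n ≤ S.gradeVB 𝒱 n := by
  refine creationSpan_le fun b m _ w hw => ?_
  convert modeB_smul_mem_gradeVB b (-m) hw using 1
  congr 1
  ring

section Quotient

variable {𝒲 : VertexAlgebra (S.VB 𝒱)} (h : S.toConformal.IsCanonical 𝒱)
  (hf : 𝒱.IsHom 𝒲 (S.toVB 𝒱))
include h hf

theorem vac_eq_vacB : 𝒲.vac = S.vacB 𝒱 := by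
  rw [← hf.map_vac, h.vac_eq, vacB]

theorem mode_inA (a : A) (n : ℤ) (w : S.VB 𝒱) : 𝒲.mode (S.inA 𝒱 a) n w = S.modeA a n • w := by
  obtain ⟨w, rfl⟩ := S.toVB_surjective 𝒱 w
  rw [inA_apply, vacB, ← toVB_smul, ← hf.map_mode, modeA, h.mode_zero, toVB_smul]

theorem mode_inB (b : B) (n : ℤ) (w : S.VB 𝒱) : 𝒲.mode (S.inB 𝒱 b) n w = S.modeB b n • w := by
  obtain ⟨w, rfl⟩ := S.toVB_surjective 𝒱 w
  rw [inB_apply, vacB, ← toVB_smul, ← hf.map_mode, modeB, h.mode_one, toVB_smul]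

/-- In `V_B` one has `a*b = a₋₁ b`, so the iterate formula expands `(a*b)(n)`; the hypotheses cover
the terms other than the leading one. -/
theorem act_sub_mem {P : Submodule ℂ (S.VB 𝒱)} {a : A} {b : B} {n : ℤ} {w : S.VB 𝒱}
    (h1 : ∀ i : ℕ, S.modeA a (-2 - i) • S.modeB b (n + 1 + i) • w ∈ P)
    (h2 : ∀ i : ℕ, S.modeB b (n - 1 - i) • S.modeA a i • w ∈ P) :
    S.modeB (S.act a b) n • w - S.modeA a (-1) • S.modeB b n • w ∈ P := by
  have key := 𝒲.mode_mode_sub_mem (P := P) (u := S.inA 𝒱 a) (v := S.inB 𝒱 b) (w := w) (n := n)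
  simp only [mode_inA h hf, mode_inB h hf, modeA_inB] at key
  exact key h1 h2

/-- `a(-1)b(-m)w` equals `(a*b)(-m)w` up to terms starting with `a(-2-i)`, a multiple of
`(∂a)(-1-i)`, or with `b(-m-1-i)`. -/
theorem modeA_smul_mem_creationSpan (a : A) {n : ℤ} {w : S.VB 𝒱} (hw : w ∈ S.creationSpan 𝒱 n) :
    S.modeA a (-1) • w ∈ S.creationSpan 𝒱 n := by
  rw [creationSpan] at hw
  induction hw using Submodule.span_induction with
  | zero => rw [smul_zero]; exact zero_mem _
  | add v w _ _ hv hw => rw [smul_add]; exact add_mem hv hw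
  | smul c v _ hv => rw [smul_comm]; exact Submodule.smul_mem _ c hv
  | mem v hv =>
    obtain ⟨b, m, hm, w, hw, rfl⟩ := hv
    have h1 := mem_creationSpan (S.act a b) hm hw
    refine ((S.creationSpan 𝒱 n).sub_mem_iff_right h1).1 (act_sub_mem h hf (fun i => ?_) fun i => ?_)
    · rw [show (-2 : ℤ) - i = -(1 + i) - 1 by ring]
      refine modeA_smul_mem_of_modeB (by omega) (mem_creationSpan _ (by omega) ?_)
      convert modeB_smul_mem_gradeVB b (-m + 1 + i) hw using 1
      congr 1
      ring
    · rw [show -m - 1 - (i : ℤ) = -(m + 1 + i) by ring]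
      refine mem_creationSpan _ (by omega) ?_
      convert modeA_smul_mem_gradeVB a i hw using 1
      congr 1
      ring

/-- The candidates lie in the corresponding components and together span `V_B`, being stable under
creation operators; independence of the components forces equality. -/
theorem gradeVB_eq (n : ℤ) : S.gradeVB 𝒱 n
    = if n = 0 then LinearMap.range (S.inA 𝒱) else if 0 < n then S.creationSpan 𝒱 n else ⊥ := by
  set F : ℤ → Submodule ℂ (S.VB 𝒱) := fun n =>
    if n = 0 then LinearMap.range (S.inA 𝒱) else if 0 < n then S.creationSpan 𝒱 n else ⊥ with hF
  have F0 : F 0 = LinearMap.range (S.inA 𝒱) := if_pos rfl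
  have F1 : ∀ n, 0 < n → F n = S.creationSpan 𝒱 n := fun n hn => by
    rw [hF]
    exact (if_neg (by omega)).trans (if_pos hn)
  have F2 : ∀ n, n < 0 → F n = ⊥ := fun n hn => by
    rw [hF]
    exact (if_neg (by omega)).trans (if_neg (by omega))
  have hle : ∀ n, F n ≤ S.gradeVB 𝒱 n := by
    intro n
    rcases lt_trichotomy n 0 with hn | rfl | hn
    · rw [F2 n hn]
      exact bot_le
    · rw [F0]
      rintro _ ⟨a, rfl⟩
      exact inA_mem_gradeVB a
    · rw [F1 n hn]
      exact creationSpan_le_gradeVB n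
  have hmem : ∀ {n v}, v ∈ F n → v ∈ ⨆ n, F n := fun {n v} hv => Submodule.mem_iSup_of_mem n hv
  have htop : ⨆ n, F n = ⊤ := by
    refine VB_creation_induction ?_ (fun a w hw => ?_) fun n hn b w hw => ?_
    · refine hmem (n := 0) ?_
      rw [F0, ← inA_one]
      exact ⟨1, rfl⟩
    · induction hw using Submodule.iSup_induction' with
      | zero => rw [smul_zero]; exact zero_mem _
      | add v w _ _ hv hw => rw [smul_add]; exact add_mem hv hw
      | mem n w hw =>
        refine hmem (n := n) ?_
        rcases lt_trichotomy n 0 with hn | rfl | hn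
        · rw [F2 n hn, Submodule.mem_bot] at hw
          rw [hw, smul_zero]
          exact zero_mem _
        · rw [F0] at hw ⊢
          obtain ⟨a', rfl⟩ := hw
          exact ⟨a * a', (modeA_inA a a').symm⟩
        · rw [F1 n hn] at hw ⊢
          exact modeA_smul_mem_creationSpan h hf a hw
    · induction hw using Submodule.iSup_induction' with
      | zero => rw [smul_zero]; exact zero_mem _
      | add v w _ _ hv hw => rw [smul_add]; exact add_mem hv hw
      | mem k w hw =>
        rcases lt_or_ge k 0 with hk | hk
        · rw [F2 k hk, Submodule.mem_bot] at hw
          rw [hw, smul_zero]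
          exact zero_mem _
        · refine hmem (n := k - n) ?_
          rw [F1 _ (by omega), ← neg_neg n]
          refine mem_creationSpan b (by omega) ?_
          convert hle k hw using 2
          ring
  exact (eq_of_le_of_iSup_eq_top hle (iSupIndep_gradeVB h) htop n).symm

theorem gradeVB_zero : S.gradeVB 𝒱 0 = LinearMap.range (S.inA 𝒱) := by
  rw [gradeVB_eq h hf, if_pos rfl]

theorem gradeVB_of_neg {n : ℤ} (hn : n < 0) : S.gradeVB 𝒱 n = ⊥ := by
  rw [gradeVB_eq h hf, if_neg (by omega), if_neg (by omega)]

theorem gradeVB_of_pos {n : ℤ} (hn : 0 < n) : S.gradeVB 𝒱 n = S.creationSpan 𝒱 n := by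
  rw [gradeVB_eq h hf, if_neg (by omega), if_pos hn]

theorem iSup_gradeVB : ⨆ n, S.gradeVB 𝒱 n = ⊤ := by
  refine VB_creation_induction ?_ (fun a w hw => ?_) fun n _ b w hw => ?_
  · exact Submodule.mem_iSup_of_mem 0 vacB_mem_gradeVB
  · induction hw using Submodule.iSup_induction' with
    | zero => rw [smul_zero]; exact zero_mem _
    | add v w _ _ hv hw => rw [smul_add]; exact add_mem hv hw
    | mem n w hw => exact Submodule.mem_iSup_of_mem _ (modeA_smul_mem_gradeVB a (-1) hw)
  · induction hw using Submodule.iSup_induction' with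
    | zero => rw [smul_zero]; exact zero_mem _
    | add v w _ _ hv hw => rw [smul_add]; exact add_mem hv hw
    | mem k w hw => exact Submodule.mem_iSup_of_mem _ (modeB_smul_mem_gradeVB b n hw)

theorem isNGraded : 𝒲.IsNGraded (S.gradeVB 𝒱) where
  isInternal := (DirectSum.isInternal_submodule_iff_iSupIndep_and_iSup_eq_top _).2
    ⟨iSupIndep_gradeVB h, iSup_gradeVB h hf⟩
  eq_bot_of_neg _ hn := gradeVB_of_neg h hf hn
  vac_mem := by
    rw [vac_eq_vacB h hf]
    exact vacB_mem_gradeVB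
  mode_mem := by
    rintro k n m _ ⟨u, hu, rfl⟩ _ ⟨v, hv, rfl⟩
    rw [← hf.map_mode]
    exact ⟨_, h.mode_mem_gradeVL hu hv m, rfl⟩

/-- In degree 1 only `b(-1)a` with `a ∈ A` occurs, and it equals `a*b + ∂(π(b)(a))`. -/
theorem gradeVB_one : S.gradeVB 𝒱 1 = LinearMap.range (S.inB 𝒱) := by
  refine le_antisymm ?_ ?_
  · rw [gradeVB_of_pos h hf one_pos]
    refine creationSpan_le fun b m hm w hw => ?_
    rcases hm.eq_or_lt with rfl | hm
    · rw [sub_self, gradeVB_zero h hf] at hw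
      obtain ⟨a, rfl⟩ := hw
      refine ⟨S.act a b + S.d (S.anchor b a), ?_⟩
      rw [inA_apply, modeB_modeA, ← inB_apply, modeA_inB, map_add, ← modeA_neg_two]
      rfl
    · rw [gradeVB_of_neg h hf (by omega), Submodule.mem_bot] at hw
      rw [hw, smul_zero]
      exact zero_mem _
  · rintro _ ⟨b, rfl⟩
    simpa [inB_apply] using modeB_smul_mem_gradeVB b (-1) (vacB_mem_gradeVB (𝒱 := 𝒱))

theorem generatedBy : 𝒲.GeneratedBy (Set.range (S.inA 𝒱) ∪ Set.range (S.inB 𝒱)) := by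
  intro W hvac hW hs
  refine VB_creation_induction ?_ (fun a w hw => ?_) fun n _ b w hw => ?_
  · rwa [← vac_eq_vacB h hf]
  · rw [← mode_inA h hf]
    exact hW _ (hs (Or.inl ⟨a, rfl⟩)) _ hw _
  · rw [← mode_inB h hf]
    exact hW _ (hs (Or.inr ⟨b, rfl⟩)) _ hw _

end Quotient

/-- The monomials `b₁(-n₁) ⋯ b_k(-n_k)𝟏` with `p ≥ n₁ ≥ ⋯ ≥ n_k ≥ 1` and `n₁ + ⋯ + n_k = n`. -/
inductive IsOrdered (S : VertexAlgebroid A B) (𝒱 : VertexAlgebra S.VL) : ℤ → ℤ → S.VB 𝒱 → Prop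
  | vac (p : ℤ) : IsOrdered S 𝒱 p 0 (S.vacB 𝒱)
  | cons {p m n : ℤ} {v : S.VB 𝒱} (b : B) : 1 ≤ m → m ≤ p → IsOrdered S 𝒱 m n v →
      IsOrdered S 𝒱 p (m + n) (S.modeB b (-m) • v)

theorem IsOrdered.mem_gradeVB {p n : ℤ} {v : S.VB 𝒱} (hv : S.IsOrdered 𝒱 p n v) :
    v ∈ S.gradeVB 𝒱 n := by
  induction hv with
  | vac p => exact vacB_mem_gradeVB
  | cons b _ _ _ ih =>
    convert modeB_smul_mem_gradeVB b _ ih using 2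
    ring

theorem IsOrdered.exists_eq {p n : ℤ} {v : S.VB 𝒱} (hv : S.IsOrdered 𝒱 p n v) :
    ∃ (k : ℕ) (b : Fin k → B) (q : Fin k → ℕ), Antitone q ∧ (∀ i, 1 ≤ q i) ∧ (∀ i, (q i : ℤ) ≤ p) ∧
      ((∑ i, q i : ℕ) : ℤ) = n ∧
      v = (List.ofFn fun i => S.modeB (b i) (-(q i : ℤ))).prod • S.vacB 𝒱 := by
  induction hv with
  | vac p => exact ⟨0, Fin.elim0, Fin.elim0, fun i => i.elim0, fun i => i.elim0, fun i => i.elim0,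
      by simp, by simp⟩
  | @cons p m n v b hm hmp _ ih =>
    obtain ⟨k, b', q, hq, hq1, hqm, hsum, rfl⟩ := ih
    lift m to ℕ using by omega
    refine ⟨k + 1, Fin.cons b b', Fin.cons m q, fun i j hij => ?_, fun i => ?_, fun i => ?_, ?_, ?_⟩
    · induction j using Fin.cases with
      | zero => rw [Fin.le_zero_iff.1 hij]
      | succ j =>
        induction i using Fin.cases with
        | zero => simpa using hqm j
        | succ i => simpa using hq (Fin.succ_le_succ_iff.1 hij)
    · induction i using Fin.cases with
      | zero => simpa using hm
      | succ i => simpa using hq1 i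
    · induction i using Fin.cases with
      | zero => simpa using hmp
      | succ i => simpa using (hqm i).trans hmp
    · rw [Fin.sum_univ_succ]
      push_cast at hsum ⊢
      simp [hsum]
    · rw [List.ofFn_succ, List.prod_cons, mul_smul]
      rfl

theorem IsOrdered.mem_monomialsB {p : ℤ} {n : ℕ} {v : S.VB 𝒱} (hv : S.IsOrdered 𝒱 p n v) :
    v ∈ S.monomialsB 𝒱 n := by
  obtain ⟨k, b, q, hq, hq1, -, hsum, hv⟩ := hv.exists_eq
  exact ⟨k, b, q, hq, hq1, by exact_mod_cast hsum, hv⟩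

theorem monomialsB_subset_gradeVB (n : ℕ) : S.monomialsB 𝒱 n ⊆ S.gradeVB 𝒱 n := by
  rintro _ ⟨k, b, q, -, -, rfl, rfl⟩
  induction k with
  | zero => simpa using vacB_mem_gradeVB
  | succ k ih =>
    rw [List.ofFn_succ, List.prod_cons, mul_smul, Fin.sum_univ_succ, SetLike.mem_coe,
      Nat.cast_add, add_comm, ← sub_neg_eq_add]
    exact modeB_smul_mem_gradeVB (b 0) _ (ih (fun i => b i.succ) fun i => q i.succ)

/-- The span of the ordered monomials of degree `n`. -/
noncomputable def orderedSpan (S : VertexAlgebroid A B) (𝒱 : VertexAlgebra S.VL) (n : ℤ) :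
    Submodule ℂ (S.VB 𝒱) :=
  Submodule.span ℂ {v | ∃ p, S.IsOrdered 𝒱 p n v}

theorem one_letter_mem (b : B) {n : ℤ} (hn : 1 ≤ n) :
    S.modeB b (-n) • S.vacB 𝒱 ∈ S.orderedSpan 𝒱 n := by
  refine Submodule.subset_span ⟨n, ?_⟩
  simpa using IsOrdered.cons b hn le_rfl (.vac n)

/-- Exchanging the letters costs only one-letter words: `[b, b'](-m-n)𝟏` and a multiple of `(∂⟨b,
b'⟩)(-m-n)𝟏`. -/
theorem two_letter_mem (b b' : B) {m n : ℤ} (hm : 1 ≤ m) (hn : 1 ≤ n) :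
    S.modeB b (-m) • S.modeB b' (-n) • S.vacB 𝒱 ∈ S.orderedSpan 𝒱 (m + n) := by
  have hord : ∀ (b b' : B) {m n : ℤ}, 1 ≤ n → n ≤ m →
      S.modeB b (-m) • S.modeB b' (-n) • S.vacB 𝒱 ∈ S.orderedSpan 𝒱 (m + n) := by
    intro b b' m n hn hnm
    refine Submodule.subset_span ⟨m, ?_⟩
    simpa using IsOrdered.cons b (hn.trans hnm) le_rfl (.cons b' hn hnm (.vac n))
  rcases le_total n m with hnm | hmn
  · exact hord b b' hn hnm
  · rw [modeB_modeB, show -m + -n = -(m + n) by ring]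
    refine add_mem ?_ (add_mem (one_letter_mem _ (by omega)) (Submodule.smul_mem _ _
      (modeA_smul_mem_of_modeB (by omega) (one_letter_mem _ (by omega)))))
    rw [add_comm m n]
    exact hord b' b hm hmn

/-- Strong induction on the degree `n` orders the tail `w` of `b(-m)w`. Within a fixed degree,
descending induction on `m`, measured by `n - m`, handles the reordering. -/
theorem gradeVB_le_orderedSpan {𝒲 : VertexAlgebra (S.VB 𝒱)} (h : S.toConformal.IsCanonical 𝒱)
    (hf : 𝒱.IsHom 𝒲 (S.toVB 𝒱)) (n : ℕ) (hn : 1 ≤ n) :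
    S.gradeVB 𝒱 n ≤ S.orderedSpan 𝒱 n := by
  induction n using Nat.strong_induction_on with
  | _ n ih =>
  have main : ∀ k : ℕ, ∀ m : ℤ, 1 ≤ m → (n : ℤ) - m < k → ∀ b : B, ∀ w ∈ S.gradeVB 𝒱 (n - m),
      S.modeB b (-m) • w ∈ S.orderedSpan 𝒱 n := by
    intro k
    induction k with
    | zero =>
      intro m hm hk b w hw
      rw [gradeVB_of_neg h hf (by exact_mod_cast hk), Submodule.mem_bot] at hw
      rw [hw, smul_zero]
      exact zero_mem _
    | succ k ihk =>
      intro m hm hk b w hw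
      rcases lt_trichotomy (n : ℤ) m with hnm | rfl | hmn
      · rw [gradeVB_of_neg h hf (by omega), Submodule.mem_bot] at hw
        rw [hw, smul_zero]
        exact zero_mem _
      -- Here `w` is some `a ∈ A`. The word `a(-1)b(-n)𝟏` is `(a*b)(-n)𝟏` up to two-letter words
      -- starting with `(∂a)(-1-i)`, which do not need the induction.
      · rw [sub_self, gradeVB_zero h hf] at hw
        obtain ⟨a, rfl⟩ := hw
        rw [inA_apply, modeB_modeA]
        refine add_mem ?_ ?_
        · refine ((S.orderedSpan 𝒱 n).sub_mem_iff_right (one_letter_mem (S.act a b) hm)).1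
            (act_sub_mem h hf (fun i => ?_) fun i => ?_)
          · rcases le_or_gt 0 (-(n : ℤ) + 1 + i) with hi | hi
            · rw [modeB_vacB hi, smul_zero]
              exact zero_mem _
            · rw [show (-2 : ℤ) - i = -(1 + i) - 1 by ring]
              refine modeA_smul_mem_of_modeB (by omega) ?_
              have := two_letter_mem (𝒱 := 𝒱) (S.d a) b (m := 1 + i) (n := n - 1 - i) (by omega)
                (by omega)
              rwa [show -((n : ℤ) - 1 - i) = -n + 1 + i by ring,
                show 1 + (i : ℤ) + (n - 1 - i) = n by ring] at this
          · rw [modeA_vacB (by omega), smul_zero]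
            exact zero_mem _
        · exact modeA_smul_mem_of_modeB (by omega) (one_letter_mem _ hm)
      · have hw' : w ∈ S.orderedSpan 𝒱 (n - m) := by
          have := ih (n - m).toNat (by omega) (by omega)
          rw [Int.toNat_of_nonneg (by omega)] at this
          exact this hw
        rw [orderedSpan] at hw'
        clear hw
        induction hw' using Submodule.span_induction with
        | zero => rw [smul_zero]; exact zero_mem _
        | add v w _ _ hv hw => rw [smul_add]; exact add_mem hv hw
        | smul c v _ hv => rw [smul_comm]; exact Submodule.smul_mem _ c hv
        | mem w hw =>
          obtain ⟨p, hw⟩ := hw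
          generalize hs : (n : ℤ) - m = s at hw
          cases hw with
          | vac p => omega
          | @cons p m₁ n₁ v b₁ hm₁ _ hv =>
            -- If `m₁ > m`, exchanging the first two letters makes `m₁` lead, and the commutator
            -- terms start with a mode of index `-(m + m₁)`; all are covered by the inner induction.
            rcases le_or_gt m₁ m with hle | hgt
            · refine Submodule.subset_span ⟨m, ?_⟩
              have := IsOrdered.cons b hm le_rfl (.cons b₁ hm₁ hle hv)
              rwa [← hs, add_sub_cancel] at this
            · have hv' := hv.mem_gradeVB
              have hn₁ : n₁ = n - m - m₁ := by omega
              rw [modeB_modeB, show -m + -m₁ = -(m + m₁) by ring]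
              have hv'' : v ∈ S.gradeVB 𝒱 (n - (m + m₁)) := by
                rwa [← sub_sub, ← hn₁]
              refine add_mem (ihk m₁ hm₁ (by omega) _ _ ?_) (add_mem
                (ihk _ (by omega) (by omega) _ _ hv'') (Submodule.smul_mem _ _
                (modeA_smul_mem_of_modeB (by omega) (ihk _ (by omega) (by omega) _ _ hv''))))
              convert modeB_smul_mem_gradeVB b (-m) hv' using 1
              congr 1
              omega
  rw [gradeVB_of_pos h hf (by omega)]
  exact creationSpan_le fun b m hm w hw => main (n + 1) m hm (by push_cast; omega) b w hw

theorem gradeVB_eq_span {𝒲 : VertexAlgebra (S.VB 𝒱)} (h : S.toConformal.IsCanonical 𝒱)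
    (hf : 𝒱.IsHom 𝒲 (S.toVB 𝒱)) (n : ℕ) (hn : 1 ≤ n) :
    S.gradeVB 𝒱 n = Submodule.span ℂ (S.monomialsB 𝒱 n) := by
  refine le_antisymm ((gradeVB_le_orderedSpan h hf n hn).trans (Submodule.span_mono ?_))
    (Submodule.span_le.2 (monomialsB_subset_gradeVB n))
  rintro v ⟨p, hv⟩
  exact hv.mem_monomialsB

end VertexAlgebroid

/-! ### The main theorem -/

theorem theorem4p5 {A B : Type*} [CommRing A] [Algebra ℂ A] [AddCommGroup B] [Module ℂ B]
    (S : VertexAlgebroid A B) :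
    ∃ 𝒱 : VertexAlgebra S.VL,
      -- the vertex algebra `V_𝓛`
      (S.toConformal.IsCanonical 𝒱 ∧
        ∀ 𝒱' : VertexAlgebra S.VL, S.toConformal.IsCanonical 𝒱' → 𝒱' = 𝒱) ∧
      ∃ 𝒲 : VertexAlgebra (S.VB 𝒱),
        -- the quotient vertex algebra `V_B = V_𝓛/I_B`
        (𝒱.IsHom 𝒲 (S.toVB 𝒱) ∧
          ∀ 𝒲' : VertexAlgebra (S.VB 𝒱), 𝒱.IsHom 𝒲' (S.toVB 𝒱) → 𝒲' = 𝒲) ∧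
        𝒲.IsNGraded (S.gradeVB 𝒱) ∧
        -- `(V_B)₍₀₎ = A` and `(V_B)₍₁₎ = B`
        (Function.Injective (S.inA 𝒱) ∧ LinearMap.range (S.inA 𝒱) = S.gradeVB 𝒱 0) ∧
        (Function.Injective (S.inB 𝒱) ∧ LinearMap.range (S.inB 𝒱) = S.gradeVB 𝒱 1) ∧
        -- these identifications respect the structure of `A` and of `B`
        (S.inA 𝒱 1 = 𝒲.vac ∧
          (∀ a a' : A, 𝒲.mode (S.inA 𝒱 a) (-1) (S.inA 𝒱 a') = S.inA 𝒱 (a * a')) ∧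
          (∀ (a : A) (b : B), 𝒲.mode (S.inA 𝒱 a) (-1) (S.inB 𝒱 b) = S.inB 𝒱 (S.act a b)) ∧
          (∀ (b : B) (a : A), 𝒲.mode (S.inB 𝒱 b) 0 (S.inA 𝒱 a) = S.inA 𝒱 (S.anchor b a)) ∧
          (∀ b b' : B, 𝒲.mode (S.inB 𝒱 b) 0 (S.inB 𝒱 b') = S.inB 𝒱 (S.br b b')) ∧
          (∀ b b' : B, 𝒲.mode (S.inB 𝒱 b) 1 (S.inB 𝒱 b') = S.inA 𝒱 (S.pair b b')) ∧
          (∀ a : A, 𝒲.D (S.inA 𝒱 a) = S.inB 𝒱 (S.d a))) ∧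
        -- generation by `A ⊕ B`
        𝒲.GeneratedBy (Set.range (S.inA 𝒱) ∪ Set.range (S.inB 𝒱)) ∧
        -- the spanning monomials
        ∀ n : ℕ, 1 ≤ n → S.gradeVB 𝒱 n = Submodule.span ℂ (S.monomialsB 𝒱 n) := by
  obtain ⟨𝒱, -, h, -⟩ := S.toConformal.exists_isCanonical
  obtain ⟨𝒲, hf⟩ := VertexAlgebroid.exists_quotient h
  refine ⟨𝒱, ⟨h, fun 𝒱' h' => h.unique h'⟩, 𝒲,
    ⟨hf, fun 𝒲' h' => hf.unique (S.toVB_surjective 𝒱) h'⟩, VertexAlgebroid.isNGraded h hf,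
    ⟨VertexAlgebroid.inA_injective h, (VertexAlgebroid.gradeVB_zero h hf).symm⟩,
    ⟨VertexAlgebroid.inB_injective h, (VertexAlgebroid.gradeVB_one h hf).symm⟩,
    ⟨?_, fun a a' => ?_, fun a b => ?_, fun b a => ?_, fun b b' => ?_, fun b b' => ?_, fun a => ?_⟩,
    VertexAlgebroid.generatedBy h hf, VertexAlgebroid.gradeVB_eq_span h hf⟩
  · rw [VertexAlgebroid.inA_one, VertexAlgebroid.vac_eq_vacB h hf]
  · rw [VertexAlgebroid.mode_inA h hf, VertexAlgebroid.modeA_inA]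
  · rw [VertexAlgebroid.mode_inA h hf, VertexAlgebroid.modeA_inB]
  · rw [VertexAlgebroid.mode_inB h hf, VertexAlgebroid.modeB_zero_inA]
  · rw [VertexAlgebroid.mode_inB h hf, VertexAlgebroid.modeB_zero_inB]
  · rw [VertexAlgebroid.mode_inB h hf, VertexAlgebroid.modeB_one_inB]
  · rw [VertexAlgebra.D, VertexAlgebroid.mode_inA h hf, VertexAlgebroid.vac_eq_vacB h hf,
      VertexAlgebroid.modeA_neg_two]
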